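/- Let $\mathbb T=\mathbb R/L\mathbb Z$ with $L>0$, and let $g,\lambda,\alpha,\beta,R,P>0$ be constants. Let $\psi_0\in H^1(\mathbb T;\mathbb C)$ and let $n_0\in H^1(\mathbb T;\mathbb R)$ with $n_0(x)>0$ for all $x$. For $\varepsilon>0$ consider the system $$ i\partial_t\psi=-\tfrac12\partial_x^2\psi+g|\psi|^2\psi+\lambda n\psi+\tfrac i2(Rn-\alpha)\psi,\qquad \varepsilon\,\partial_t n=P-(R|\psi|^2+\beta)n, \tag{1}$$ and the adiabatic damped-driven Gross–Pitaevskii equation $$ i\partial_t\psi=-\tfrac12\partial_x^2\psi+g|\psi|^2\psi+\frac{\lambda P\,\psi}{\beta+R|\psi|^2}+\tfrac i2\Big(\frac{PR}{\beta+R|\psi|^2}-\alpha\Big)\psi. \tag{2}$$ Solutions are understood in the mild sense (Duhamel's formula): solutions of (1) are continuous in time with values in $H^1(\mathbb T)\times H^1(\mathbb T)$, solutions of (2) are continuous in time with values in $H^1(\mathbb T)$. For every $\varepsilon>0$ there is a unique global solution $(\psi^\varepsilon,n^\varepsilon)\in C([0,\infty);H^1\times H^1)$ of (1) with initial data $(\psi_0,n_0)$.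 Moreover, there is a function $\psi\in C([0,\infty);H^1(\mathbb T))$, depending only on $\psi_0$ and the constants $L,g,\lambda,\alpha,\beta,R,P$, with the following properties, where $n:=P/(\beta+R|\psi|^2)$. 1. Every sequence $\varepsilon_k\to0$ with $\varepsilon_k>0$ has a subsequence along which, for all $T\ge0$ (the subsequence does not depend on $T$), $\psi^{\varepsilon_k}\to\psi$ in $C([0,T]\times\mathbb T)$ and $n^{\varepsilon_k}\rightharpoonup n$ weak-$*$ in $L^\infty((0,T)\times\mathbb T)$. 2. $\psi$ is a global solution of (2) with initial datum $\psi_0$, with finite energy $\int_{\mathbb T}\big(\tfrac12|\partial_x\psi|^2+\tfrac g2|\psi|^4+\lambda n|\psi|^2\big)\,dx<\infty$ at every time $t\ge0$; and for every $T>0$ its restriction to $[0,T]$ is the unique solution of (2) in $C([0,T];H^1(\mathbb T))$ with initial datum $\psi_0$. In particular, (2) has a unique global solution in $C([0,\infty);H^1(\mathbb T))$ for every $\psi_0\in H^1(\mathbb T)$. -/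

import Mathlib

open Filter Topology MeasureTheory Set

noncomputable section

namespace GrossPitaevskii

/-- The physical constants of the model: `g` (self-interaction), `lam` (coupling with the
reservoir), the loss rates `α` (of the wave function) and `β` (of the reservoir), `R`
(stimulated scattering) and `P` (creation rate). All of them are positive. -/
structure Constants where
  g : ℝ
  lam : ℝ
  α : ℝ
  β : ℝ
  R : ℝ
  P : ℝ
  g_pos : 0 < g
  lam_pos : 0 < lam
  α_pos : 0 < α
  β_pos : 0 < β
  R_pos : 0 < R
  P_pos : 0 < P

variable {L : ℝ} [Fact (0 < L)]

/-- The wave number `2πk/L` of the `k`-th Fourier mode on the torus of length `L`. -/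
def waveNumber (L : ℝ) (k : ℤ) : ℝ := 2 * Real.pi * k / L

/-- The Sobolev space `H¹` on the torus of length `L`; its elements are represented by
their continuous representatives (one-dimensional Sobolev embedding). -/
structure MemH1 (f : AddCircle L → ℂ) : Prop where
  continuous : Continuous f
  summable : Summable fun k : ℤ => (1 + waveNumber L k ^ 2) * ‖fourierCoeff f k‖ ^ 2

/-- The `H¹` norm. `fourierCoeff` is normalised by the length of the torus, so by Parseval
this is the square root of `∫ |f|² + |∂ₓf|²`. -/
def h1Norm (f : AddCircle L → ℂ) : ℝ :=
  Real.sqrt (L * ∑' k : ℤ, (1 + waveNumber L k ^ 2) * ‖fourierCoeff f k‖ ^ 2)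

/-- The class `C(I; H¹)`. -/
def ContinuousOnH1 (u : ℝ → AddCircle L → ℂ) (I : Set ℝ) : Prop :=
  (∀ t ∈ I, MemH1 (u t)) ∧
    ∀ t ∈ I, Tendsto (fun s => h1Norm (u s - u t)) (𝓝[I] t) (𝓝 0)

/-- The free Schrödinger group `exp(i t ∂ₓ² / 2)`, as a Fourier multiplier. On `H¹` the
Fourier series converges absolutely. -/
def freeGroup (t : ℝ) (f : AddCircle L → ℂ) (x : AddCircle L) : ℂ :=
  ∑' k : ℤ, Complex.exp (-(Complex.I / 2) * (t * waveNumber L k ^ 2 : ℝ)) *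
    fourierCoeff f k * fourier k x

/-- The zeroth-order part of the equation for `∂ₜψ`:
`-ig|ψ|²ψ - iλnψ + (Rn - α)ψ/2`, at a point where `ψ = z` and the reservoir density is `n`. -/
def waveForcing (c : Constants) (z : ℂ) (n : ℝ) : ℂ :=
  -Complex.I * c.g * (‖z‖ ^ 2 : ℝ) * z - Complex.I * c.lam * n * z
    + (1 / 2 : ℂ) * (c.R * n - c.α : ℝ) * z

/-- The adiabatic reservoir density `P / (β + R|ψ|²)`, at a point where `ψ = z`. -/
def adiabaticDensity (c : Constants) (z : ℂ) : ℝ := c.P / (c.β + c.R * ‖z‖ ^ 2)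

/-- `(ψ, n) ∈ C(I; H¹ × H¹)` is a mild solution, on the time interval `I` (starting at `0`),
with initial data `(ψ₀, n₀)`, of
`i∂ₜψ = -½∂ₓ²ψ + g|ψ|²ψ + λnψ + (i/2)(Rn - α)ψ`, `ε∂ₜn = P - (R|ψ|² + β)n`. -/
structure IsGPSolution (c : Constants) (ε : ℝ) (ψ₀ : AddCircle L → ℂ) (n₀ : AddCircle L → ℝ)
    (I : Set ℝ) (ψ : ℝ → AddCircle L → ℂ) (n : ℝ → AddCircle L → ℝ) : Prop where
  wave_continuous : ContinuousOnH1 ψ I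
  density_continuous : ContinuousOnH1 (fun t x => (n t x : ℂ)) I
  wave_duhamel : ∀ t ∈ I, ∀ x,
    ψ t x = freeGroup t ψ₀ x +
      ∫ τ in (0 : ℝ)..t, freeGroup (t - τ) (fun y => waveForcing c (ψ τ y) (n τ y)) x
  density_duhamel : ∀ t ∈ I, ∀ x,
    n t x = Real.exp (-(c.β / ε) * t) * n₀ x +
      ∫ τ in (0 : ℝ)..t, Real.exp (-(c.β / ε) * (t - τ)) *
        ((c.P - c.R * ‖ψ τ x‖ ^ 2 * n τ x) / ε)

/-- `ψ ∈ C(I; H¹)` is a mild solution, on the time interval `I` (starting at `0`), with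
initial datum `ψ₀`, of the adiabatic damped-driven equation
`i∂ₜψ = -½∂ₓ²ψ + g|ψ|²ψ + λPψ/(β + R|ψ|²) + (i/2)(PR/(β + R|ψ|²) - α)ψ`. -/
structure IsAdiabaticSolution (c : Constants) (ψ₀ : AddCircle L → ℂ) (I : Set ℝ)
    (ψ : ℝ → AddCircle L → ℂ) : Prop where
  continuous : ContinuousOnH1 ψ I
  duhamel : ∀ t ∈ I, ∀ x,
    ψ t x = freeGroup t ψ₀ x +
      ∫ τ in (0 : ℝ)..t,
        freeGroup (t - τ) (fun y => waveForcing c (ψ τ y) (adiabaticDensity c (ψ τ y))) x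

/-- The energy `∫ ½|∂ₓψ|² + (g/2)|ψ|⁴ + λn|ψ|²` for a nonnegative density `n`, with values
in `[0, ∞]`; the kinetic part is written by Parseval. -/
def energy (c : Constants) (ψ : AddCircle L → ℂ) (n : AddCircle L → ℝ) : ENNReal :=
  (∑' k : ℤ, ENNReal.ofReal (L / 2 * waveNumber L k ^ 2 * ‖fourierCoeff ψ k‖ ^ 2)) +
    ∫⁻ x, ENNReal.ofReal (c.g / 2 * ‖ψ x‖ ^ 4 + c.lam * n x * ‖ψ x‖ ^ 2)

/-- `u k → v` in `C([0,T] × 𝕋)`. -/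
def TendstoInC (T : ℝ) (u : ℕ → ℝ → AddCircle L → ℂ) (v : ℝ → AddCircle L → ℂ) : Prop :=
  (∀ k, ContinuousOn (fun p : ℝ × AddCircle L => u k p.1 p.2) (Icc 0 T ×ˢ univ)) ∧
  ContinuousOn (fun p : ℝ × AddCircle L => v p.1 p.2) (Icc 0 T ×ˢ univ) ∧
  TendstoUniformlyOn (fun k (p : ℝ × AddCircle L) => u k p.1 p.2) (fun p => v p.1 p.2) atTop
    (Icc 0 T ×ˢ univ)

/-- `m k → n` weak-* in `L^∞((0,T) × 𝕋)`, i.e. when tested against `L¹((0,T) × 𝕋)`. -/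
def TendstoWeakStar (T : ℝ) (m : ℕ → ℝ → AddCircle L → ℝ) (n : ℝ → AddCircle L → ℝ) : Prop :=
  let μ : Measure (ℝ × AddCircle L) := volume.restrict (Ioo 0 T ×ˢ univ)
  (∀ k, MemLp (fun p : ℝ × AddCircle L => m k p.1 p.2) ⊤ μ) ∧
  MemLp (fun p : ℝ × AddCircle L => n p.1 p.2) ⊤ μ ∧
  ∀ φ : ℝ × AddCircle L → ℝ, Integrable φ μ →
    Tendsto (fun k => ∫ p, m k p.1 p.2 * φ p ∂μ) atTop (𝓝 (∫ p, n p.1 p.2 * φ p ∂μ))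

end GrossPitaevskii

end

/-!
The space `H¹(𝕋)` is modelled by the Hilbert space `ℓ²(ℤ)` of weighted Fourier coefficients
(`Coeff`, `ev`). In the interaction picture `v(t) = S(-t)ψ(t)`, where `S` is the free Schrödinger
group, both equations become ordinary differential equations in this space whose fields are
Lipschitz on bounded sets, because `H¹` is an algebra (`exists_mul`, `exists_dens`). Mild solutions
are the same as trajectories of these equations (`duhamel_iff`, `density_duhamel_iff`), so uniqueness
is that of ordinary differential equations, and global existence is a matter of a priori bounds
(`exists_global_trajectory`).

*A priori bounds.* By the maximum principle for the pointwise equation of the reservoir, `n` stays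
between `0` and a constant `N` (`density_bounds`). For the system one considers
`‖ψ‖² + g∫|ψ|⁴ + ε‖n‖²` with `H¹` norms. The contribution of the cubic term to the derivative of
`‖ψ‖²` cancels against the dispersive part of the derivative of the quartic integral
(`hasDerivWithinAt_energy`). The coupling terms contain products such as `|ψ| |∂ₓn| |∂ₓψ|`, which
the term `-R|ψ|²|∂ₓn|²` from the reservoir absorbs (`increment_le`); the resulting bound
(`gp_energy_le`) is uniform in bounded `ε`. Derivatives in `x` are never taken: `H¹` inner products
are limits of `L²` inner products of difference quotients, so it suffices to bound increments
(`re_inner_add_le`). The adiabatic equation is treated in the same way (`adiabatic_energy_le`).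

*The limit.* Let `ψ` solve the adiabatic equation, and let `μ` be the density of the reservoir with
relaxation time `ε` driven by this fixed `ψ`. Since `μ` solves a scalar linear relaxation equation
at each point, it tends to `P/(β + R|ψ|²)` pointwise (`tendsto_relaxation`), hence in `L²` of
space-time (`tendsto_integral_relaxation`). Gronwall's inequality for
`‖ψᵋ - ψ‖² + ε‖nᵋ - μ‖²` in `L²`, in which the decay `-β|nᵋ - μ|²` absorbs the coupling, gives
`ψᵋ → ψ` in `L²` uniformly in time (`comparison_norm_sq_le`). Interpolation with the uniform `H¹`
bound makes the convergence uniform in space-time (`norm_ev_le_interpolation`, `tendsto_wave`), and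
then the pointwise relaxation argument, now with convergent rates, and dominated convergence give
the weak-* convergence of the densities. The limit is identified directly, so no subsequence has to
be extracted.
-/

noncomputable section

namespace GrossPitaevskii

section

/-! ### Fourier multipliers on square-summable sequences -/

/-- Square-summable complex sequences indexed by `ℤ`. They play two roles: a sequence `a` stands
for the element of `H¹` with Fourier coefficients `aₖ / √(1 + wₖ²)`, where `wₖ` is the `k`-th wave
number, so that `‖a‖` is the `H¹` norm up to a constant; and `toL2 L a` is the sequence of these
Fourier coefficients, whose norm is that of `L²`. -/
abbrev Coeff : Type := lp (fun _ : ℤ => ℂ) 2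

theorem Coeff.summable_sq (a : Coeff) : Summable fun k => ‖a k‖ ^ 2 := by
  have := (lp.memℓp a).summable (by norm_num)
  simpa using this

theorem Coeff.norm_sq (a : Coeff) : ‖a‖ ^ 2 = ∑' k, ‖a k‖ ^ 2 := by
  have := lp.norm_rpow_eq_tsum (p := 2) (by norm_num) a
  simpa using this

theorem memℓp_two {f : ℤ → ℂ} (h : Summable fun k => ‖f k‖ ^ 2) :
    Memℓp (E := fun _ : ℤ => ℂ) f 2 :=
  memℓp_gen (by simpa using h)

theorem Coeff.norm_mul_le (m : ℤ → ℂ) (C : ℝ) (hm : ∀ k, ‖m k‖ ≤ C) (a : Coeff) (k : ℤ) :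
    ‖m k * a k‖ ^ 2 ≤ C ^ 2 * ‖a k‖ ^ 2 := by
  rw [norm_mul, mul_pow]
  gcongr
  exact hm k

/-- The multiplier `a ↦ (mₖ aₖ)ₖ` with a symbol bounded by `C`. -/
def multiplier (m : ℤ → ℂ) (C : ℝ) (hm : ∀ k, ‖m k‖ ≤ C) : Coeff →L[ℂ] Coeff :=
  LinearMap.mkContinuous
    { toFun := fun a => ⟨fun k => m k * a k, memℓp_two (.of_nonneg_of_le (fun _ => by positivity)
        (Coeff.norm_mul_le m C hm a) (a.summable_sq.mul_left _))⟩
      map_add' := fun a b => by ext k; exact mul_add _ _ _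
      map_smul' := fun c a => by ext k; exact mul_left_comm _ _ _ }
    C (fun a => by
      have hC : 0 ≤ C := (norm_nonneg _).trans (hm 0)
      refine le_of_sq_le_sq ?_ (by positivity)
      rw [mul_pow, Coeff.norm_sq, Coeff.norm_sq, ← tsum_mul_left]
      refine Summable.tsum_le_tsum (Coeff.norm_mul_le m C hm a) ?_ (a.summable_sq.mul_left _)
      exact .of_nonneg_of_le (fun _ => by positivity)
        (Coeff.norm_mul_le m C hm a) (a.summable_sq.mul_left _))

@[simp] theorem multiplier_apply (m : ℤ → ℂ) (C : ℝ) (hm : ∀ k, ‖m k‖ ≤ C) (a : Coeff) (k : ℤ) :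
    multiplier m C hm a k = m k * a k := rfl

theorem norm_multiplier_le (m : ℤ → ℂ) (C : ℝ) (hm : ∀ k, ‖m k‖ ≤ C) (a : Coeff) :
    ‖multiplier m C hm a‖ ≤ C * ‖a‖ :=
  (ContinuousLinearMap.le_opNorm _ _).trans (mul_le_mul_of_nonneg_right
    (LinearMap.mkContinuous_norm_le _ ((norm_nonneg _).trans (hm 0)) _) (norm_nonneg _))

theorem norm_multiplier_eq (m : ℤ → ℂ) (C : ℝ) (hm : ∀ k, ‖m k‖ ≤ C) (h1 : ∀ k, ‖m k‖ = 1)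
    (a : Coeff) : ‖multiplier m C hm a‖ = ‖a‖ := by
  refine (sq_eq_sq₀ (norm_nonneg _) (norm_nonneg _)).1 ?_
  rw [Coeff.norm_sq, Coeff.norm_sq]
  simp [h1]

/-! ### The Fourier model of `H¹` -/

variable (L : ℝ)

/-- The weight `√(1 + wₖ²)` of the `k`-th mode in the `H¹` norm. -/
def bracket (k : ℤ) : ℝ := Real.sqrt (1 + waveNumber L k ^ 2)

theorem one_le_bracket (k : ℤ) : 1 ≤ bracket L k := by
  rw [bracket, Real.one_le_sqrt]
  nlinarith [sq_nonneg (waveNumber L k)]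

theorem bracket_pos (k : ℤ) : 0 < bracket L k := zero_lt_one.trans_le (one_le_bracket L k)

theorem bracket_sq (k : ℤ) : bracket L k ^ 2 = 1 + waveNumber L k ^ 2 :=
  Real.sq_sqrt (by positivity)

theorem bracket_ne (k : ℤ) : (bracket L k : ℂ) ≠ 0 := by
  exact_mod_cast (bracket_pos L k).ne'

theorem norm_inv_bracket_le (k : ℤ) : ‖((bracket L k)⁻¹ : ℂ)‖ ≤ 1 := by
  rw [norm_inv, Complex.norm_real, Real.norm_of_nonneg (bracket_pos L k).le]
  exact inv_le_one_of_one_le₀ (one_le_bracket L k)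

/-- The inclusion of `H¹` into `L²`: an element is sent to its sequence of Fourier coefficients. -/
def toL2 : Coeff →L[ℂ] Coeff :=
  multiplier (fun k => (bracket L k : ℂ)⁻¹) 1 (norm_inv_bracket_le L)

@[simp] theorem toL2_apply (a : Coeff) (k : ℤ) : toL2 L a k = (bracket L k : ℂ)⁻¹ * a k := rfl

theorem norm_toL2_le (a : Coeff) : ‖toL2 L a‖ ≤ ‖a‖ := by
  exact (norm_multiplier_le _ 1 (norm_inv_bracket_le L) a).trans_eq (one_mul _)

theorem toL2_injective : Function.Injective (toL2 L) := fun a b h => by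
  ext k
  have : toL2 L a k = toL2 L b k := by rw [h]
  simpa [bracket_ne L k] using this

variable [hL : Fact (0 < L)]

theorem summable_inv_bracket_sq : Summable fun k : ℤ => ‖((bracket L k)⁻¹ : ℂ)‖ ^ 2 := by
  have h1 : Summable fun k : ℤ => 1 / (k : ℝ) ^ 2 := by
    simpa using Real.summable_one_div_int_pow (p := 2) |>.2 (by norm_num)
  have hc : 0 < 2 * Real.pi / L := div_pos (by positivity) hL.out
  refine Summable.of_norm_bounded_eventually (h1.mul_left ((2 * Real.pi / L) ^ 2)⁻¹) ?_
  have : ∀ᶠ k : ℤ in cofinite, k ≠ 0 := (Set.finite_singleton (0 : ℤ)).compl_mem_cofinite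
  filter_upwards [this] with k hk
  have hk' : (k : ℝ) ≠ 0 := by exact_mod_cast hk
  rw [norm_inv, Complex.norm_real, Real.norm_of_nonneg (bracket_pos L k).le, inv_pow, bracket_sq,
    Real.norm_of_nonneg (by positivity), one_div, ← mul_inv]
  have h2 : waveNumber L k = 2 * Real.pi / L * k := by rw [waveNumber]; ring
  rw [h2, mul_pow]
  have : 0 < (2 * Real.pi / L) ^ 2 * (k : ℝ) ^ 2 := by positivity
  gcongr
  linarith

/-- The sequence of the inverse weights; its `ℓ²` norm is the Sobolev constant of
`H¹ ⊆ C(𝕋)`. -/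
def sobolevSeq : Coeff := ⟨fun k => (bracket L k : ℂ)⁻¹, memℓp_two (summable_inv_bracket_sq L)⟩

theorem summable_norm_toL2 (a : Coeff) :
    Summable (fun k => ‖toL2 L a k‖) ∧ ∑' k, ‖toL2 L a k‖ ≤ ‖sobolevSeq L‖ * ‖a‖ := by
  have := lp.tsum_mul_le_mul_norm (p := 2) (q := 2)
    (by rw [Real.holderConjugate_iff]; norm_num) (sobolevSeq L) a
  simpa [sobolevSeq] using this

theorem summable_toL2_fourier (a : Coeff) :
    Summable fun k => toL2 L a k • (fourier k : C(AddCircle L, ℂ)) := by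
  refine .of_norm ?_
  simpa [norm_smul, fourier_norm] using (summable_norm_toL2 L a).1

/-- The continuous function on the torus represented by an element of the Fourier model. -/
def ev : Coeff →L[ℂ] C(AddCircle L, ℂ) :=
  LinearMap.mkContinuous
    { toFun := fun a => ∑' k, toL2 L a k • (fourier k : C(AddCircle L, ℂ))
      map_add' := fun a b => by
        rw [← (summable_toL2_fourier L a).tsum_add (summable_toL2_fourier L b)]
        simp [add_smul]
      map_smul' := fun c a => by
        rw [RingHom.id_apply, ← tsum_const_smul'']
        refine tsum_congr fun k => ?_
        rw [← smul_assoc]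
        congr 1
        simp }
    ‖sobolevSeq L‖ (fun a => by
      refine (norm_tsum_le_tsum_norm ?_).trans ?_
      · simpa [norm_smul, fourier_norm] using (summable_norm_toL2 L a).1
      · simpa [norm_smul, fourier_norm] using (summable_norm_toL2 L a).2)

theorem ev_eq_tsum (a : Coeff) :
    ev L a = ∑' k, toL2 L a k • (fourier k : C(AddCircle L, ℂ)) := rfl

theorem norm_ev_le (a : Coeff) : ‖ev L a‖ ≤ ‖sobolevSeq L‖ * ‖a‖ :=
  (ContinuousLinearMap.le_opNorm _ _).trans
    (mul_le_mul_of_nonneg_right (LinearMap.mkContinuous_norm_le _ (norm_nonneg _) _)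
      (norm_nonneg _))

theorem norm_ev_apply_le (a : Coeff) (x : AddCircle L) : ‖ev L a x‖ ≤ ‖sobolevSeq L‖ * ‖a‖ :=
  ((ev L a).norm_coe_le_norm x).trans (norm_ev_le L a)

theorem hasSum_ev (a : Coeff) (x : AddCircle L) :
    HasSum (fun k => toL2 L a k * fourier k x) (ev L a x) := by
  have := (summable_toL2_fourier L a).hasSum
  exact this.mapL (ContinuousMap.evalCLM ℂ x)

@[simp] theorem fourierCoeff_ev (a : Coeff) (k : ℤ) : fourierCoeff (ev L a) k = toL2 L a k := by
  have h := (summable_toL2_fourier L a).hasSum.mapL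
    (ContinuousMap.toLp (E := ℂ) 2 (AddCircle.haarAddCircle (T := L)) ℂ)
  have h2 := HilbertBasis.hasSum_repr_symm (fourierBasis (T := L)) (toL2 L a)
  rw [coe_fourierBasis] at h2
  simp only [map_smul] at h
  have h3 := h.unique h2
  rw [← fourierCoeff_toLp, ← fourierBasis_repr]
  erw [h3]
  simp

theorem ev_injective : Function.Injective fun a => (ev L a : AddCircle L → ℂ) := fun a b h => by
  refine toL2_injective L ?_
  ext k
  rw [← fourierCoeff_ev, ← fourierCoeff_ev]
  exact congrArg (fun f => fourierCoeff f k) h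

variable {L}

/-- Every function of class `H¹` is represented: its Fourier series converges absolutely. -/
theorem exists_ev_eq {f : AddCircle L → ℂ} (hf : MemH1 f) : ∃ a : Coeff, (ev L a : _ → ℂ) = f := by
  have hs : Summable fun k => ‖(bracket L k : ℂ) * fourierCoeff f k‖ ^ 2 := by
    refine hf.summable.congr fun k => ?_
    rw [norm_mul, mul_pow, Complex.norm_real, Real.norm_eq_abs, sq_abs, bracket_sq]
  refine ⟨⟨_, memℓp_two hs⟩, ?_⟩
  set a : Coeff := ⟨_, memℓp_two hs⟩ with ha
  have hk : ∀ k, toL2 L a k = fourierCoeff f k := fun k => by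
    simp [ha, bracket_ne L k]
  funext x
  have h1 := hasSum_ev L a x
  have h2 : Summable (fourierCoeff f) := by
    refine .of_norm ((summable_norm_toL2 L a).1.congr fun k => ?_)
    rw [hk]
  have h3 := has_pointwise_sum_fourier_series_of_summable (f := ⟨f, hf.continuous⟩) h2 x
  refine h1.unique ?_
  simpa [hk] using h3

theorem norm_sq_eq_tsum (a : Coeff) :
    ‖a‖ ^ 2 = ∑' k, (1 + waveNumber L k ^ 2) * ‖fourierCoeff (ev L a) k‖ ^ 2 := by
  rw [Coeff.norm_sq]
  refine tsum_congr fun k => ?_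
  rw [fourierCoeff_ev, toL2_apply, norm_mul, mul_pow, norm_inv, Complex.norm_real, Real.norm_eq_abs,
    inv_pow, sq_abs, bracket_sq, ← mul_assoc, mul_inv_cancel₀ (by positivity), one_mul]

theorem memH1_ev (a : Coeff) : MemH1 (ev L a : AddCircle L → ℂ) := by
  refine ⟨(ev L a).continuous, a.summable_sq.congr fun k => ?_⟩
  rw [fourierCoeff_ev, toL2_apply, norm_mul, mul_pow, norm_inv, Complex.norm_real, Real.norm_eq_abs,
    inv_pow, sq_abs, bracket_sq, ← mul_assoc, mul_inv_cancel₀ (by positivity), one_mul]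

theorem h1Norm_ev (a : Coeff) : h1Norm (ev L a : AddCircle L → ℂ) = Real.sqrt L * ‖a‖ := by
  rw [h1Norm, ← norm_sq_eq_tsum, Real.sqrt_mul hL.out.le, Real.sqrt_sq (norm_nonneg _)]

theorem integrable_of_continuous {E : Type*} [NormedAddCommGroup E] {f : AddCircle L → E}
    (hf : Continuous f) : Integrable f AddCircle.haarAddCircle :=
  hf.integrable_of_hasCompactSupport (HasCompactSupport.of_compactSpace f)

open ComplexConjugate in
/-- Parseval's identity. -/
theorem inner_toL2 (a b : Coeff) :
    inner ℂ (toL2 L a) (toL2 L b) = ∫ x, conj (ev L a x) * ev L b x ∂AddCircle.haarAddCircle := by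
  have h : ∀ a : Coeff, toL2 L a = fourierBasis.repr
      (ContinuousMap.toLp (E := ℂ) 2 (AddCircle.haarAddCircle (T := L)) ℂ (ev L a)) := fun a => by
    ext k
    rw [fourierBasis_repr, fourierCoeff_toLp, fourierCoeff_ev]
  rw [h, h, LinearIsometryEquiv.inner_map_map, ContinuousMap.inner_toLp]
  simp [mul_comm]

theorem norm_toL2_sq (a : Coeff) :
    ‖toL2 L a‖ ^ 2 = ∫ x, ‖ev L a x‖ ^ 2 ∂AddCircle.haarAddCircle := by
  have h := inner_toL2 (L := L) a a
  rw [inner_self_eq_norm_sq_to_K] at h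
  have h2 : ∀ x, (starRingEnd ℂ) (ev L a x) * ev L a x = ((‖ev L a x‖ ^ 2 : ℝ) : ℂ) := fun x => by
    rw [Complex.conj_mul']; norm_cast
  simp_rw [h2] at h
  rw [integral_complex_ofReal] at h
  exact Complex.ofReal_injective (by rw [← h]; simp)

end

section

/-! ### The free Schrödinger group -/

/-- Bounded pointwise convergence of the symbols gives strong convergence of the multipliers. -/
theorem tendsto_multiplier {ι : Type*} {l : Filter ι} {m : ι → ℤ → ℂ} {m₀ : ℤ → ℂ} {C : ℝ}
    (hm : ∀ i k, ‖m i k‖ ≤ C) (hm₀ : ∀ k, ‖m₀ k‖ ≤ C)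
    (h : ∀ k, Tendsto (fun i => m i k) l (𝓝 (m₀ k))) (a : Coeff) :
    Tendsto (fun i => multiplier (m i) C (hm i) a) l (𝓝 (multiplier m₀ C hm₀ a)) := by
  rw [tendsto_iff_norm_sub_tendsto_zero]
  have key : Tendsto (fun i => ∑' k, ‖(m i k - m₀ k) * a k‖ ^ 2) l (𝓝 (∑' _ : ℤ, (0 : ℝ))) := by
    refine tendsto_tsum_of_dominated_convergence (bound := fun k => (2 * C) ^ 2 * ‖a k‖ ^ 2)
      (a.summable_sq.mul_left _) (fun k => ?_) (Eventually.of_forall fun i k => ?_)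
    · have h1 : Tendsto (fun i => (m i k - m₀ k) * a k) l (𝓝 0) := by
        simpa using ((h k).sub_const (m₀ k)).mul_const (a k)
      simpa using h1.norm.pow 2
    · rw [Real.norm_of_nonneg (by positivity), norm_mul, mul_pow]
      gcongr
      calc ‖m i k - m₀ k‖ ≤ ‖m i k‖ + ‖m₀ k‖ := norm_sub_le _ _
        _ ≤ 2 * C := by linarith [hm i k, hm₀ k]
  rw [tsum_zero] at key
  have h2 := key.sqrt
  rw [Real.sqrt_zero] at h2
  refine h2.congr fun i => ?_
  rw [← Real.sqrt_sq (norm_nonneg (multiplier (m i) C (hm i) a - multiplier m₀ C hm₀ a)),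
    Coeff.norm_sq]
  congr 1
  refine tsum_congr fun k => ?_
  rw [lp.coeFn_sub, Pi.sub_apply, multiplier_apply, multiplier_apply, sub_mul]

variable (L : ℝ)

/-- The symbol `exp(-i t wₖ² / 2)` of the free Schrödinger group. -/
def phase (t : ℝ) (k : ℤ) : ℂ := Complex.exp (-(Complex.I / 2) * (t * waveNumber L k ^ 2 : ℝ))

theorem phase_eq (t : ℝ) (k : ℤ) :
    phase L t k = Complex.exp ((-(t * waveNumber L k ^ 2 / 2) : ℝ) * Complex.I) := by
  rw [phase]; congr 1; push_cast; ring

theorem norm_phase (t : ℝ) (k : ℤ) : ‖phase L t k‖ = 1 := by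
  rw [phase_eq, Complex.norm_exp_ofReal_mul_I]

theorem phase_add (s t : ℝ) (k : ℤ) : phase L (s + t) k = phase L s k * phase L t k := by
  rw [phase, phase, phase, ← Complex.exp_add]; congr 1; push_cast; ring

theorem phase_zero (k : ℤ) : phase L 0 k = 1 := by simp [phase]

theorem hasDerivAt_phase (t : ℝ) (k : ℤ) :
    HasDerivAt (fun t => phase L t k)
      (-(Complex.I / 2) * (waveNumber L k ^ 2 : ℝ) * phase L t k) t := by
  have h : HasDerivAt (fun t : ℝ => -(Complex.I / 2) * (t * waveNumber L k ^ 2 : ℝ))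
      (-(Complex.I / 2) * (waveNumber L k ^ 2 : ℝ)) t := by
    have := (((hasDerivAt_id t).mul_const (waveNumber L k ^ 2)).ofReal_comp).const_mul
      (-(Complex.I / 2))
    simpa using this
  have := h.cexp
  rw [mul_comm] at this
  exact this

/-- The free Schrödinger group `exp(i t ∂ₓ² / 2)` on `H¹`. -/
def freeFlow (t : ℝ) : Coeff →L[ℂ] Coeff :=
  multiplier (phase L t) 1 (fun k => (norm_phase L t k).le)

@[simp] theorem freeFlow_apply (t : ℝ) (a : Coeff) (k : ℤ) :
    freeFlow L t a k = phase L t k * a k := rfl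

@[simp] theorem norm_freeFlow (t : ℝ) (a : Coeff) : ‖freeFlow L t a‖ = ‖a‖ :=
  norm_multiplier_eq _ _ _ (norm_phase L t) a

theorem freeFlow_add (s t : ℝ) (a : Coeff) :
    freeFlow L (s + t) a = freeFlow L s (freeFlow L t a) := by
  ext k; simp [phase_add, mul_assoc]

@[simp] theorem freeFlow_zero (a : Coeff) : freeFlow L 0 a = a := by
  ext k; simp [phase_zero]

@[simp] theorem freeFlow_neg_freeFlow (t : ℝ) (a : Coeff) :
    freeFlow L (-t) (freeFlow L t a) = a := by
  rw [← freeFlow_add]; simp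

@[simp] theorem freeFlow_freeFlow_neg (t : ℝ) (a : Coeff) :
    freeFlow L t (freeFlow L (-t) a) = a := by
  rw [← freeFlow_add]; simp

theorem toL2_freeFlow (t : ℝ) (a : Coeff) : toL2 L (freeFlow L t a) = freeFlow L t (toL2 L a) := by
  ext k; simp; ring

theorem inner_freeFlow (t : ℝ) (a b : Coeff) :
    inner ℂ (freeFlow L t a) (freeFlow L t b) = inner ℂ a b :=
  (LinearIsometry.inner_map_map ⟨(freeFlow L t).toLinearMap, norm_freeFlow L t⟩ a b)

theorem inner_freeFlow_right (t : ℝ) (a b : Coeff) :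
    inner ℂ a (freeFlow L t b) = inner ℂ (freeFlow L (-t) a) b := by
  rw [← inner_freeFlow L t (freeFlow L (-t) a) b, freeFlow_freeFlow_neg]

theorem continuous_freeFlow (a : Coeff) : Continuous fun t => freeFlow L t a := by
  refine continuous_iff_continuousAt.2 fun t => ?_
  refine tendsto_multiplier (fun t k => (norm_phase L t k).le) _ (fun k => ?_) a
  exact (hasDerivAt_phase L t k).continuousAt

/-- The group is strongly but not norm continuous; since it is isometric it is nevertheless jointly
continuous in time and argument. -/
theorem tendsto_freeFlow {ι : Type*} {l : Filter ι} {τ : ι → ℝ} {t : ℝ} {v : ι → Coeff} {a : Coeff}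
    (hτ : Tendsto τ l (𝓝 t)) (hv : Tendsto v l (𝓝 a)) :
    Tendsto (fun i => freeFlow L (τ i) (v i)) l (𝓝 (freeFlow L t a)) := by
  have h1 : Tendsto (fun i => freeFlow L (τ i) a) l (𝓝 (freeFlow L t a)) :=
    ((continuous_freeFlow L a).tendsto t).comp hτ
  have h2 : Tendsto (fun i => freeFlow L (τ i) (v i - a)) l (𝓝 0) := by
    rw [tendsto_zero_iff_norm_tendsto_zero]
    simp_rw [norm_freeFlow]
    exact tendsto_iff_norm_sub_tendsto_zero.1 hv
  simpa using h2.add h1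

theorem continuous_freeFlow_uncurry :
    Continuous fun p : ℝ × Coeff => freeFlow L p.1 p.2 :=
  continuous_iff_continuousAt.2 fun p =>
    tendsto_freeFlow L (continuous_fst.tendsto p) (continuous_snd.tendsto p)

theorem waveNumber_mul_inv_bracket_le (k : ℤ) : |waveNumber L k| * (bracket L k)⁻¹ ≤ 1 := by
  rw [← div_eq_mul_inv, div_le_one (bracket_pos L k), bracket]
  refine Real.le_sqrt_of_sq_le ?_
  rw [sq_abs]; linarith

theorem fourier_add_arg {L : ℝ} (k : ℤ) (x y : AddCircle L) :
    (fourier k (x + y) : ℂ) = fourier k x * fourier k y := by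
  simp [fourier_apply, smul_add, AddCircle.toCircle_add]

open ComplexConjugate in
/-- The difference of the `H¹` and the `L²` inner products is the inner product of the
derivatives. -/
theorem inner_sub_inner_toL2 (a b : Coeff) :
    inner ℂ a b - inner ℂ (toL2 L a) (toL2 L b) =
      ∑' k, ((waveNumber L k ^ 2 : ℝ) : ℂ) * (conj (toL2 L a k) * toL2 L b k) := by
  rw [lp.inner_eq_tsum, lp.inner_eq_tsum]
  refine ((lp.summable_inner (𝕜 := ℂ) a b).tsum_sub
    (lp.summable_inner (𝕜 := ℂ) (toL2 L a) (toL2 L b))).symm.trans (tsum_congr fun k => ?_)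
  have h5 : ((waveNumber L k ^ 2 : ℝ) : ℂ) = (bracket L k : ℂ) ^ 2 - 1 := by
    rw [← Complex.ofReal_pow, bracket_sq]; push_cast; ring
  rw [h5, RCLike.inner_apply', RCLike.inner_apply', toL2_apply, toL2_apply, map_mul, map_inv₀,
    Complex.conj_ofReal]
  have := bracket_ne L k
  field_simp

theorem summable_norm_mul_norm (a b : Coeff) : Summable fun k => ‖a k‖ * ‖b k‖ :=
  (lp.tsum_mul_le_mul_norm (p := 2) (q := 2)
    (by rw [Real.holderConjugate_iff]; norm_num) a b).1

variable [hL : Fact (0 < L)]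

theorem ev_freeFlow (t : ℝ) (a : Coeff) (x : AddCircle L) :
    ev L (freeFlow L t a) x = freeGroup t (ev L a) x := by
  rw [freeGroup, ← (hasSum_ev L (freeFlow L t a) x).tsum_eq]
  refine tsum_congr fun k => ?_
  rw [fourierCoeff_ev, toL2_freeFlow, freeFlow_apply, phase]

/-! ### Difference quotients -/

variable {L}

theorem fourier_coe_eq (k : ℤ) (h : ℝ) :
    fourier k (h : AddCircle L) = Complex.exp ((waveNumber L k * h : ℝ) * Complex.I) := by
  rw [fourier_coe_apply]
  congr 1
  have : (L : ℂ) ≠ 0 := by exact_mod_cast hL.out.ne'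
  rw [waveNumber]; push_cast; field_simp

theorem norm_fourier_sub_one_le (k : ℤ) (h : ℝ) :
    ‖fourier k (h : AddCircle L) - 1‖ ≤ |waveNumber L k| * |h| := by
  rw [fourier_coe_eq, mul_comm _ Complex.I, ← abs_mul]
  exact Real.norm_exp_I_mul_ofReal_sub_one_le

theorem tendsto_fourier_quotient (k : ℤ) :
    Tendsto (fun h : ℝ => (h ^ 2)⁻¹ * ‖fourier k (h : AddCircle L) - 1‖ ^ 2) (𝓝[≠] 0)
      (𝓝 (waveNumber L k ^ 2)) := by
  have h1 : HasDerivAt (fun h : ℝ => fourier k (h : AddCircle L))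
      (waveNumber L k * Complex.I) 0 := by
    have h2 : HasDerivAt (fun h : ℝ => ((waveNumber L k * h : ℝ) : ℂ) * Complex.I)
        (waveNumber L k * Complex.I) 0 := by
      have := (((hasDerivAt_id (0 : ℝ)).const_mul (waveNumber L k)).ofReal_comp).mul_const
        Complex.I
      simpa using this
    have h3 := h2.cexp
    simp only [mul_zero, Complex.ofReal_zero, zero_mul, Complex.exp_zero, one_mul] at h3
    refine h3.congr_of_eventuallyEq (Eventually.of_forall fun h => ?_)
    exact fourier_coe_eq k h
  have h4 := ((hasDerivAt_iff_tendsto_slope.1 h1).norm).pow 2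
  have h5 : ‖(waveNumber L k : ℂ) * Complex.I‖ ^ 2 = waveNumber L k ^ 2 := by simp
  rw [h5] at h4
  refine h4.congr fun h => ?_
  have h6 : (fourier k (0 : AddCircle L) : ℂ) = 1 := fourier_eval_zero k
  simp [slope_def_module, mul_pow, -fourier_apply, h6]

theorem fourierCoeff_translate (f : AddCircle L → ℂ) (h : AddCircle L) (k : ℤ) :
    fourierCoeff (fun x => f (x + h)) k = fourier k h * fourierCoeff f k := by
  rw [fourierCoeff, fourierCoeff,
    ← integral_add_right_eq_self (fun t => (fourier (-k) t : ℂ) • f t) h]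
  rw [← integral_const_mul]
  congr 1
  funext x
  have h1 : (fourier k h : ℂ) * fourier (-k) h = 1 := by
    rw [← fourier_add]; simp
  rw [fourier_add_arg, smul_eq_mul, smul_eq_mul]
  linear_combination (-(fourier (-k) x * f (x + h))) * h1

variable (L) in
/-- Translation by `h`. -/
def translate (h : AddCircle L) : Coeff →L[ℂ] Coeff :=
  multiplier (fun k => fourier k h) 1 (fun k => by
    rw [← fourier_norm (T := L) k]; exact (fourier k).norm_coe_le_norm h)

theorem ev_translate (h : AddCircle L) (a : Coeff) (x : AddCircle L) :
    ev L (translate L h a) x = ev L a (x + h) := by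
  rw [← (hasSum_ev L _ x).tsum_eq, ← (hasSum_ev L _ (x + h)).tsum_eq]
  refine tsum_congr fun k => ?_
  rw [fourier_add_arg, translate, toL2_apply, multiplier_apply, toL2_apply]
  ring

theorem toL2_translate_sub (h : AddCircle L) (a : Coeff) (k : ℤ) :
    toL2 L (translate L h a - a) k = (fourier k h - 1) * toL2 L a k := by
  rw [map_sub, lp.coeFn_sub, Pi.sub_apply, toL2_apply, translate, multiplier_apply, toL2_apply]
  ring

theorem norm_toL2_translate_sub_le (h : ℝ) (a : Coeff) (k : ℤ) :
    ‖toL2 L (translate L h a - a) k‖ ≤ |h| * ‖a k‖ := by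
  rw [toL2_translate_sub, toL2_apply, norm_mul, norm_mul, norm_inv, Complex.norm_real,
    Real.norm_of_nonneg (bracket_pos L k).le]
  calc ‖(fourier k (h : AddCircle L) : ℂ) - 1‖ * ((bracket L k)⁻¹ * ‖a k‖)
      ≤ (|waveNumber L k| * |h|) * ((bracket L k)⁻¹ * ‖a k‖) := by
        gcongr
        · have := bracket_pos L k; positivity
        · exact norm_fourier_sub_one_le k h
    _ = (|waveNumber L k| * (bracket L k)⁻¹) * (|h| * ‖a k‖) := by ring
    _ ≤ 1 * (|h| * ‖a k‖) := by
        gcongr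
        exact waveNumber_mul_inv_bracket_le L k
    _ = _ := one_mul _

theorem integral_diff_sq_le (h : ℝ) (a : Coeff) :
    ∫ x, ‖ev L a (x + (h : AddCircle L)) - ev L a x‖ ^ 2 ∂AddCircle.haarAddCircle
      ≤ h ^ 2 * ‖a‖ ^ 2 := by
  have h1 := norm_toL2_sq (L := L) (translate L h a - a)
  simp only [map_sub, ContinuousMap.sub_apply, ev_translate] at h1
  rw [← h1, ← map_sub, Coeff.norm_sq, Coeff.norm_sq, ← tsum_mul_left]
  refine Summable.tsum_le_tsum (fun k => ?_) (Coeff.summable_sq _) (a.summable_sq.mul_left _)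
  rw [← sq_abs h, ← mul_pow]
  gcongr
  exact norm_toL2_translate_sub_le h a k

open ComplexConjugate in
/-- The `H¹` inner product without its `L²` part is the limit of the `L²` inner products of
difference quotients. -/
theorem tendsto_diff_inner (a b : Coeff) :
    Tendsto (fun h : ℝ => ((h ^ 2)⁻¹ : ℝ) * ∫ x, conj (ev L a (x + (h : AddCircle L)) - ev L a x) *
        (ev L b (x + (h : AddCircle L)) - ev L b x) ∂AddCircle.haarAddCircle) (𝓝[≠] 0)
      (𝓝 (inner ℂ a b - inner ℂ (toL2 L a) (toL2 L b))) := by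
  have h1 : ∀ h : ℝ, ((h ^ 2)⁻¹ : ℝ) * ∫ x, conj (ev L a (x + (h : AddCircle L)) - ev L a x) *
        (ev L b (x + (h : AddCircle L)) - ev L b x) ∂AddCircle.haarAddCircle =
      ∑' k, (((h ^ 2)⁻¹ * ‖(fourier k (h : AddCircle L) : ℂ) - 1‖ ^ 2 : ℝ) : ℂ) *
        (conj (toL2 L a k) * toL2 L b k) := fun h => by
    have h2 := inner_toL2 (L := L) (translate L h a - a) (translate L h b - b)
    simp only [map_sub (ev L), ContinuousMap.sub_apply, ev_translate] at h2
    rw [← h2, lp.inner_eq_tsum, ← tsum_mul_left]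
    refine tsum_congr fun k => ?_
    rw [toL2_translate_sub, toL2_translate_sub, RCLike.inner_apply', map_mul]
    have h3 : (((‖(fourier k (h : AddCircle L) : ℂ) - 1‖ ^ 2 : ℝ)) : ℂ) =
        conj ((fourier k (h : AddCircle L) : ℂ) - 1) * (fourier k (h : AddCircle L) - 1) := by
      rw [Complex.conj_mul']; norm_cast
    rw [Complex.ofReal_mul, h3]
    ring
  simp_rw [h1]
  rw [inner_sub_inner_toL2]
  refine tendsto_tsum_of_dominated_convergence (bound := fun k => ‖a k‖ * ‖b k‖)
    (summable_norm_mul_norm a b)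
    (fun k => ?_) ?_
  · exact ((Complex.continuous_ofReal.tendsto _).comp (tendsto_fourier_quotient k)).mul_const _
  · filter_upwards [self_mem_nhdsWithin] with h hh k
    have hh' : (0 : ℝ) < |h| := abs_pos.2 hh
    have ha := norm_toL2_translate_sub_le (L := L) h a k
    have hb := norm_toL2_translate_sub_le (L := L) h b k
    rw [toL2_translate_sub, norm_mul] at ha hb
    have hc : ∀ z w : ℂ, ‖conj z * w‖ = ‖z‖ * ‖w‖ := fun z w => by simp
    rw [norm_mul, Complex.norm_real, Real.norm_of_nonneg (by positivity), hc, ← sq_abs h]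
    calc _ = (|h| ^ 2)⁻¹ * ((‖(fourier k (h : AddCircle L) : ℂ) - 1‖ * ‖toL2 L a k‖) *
          (‖(fourier k (h : AddCircle L) : ℂ) - 1‖ * ‖toL2 L b k‖)) := by ring
      _ ≤ (|h| ^ 2)⁻¹ * ((|h| * ‖a k‖) * (|h| * ‖b k‖)) := by gcongr
      _ = ‖a k‖ * ‖b k‖ := by field_simp

/-- Bessel's inequality. -/
theorem sum_sq_fourierCoeff_le (f : C(AddCircle L, ℂ)) (s : Finset ℤ) :
    ∑ k ∈ s, ‖fourierCoeff f k‖ ^ 2 ≤ ∫ x, ‖f x‖ ^ 2 ∂AddCircle.haarAddCircle := by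
  have h := hasSum_sq_fourierCoeff (ContinuousMap.toLp (E := ℂ) 2
    (AddCircle.haarAddCircle (T := L)) ℂ f)
  simp_rw [fourierCoeff_toLp] at h
  refine (sum_le_hasSum s (fun _ _ => by positivity) h).trans_eq (integral_congr_ae ?_)
  filter_upwards [ContinuousMap.coeFn_toLp (p := 2) (𝕜 := ℂ) AddCircle.haarAddCircle f] with x hx
  rw [hx]

/-- A continuous function whose `L²` modulus of continuity is linear belongs to `H¹`. -/
theorem exists_ev_eq_of_diff (f : C(AddCircle L, ℂ)) {A D : ℝ}
    (hA : ∀ h : ℝ, ∫ x, ‖f (x + (h : AddCircle L)) - f x‖ ^ 2 ∂AddCircle.haarAddCircle ≤ A * h ^ 2)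
    (hD : ∀ x, ‖f x‖ ^ 2 ≤ D) :
    ∃ a : Coeff, ev L a = f ∧ ‖a‖ ^ 2 ≤ A + D := by
  have hfin : ∀ s : Finset ℤ,
      ∑ k ∈ s, (1 + waveNumber L k ^ 2) * ‖fourierCoeff f k‖ ^ 2 ≤ A + D := by
    intro s
    have h1 : ∑ k ∈ s, ‖fourierCoeff f k‖ ^ 2 ≤ D := by
      refine (sum_sq_fourierCoeff_le f s).trans ?_
      calc ∫ x, ‖f x‖ ^ 2 ∂AddCircle.haarAddCircle
          ≤ ∫ _, D ∂(AddCircle.haarAddCircle (T := L)) :=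
            integral_mono (integrable_of_continuous (by fun_prop)) (integrable_const _) hD
        _ = D := by simp
    have h2 : ∑ k ∈ s, waveNumber L k ^ 2 * ‖fourierCoeff f k‖ ^ 2 ≤ A := by
      have h3 : Tendsto (fun h : ℝ => ∑ k ∈ s, ((h ^ 2)⁻¹ *
          ‖(fourier k (h : AddCircle L) : ℂ) - 1‖ ^ 2) * ‖fourierCoeff f k‖ ^ 2) (𝓝[≠] 0)
          (𝓝 (∑ k ∈ s, waveNumber L k ^ 2 * ‖fourierCoeff f k‖ ^ 2)) :=
        tendsto_finsetSum _ fun k _ => (tendsto_fourier_quotient k).mul_const _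
      refine le_of_tendsto h3 ?_
      filter_upwards [self_mem_nhdsWithin] with h hh
      have hh' : 0 < h ^ 2 := by have : h ≠ 0 := hh; positivity
      let g : C(AddCircle L, ℂ) := ⟨fun x => f (x + (h : AddCircle L)) - f x, by fun_prop⟩
      have h4 : ∀ k, fourierCoeff g k = (fourier k (h : AddCircle L) - 1) * fourierCoeff f k := by
        intro k
        have h5 : fourierCoeff (g : AddCircle L → ℂ) k =
            fourierCoeff (fun x => f (x + (h : AddCircle L))) k - fourierCoeff f k := by
          simp only [fourierCoeff]
          rw [← integral_sub]
          · congr 1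
            funext x
            rw [← smul_sub]
            rfl
          · exact integrable_of_continuous (by fun_prop)
          · exact integrable_of_continuous (by fun_prop)
        rw [h5, fourierCoeff_translate, sub_mul, one_mul]
      have h6 := (sum_sq_fourierCoeff_le g s).trans (hA h)
      simp_rw [h4, norm_mul, mul_pow] at h6
      simp_rw [mul_assoc]
      rw [← Finset.mul_sum, inv_mul_le_iff₀ hh']
      linarith
    simp_rw [add_mul, one_mul]
    rw [Finset.sum_add_distrib]
    linarith
  have hs : Summable fun k => (1 + waveNumber L k ^ 2) * ‖fourierCoeff f k‖ ^ 2 :=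
    summable_of_sum_le (fun _ => by positivity) hfin
  obtain ⟨a, ha⟩ := exists_ev_eq (L := L) (f := f) ⟨f.continuous, hs⟩
  refine ⟨a, DFunLike.coe_injective ha, ?_⟩
  rw [norm_sq_eq_tsum (L := L), ha]
  exact hs.tsum_le_of_sum_le hfin

/-- A bounded continuous function whose increments are dominated by those of two elements of `H¹`
belongs to `H¹`. Products, conjugates and the adiabatic density are all obtained in this way. -/
theorem exists_ev_eq_of_le (f : C(AddCircle L, ℂ)) (a b : Coeff) {A B D : ℝ} (hA : 0 ≤ A)
    (hB : 0 ≤ B)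
    (h : ∀ x y, ‖f x - f y‖ ^ 2 ≤ A * ‖ev L a x - ev L a y‖ ^ 2 + B * ‖ev L b x - ev L b y‖ ^ 2)
    (hD : ∀ x, ‖f x‖ ^ 2 ≤ D) :
    ∃ c : Coeff, ev L c = f ∧ ‖c‖ ^ 2 ≤ A * ‖a‖ ^ 2 + B * ‖b‖ ^ 2 + D := by
  refine exists_ev_eq_of_diff f (fun τ => ?_) hD
  have h1 := integral_diff_sq_le (L := L) τ a
  have h2 := integral_diff_sq_le (L := L) τ b
  calc _ ≤ ∫ x, (A * ‖ev L a (x + (τ : AddCircle L)) - ev L a x‖ ^ 2 +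
        B * ‖ev L b (x + (τ : AddCircle L)) - ev L b x‖ ^ 2) ∂AddCircle.haarAddCircle :=
        integral_mono (integrable_of_continuous (by fun_prop))
          (integrable_of_continuous (by fun_prop)) fun x => h _ _
    _ = A * ∫ x, ‖ev L a (x + (τ : AddCircle L)) - ev L a x‖ ^ 2 ∂AddCircle.haarAddCircle +
        B * ∫ x, ‖ev L b (x + (τ : AddCircle L)) - ev L b x‖ ^ 2 ∂AddCircle.haarAddCircle := by
        rw [integral_add (integrable_of_continuous (by fun_prop))
          (integrable_of_continuous (by fun_prop)), integral_const_mul, integral_const_mul]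
    _ ≤ A * (τ ^ 2 * ‖a‖ ^ 2) + B * (τ ^ 2 * ‖b‖ ^ 2) := by gcongr
    _ = _ := by ring

end

section

/-! ### Interpolation between `L²` and `H¹` -/

variable {L : ℝ} [hL : Fact (0 < L)]

variable (L) in
/-- The sup norm is controlled by a small multiple of the `H¹` norm and a large multiple of the
`L²` norm. -/
theorem norm_ev_le_interpolation {η : ℝ} (hη : 0 < η) :
    ∃ C : ℝ, 0 ≤ C ∧ ∀ a : Coeff, ‖ev L a‖ ≤ η * ‖a‖ + C * ‖toL2 L a‖ := by
  classical
  -- outside a finite set `s` of modes the Sobolev sequence has norm at most `η`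
  have h0 : Tendsto (fun s : Finset ℤ => multiplier (fun k => if k ∈ s then 0 else 1) 1
      (fun k => by split_ifs <;> simp) (sobolevSeq L)) atTop
      (𝓝 (multiplier (fun _ => 0) 1 (by simp) (sobolevSeq L))) := by
    refine tendsto_multiplier _ _ (fun k => ?_) _
    refine tendsto_const_nhds.congr' ?_
    filter_upwards [eventually_ge_atTop {k}] with s hs
    rw [if_pos (hs (Finset.mem_singleton_self k))]
  have h1 : multiplier (fun _ => 0) 1 (by simp) (sobolevSeq L) = 0 := by ext k; simp
  rw [h1] at h0
  obtain ⟨s, hs⟩ := ((tendsto_zero_iff_norm_tendsto_zero.1 h0).eventually_le_const hη).exists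
  set r : Coeff := multiplier (fun k => if k ∈ s then 0 else 1) 1
      (fun k => by split_ifs <;> simp) (sobolevSeq L) with hr
  refine ⟨s.card, by positivity, fun a => ?_⟩
  obtain ⟨h3, h4⟩ := lp.tsum_mul_le_mul_norm (p := 2) (q := 2)
    (by rw [Real.holderConjugate_iff]; norm_num) r a
  -- the modes in `s` are controlled by the `L²` norm
  have h5 : ∀ k, ‖toL2 L a k‖ ≤ ‖r k‖ * ‖a k‖ + (if k ∈ s then ‖toL2 L a‖ else 0) := fun k => by
    by_cases hk : k ∈ s
    · rw [if_pos hk]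
      have := lp.norm_apply_le_norm (by norm_num) (toL2 L a) k
      have : 0 ≤ ‖r k‖ * ‖a k‖ := by positivity
      linarith
    · rw [if_neg hk, add_zero, hr, multiplier_apply, if_neg hk, one_mul, toL2_apply, norm_mul]
      rfl
  have h6 : HasSum (fun k => if k ∈ s then ‖toL2 L a‖ else 0) (s.card * ‖toL2 L a‖) := by
    have : HasSum (fun k => if k ∈ s then ‖toL2 L a‖ else 0)
        (∑ k ∈ s, if k ∈ s then ‖toL2 L a‖ else 0) :=
      hasSum_sum_of_ne_finset_zero fun k hk => by simp [hk]
    rw [Finset.sum_congr rfl (fun k hk => if_pos hk)] at this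
    simpa using this
  calc ‖ev L a‖ ≤ ∑' k, ‖toL2 L a k‖ := by
        rw [ev_eq_tsum]
        refine (norm_tsum_le_tsum_norm ?_).trans ?_
        · simpa [norm_smul, fourier_norm] using (summable_norm_toL2 L a).1
        · simp [norm_smul, fourier_norm]
    _ ≤ ∑' k, (‖r k‖ * ‖a k‖ + (if k ∈ s then ‖toL2 L a‖ else 0)) :=
        Summable.tsum_le_tsum h5 (summable_norm_toL2 L a).1 (h3.add h6.summable)
    _ = ∑' k, ‖r k‖ * ‖a k‖ + s.card * ‖toL2 L a‖ := by rw [h3.tsum_add h6.summable, h6.tsum_eq]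
    _ ≤ ‖r‖ * ‖a‖ + s.card * ‖toL2 L a‖ := by gcongr
    _ ≤ η * ‖a‖ + s.card * ‖toL2 L a‖ := by gcongr

/-! ### The algebra structure of `H¹` -/

variable (L) in
/-- A constant for which `‖ab‖ ≤ C ‖a‖ ‖b‖` in `H¹`. -/
def algConst : ℝ := 2 * ‖sobolevSeq L‖ + ‖sobolevSeq L‖ ^ 2

theorem algConst_nonneg : 0 ≤ algConst L := by unfold algConst; positivity

theorem norm_add_sq_le_two (z w : ℂ) : ‖z + w‖ ^ 2 ≤ 2 * ‖z‖ ^ 2 + 2 * ‖w‖ ^ 2 := by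
  have := norm_add_le z w
  nlinarith [sq_nonneg (‖z‖ - ‖w‖), norm_nonneg (z + w)]

/-- `H¹` is an algebra: `|Δ(ab)|² ≤ 2‖b‖∞²|Δa|² + 2‖a‖∞²|Δb|²`. -/
theorem exists_mul (a b : Coeff) :
    ∃ c : Coeff, ev L c = ev L a * ev L b ∧ ‖c‖ ≤ algConst L * (‖a‖ * ‖b‖) := by
  obtain ⟨c, hc, hn⟩ := exists_ev_eq_of_le (ev L a * ev L b) a b
    (A := 2 * ‖ev L b‖ ^ 2) (B := 2 * ‖ev L a‖ ^ 2) (D := ‖ev L a‖ ^ 2 * ‖ev L b‖ ^ 2)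
    (by positivity) (by positivity) (fun x y => by
      have h : (ev L a * ev L b) x - (ev L a * ev L b) y =
          (ev L a x - ev L a y) * ev L b x + ev L a y * (ev L b x - ev L b y) := by
        simp only [ContinuousMap.mul_apply]; ring
      rw [h]
      refine (norm_add_sq_le_two _ _).trans ?_
      rw [norm_mul, norm_mul, mul_pow, mul_pow]
      have h1 := (ev L b).norm_coe_le_norm x
      have h2 := (ev L a).norm_coe_le_norm y
      have h3 : ‖ev L b x‖ ^ 2 ≤ ‖ev L b‖ ^ 2 := by gcongr
      have h4 : ‖ev L a y‖ ^ 2 ≤ ‖ev L a‖ ^ 2 := by gcongr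
      nlinarith [sq_nonneg ‖ev L a x - ev L a y‖, sq_nonneg ‖ev L b x - ev L b y‖]) (fun x => by
      rw [ContinuousMap.mul_apply, norm_mul, mul_pow]
      have h1 := (ev L b).norm_coe_le_norm x
      have h2 := (ev L a).norm_coe_le_norm x
      gcongr)
  refine ⟨c, hc, le_of_sq_le_sq (hn.trans ?_) (by have := algConst_nonneg (L := L); positivity)⟩
  have ha : ‖ev L a‖ ^ 2 ≤ (‖sobolevSeq L‖ * ‖a‖) ^ 2 := by gcongr; exact norm_ev_le L a
  have hb : ‖ev L b‖ ^ 2 ≤ (‖sobolevSeq L‖ * ‖b‖) ^ 2 := by gcongr; exact norm_ev_le L b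
  set K := ‖sobolevSeq L‖ with hK
  have hK0 : 0 ≤ K := norm_nonneg _
  calc _ ≤ 2 * (K * ‖b‖) ^ 2 * ‖a‖ ^ 2 + 2 * (K * ‖a‖) ^ 2 * ‖b‖ ^ 2 +
        (K * ‖a‖) ^ 2 * (K * ‖b‖) ^ 2 := by gcongr
    _ = (4 * K ^ 2 + K ^ 4) * (‖a‖ * ‖b‖) ^ 2 := by ring
    _ ≤ (2 * K + K ^ 2) ^ 2 * (‖a‖ * ‖b‖) ^ 2 := by
        gcongr
        have : 0 ≤ K ^ 3 := by positivity
        nlinarith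
    _ = _ := by rw [algConst]; ring

variable (L) in
/-- The pointwise product. It is determined by its values, as `ev` is injective. -/
def mul (a b : Coeff) : Coeff := (exists_mul (L := L) a b).choose

@[simp] theorem ev_mul (a b : Coeff) : ev L (mul L a b) = ev L a * ev L b :=
  (exists_mul (L := L) a b).choose_spec.1

theorem norm_mul_le' (a b : Coeff) : ‖mul L a b‖ ≤ algConst L * (‖a‖ * ‖b‖) :=
  (exists_mul (L := L) a b).choose_spec.2

theorem ev_ext {a b : Coeff} (h : ∀ x, ev L a x = ev L b x) : a = b :=
  ev_injective L (funext h)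

theorem mul_sub_mul_eq (a b a' b' : Coeff) :
    mul L a b - mul L a' b' = mul L (a - a') b + mul L a' (b - b') := by
  refine ev_ext (L := L) fun x => ?_
  simp; ring

theorem exists_conj (a : Coeff) :
    ∃ c : Coeff, (∀ x, ev L c x = (starRingEnd ℂ) (ev L a x)) ∧
      ‖c‖ ^ 2 ≤ 1 * ‖a‖ ^ 2 + 0 * ‖a‖ ^ 2 + ‖ev L a‖ ^ 2 := by
  obtain ⟨c, hc, hn⟩ := exists_ev_eq_of_le
    (⟨fun x => (starRingEnd ℂ) (ev L a x), by fun_prop⟩ : C(AddCircle L, ℂ)) a a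
    (A := 1) (B := 0) (D := ‖ev L a‖ ^ 2) zero_le_one le_rfl (fun x y => by
      simp [← map_sub]) (fun x => by
      have := (ev L a).norm_coe_le_norm x
      simp only [ContinuousMap.coe_mk, Complex.norm_conj]
      gcongr)
  exact ⟨c, fun x => by rw [hc]; rfl, hn⟩

variable (L) in
/-- The pointwise complex conjugate. -/
def cconj (a : Coeff) : Coeff := (exists_conj (L := L) a).choose

@[simp] theorem ev_cconj (a : Coeff) (x : AddCircle L) :
    ev L (cconj L a) x = (starRingEnd ℂ) (ev L a x) :=
  (exists_conj (L := L) a).choose_spec.1 x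

theorem norm_cconj_le (a : Coeff) : ‖cconj L a‖ ≤ (1 + ‖sobolevSeq L‖) * ‖a‖ := by
  have h := (exists_conj (L := L) a).choose_spec.2
  refine le_of_sq_le_sq (h.trans ?_) (by positivity)
  have ha : ‖ev L a‖ ^ 2 ≤ (‖sobolevSeq L‖ * ‖a‖) ^ 2 := by gcongr; exact norm_ev_le L a
  nlinarith [mul_nonneg (norm_nonneg (sobolevSeq L)) (sq_nonneg ‖a‖)]

theorem exists_one : ∃ c : Coeff, ev L c = 1 := by
  obtain ⟨c, hc, -⟩ := exists_ev_eq_of_le (1 : C(AddCircle L, ℂ)) 0 0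
    (A := 0) (B := 0) (D := 1) le_rfl le_rfl (by simp) (by simp)
  exact ⟨c, hc⟩

variable (L) in
/-- The constant function `1`. -/
def one : Coeff := (exists_one (L := L)).choose

@[simp] theorem ev_one : ev L (one L) = 1 := (exists_one (L := L)).choose_spec

variable (L) in
/-- The pointwise square modulus. -/
def modSq (a : Coeff) : Coeff := mul L a (cconj L a)

@[simp] theorem ev_modSq (a : Coeff) (x : AddCircle L) :
    ev L (modSq L a) x = ((‖ev L a x‖ ^ 2 : ℝ) : ℂ) := by
  rw [modSq, ev_mul, ContinuousMap.mul_apply, ev_cconj, Complex.mul_conj']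
  norm_cast

/-! ### The adiabatic density -/

theorem adiabaticDensity_sub (c : Constants) (z w : ℂ) :
    adiabaticDensity c z - adiabaticDensity c w =
      c.R / c.P * (adiabaticDensity c z * adiabaticDensity c w) * (‖w‖ ^ 2 - ‖z‖ ^ 2) := by
  have h1 : 0 < c.β + c.R * ‖z‖ ^ 2 := by have := c.β_pos; have := c.R_pos; positivity
  have h2 : 0 < c.β + c.R * ‖w‖ ^ 2 := by have := c.β_pos; have := c.R_pos; positivity
  have h3 := c.P_pos.ne'
  rw [adiabaticDensity, adiabaticDensity]
  field_simp
  ring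

theorem adiabaticDensity_pos (c : Constants) (z : ℂ) : 0 < adiabaticDensity c z := by
  have := c.β_pos; have := c.R_pos; have := c.P_pos
  unfold adiabaticDensity; positivity

theorem adiabaticDensity_le (c : Constants) (z : ℂ) : adiabaticDensity c z ≤ c.P / c.β := by
  have := c.β_pos; have := c.R_pos; have := c.P_pos
  unfold adiabaticDensity
  gcongr
  nlinarith [mul_nonneg c.R_pos.le (sq_nonneg ‖z‖)]

theorem continuous_adiabaticDensity (c : Constants) : Continuous (adiabaticDensity c) := by
  unfold adiabaticDensity
  refine continuous_const.div (by fun_prop) fun z => ?_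
  have := c.β_pos; have := c.R_pos
  positivity

theorem abs_norm_sq_sub_le (z w : ℂ) : |‖z‖ ^ 2 - ‖w‖ ^ 2| ≤ (‖z‖ + ‖w‖) * ‖z - w‖ := by
  have : ‖z‖ ^ 2 - ‖w‖ ^ 2 = (‖z‖ + ‖w‖) * (‖z‖ - ‖w‖) := by ring
  rw [this, abs_mul, abs_of_nonneg (by positivity)]
  gcongr
  exact abs_norm_sub_norm_le z w

theorem exists_dens (c : Constants) (a : Coeff) :
    ∃ d : Coeff, (∀ x, ev L d x = (adiabaticDensity c (ev L a x) : ℂ)) ∧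
      ‖d‖ ^ 2 ≤ (2 * c.R * c.P / c.β ^ 2 * (‖sobolevSeq L‖ * ‖a‖)) ^ 2 * ‖a‖ ^ 2 + 0 * ‖a‖ ^ 2 +
        (c.P / c.β) ^ 2 := by
  have hβ := c.β_pos
  have hR := c.R_pos
  have hP := c.P_pos
  obtain ⟨d, hd, hn⟩ := exists_ev_eq_of_le
    (⟨fun x => (adiabaticDensity c (ev L a x) : ℂ), Complex.continuous_ofReal.comp
      ((continuous_adiabaticDensity c).comp (ev L a).continuous)⟩ : C(AddCircle L, ℂ)) a a
    (A := (2 * c.R * c.P / c.β ^ 2 * (‖sobolevSeq L‖ * ‖a‖)) ^ 2) (B := 0) (D := (c.P / c.β) ^ 2)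
    (by positivity) le_rfl (fun x y => by
      rw [zero_mul, add_zero, ← mul_pow]
      gcongr
      rw [ContinuousMap.coe_mk, ← Complex.ofReal_sub, Complex.norm_real, Real.norm_eq_abs,
        adiabaticDensity_sub, abs_mul, abs_of_pos (mul_pos (div_pos hR hP)
          (mul_pos (adiabaticDensity_pos c _) (adiabaticDensity_pos c _)))]
      have h1 := abs_norm_sq_sub_le (ev L a y) (ev L a x)
      rw [norm_sub_rev] at h1
      have h2 : ‖ev L a y‖ + ‖ev L a x‖ ≤ 2 * (‖sobolevSeq L‖ * ‖a‖) := by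
        linarith [norm_ev_apply_le L a x, norm_ev_apply_le L a y]
      calc _ ≤ c.R / c.P * (c.P / c.β * (c.P / c.β)) *
            (2 * (‖sobolevSeq L‖ * ‖a‖) * ‖ev L a x - ev L a y‖) := by
            gcongr
            · exact (adiabaticDensity_pos c _).le
            · exact adiabaticDensity_le c _
            · exact adiabaticDensity_le c _
            · exact h1.trans (by gcongr)
        _ = _ := by field_simp) (fun x => by
      rw [ContinuousMap.coe_mk, Complex.norm_real,
        Real.norm_of_nonneg (adiabaticDensity_pos c _).le]
      have := (adiabaticDensity_pos c (ev L a x)).le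
      gcongr
      exact adiabaticDensity_le c _)
  exact ⟨d, fun x => by rw [hd]; rfl, hn⟩

variable (L) in
/-- The adiabatic reservoir density `P / (β + R|a|²)` as an element of `H¹`. -/
def dens (c : Constants) (a : Coeff) : Coeff := (exists_dens (L := L) c a).choose

@[simp] theorem ev_dens (c : Constants) (a : Coeff) (x : AddCircle L) :
    ev L (dens L c a) x = (adiabaticDensity c (ev L a x) : ℂ) :=
  (exists_dens (L := L) c a).choose_spec.1 x

theorem norm_dens_le (c : Constants) (a : Coeff) {M : ℝ} (ha : ‖a‖ ≤ M) :
    ‖dens L c a‖ ≤ 2 * c.R * c.P / c.β ^ 2 * (‖sobolevSeq L‖ * M) * M + c.P / c.β := by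
  have hβ := c.β_pos
  have hR := c.R_pos
  have hP := c.P_pos
  have hM : 0 ≤ M := (norm_nonneg _).trans ha
  have h := (exists_dens (L := L) c a).choose_spec.2
  refine le_of_sq_le_sq (h.trans ?_) (by positivity)
  calc _ ≤ (2 * c.R * c.P / c.β ^ 2 * (‖sobolevSeq L‖ * M)) ^ 2 * M ^ 2 + 0 * ‖a‖ ^ 2 +
        (c.P / c.β) ^ 2 := by gcongr
    _ ≤ _ := by
        have : 0 ≤ 2 * c.R * c.P / c.β ^ 2 * (‖sobolevSeq L‖ * M) * M * (c.P / c.β) := by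
          positivity
        nlinarith

/-! ### Maps that are Lipschitz on balls -/

/-- `F` is Lipschitz on every ball centred at the origin. -/
def LipOnBalls {E E' : Type*} [NormedAddCommGroup E] [NormedAddCommGroup E'] (F : E → E') : Prop :=
  ∀ M : ℝ, ∃ K : ℝ, 0 ≤ K ∧ ∀ x y, ‖x‖ ≤ M → ‖y‖ ≤ M → ‖F x - F y‖ ≤ K * ‖x - y‖

section LipOnBalls

variable {E E' : Type*} [NormedAddCommGroup E] [NormedAddCommGroup E']

theorem LipOnBalls.bounded {F : E → E'} (hF : LipOnBalls F) (M : ℝ) :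
    ∃ B : ℝ, 0 ≤ B ∧ ∀ x, ‖x‖ ≤ M → ‖F x‖ ≤ B := by
  rcases lt_or_ge M 0 with hM | hM
  · exact ⟨0, le_rfl, fun x hx => absurd (norm_nonneg x) (by linarith)⟩
  obtain ⟨K, hK, h⟩ := hF M
  refine ⟨‖F 0‖ + K * M, by positivity, fun x hx => ?_⟩
  have h1 := h x 0 hx (by simpa)
  have h2 := norm_le_norm_add_norm_sub' (F x) (F 0)
  rw [sub_zero] at h1
  nlinarith

theorem LipOnBalls.continuous {F : E → E'} (hF : LipOnBalls F) : Continuous F := by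
  refine continuous_iff_continuousAt.2 fun x => ?_
  obtain ⟨K, -, h⟩ := hF (‖x‖ + 1)
  rw [ContinuousAt, tendsto_iff_norm_sub_tendsto_zero]
  have h1 : Tendsto (fun y => K * ‖y - x‖) (𝓝 x) (𝓝 0) := by
    have : Tendsto (fun y => ‖y - x‖) (𝓝 x) (𝓝 0) := tendsto_iff_norm_sub_tendsto_zero.1 tendsto_id
    simpa using this.const_mul K
  refine squeeze_zero' (Eventually.of_forall fun _ => norm_nonneg _) ?_ h1
  have h2 : ∀ᶠ y in 𝓝 x, ‖y‖ < ‖x‖ + 1 :=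
    (continuous_norm.tendsto x).eventually_lt_const (by linarith)
  filter_upwards [h2] with y hy
  exact h y x hy.le (by linarith)

theorem LipOnBalls.const (c : E') : LipOnBalls fun _ : E => c :=
  fun _ => ⟨0, le_rfl, by simp⟩

theorem LipOnBalls.of_lipschitz {F : E → E'} (K : ℝ) (hK : 0 ≤ K)
    (h : ∀ x y, ‖F x - F y‖ ≤ K * ‖x - y‖) : LipOnBalls F :=
  fun _ => ⟨K, hK, fun x y _ _ => h x y⟩

theorem LipOnBalls.add {F G : E → E'} (hF : LipOnBalls F) (hG : LipOnBalls G) :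
    LipOnBalls fun x => F x + G x := fun M => by
  obtain ⟨K, hK, h⟩ := hF M
  obtain ⟨K', hK', h'⟩ := hG M
  refine ⟨K + K', by positivity, fun x y hx hy => ?_⟩
  rw [add_sub_add_comm, add_mul]
  exact (norm_add_le _ _).trans (add_le_add (h x y hx hy) (h' x y hx hy))

theorem LipOnBalls.smul {F : E → Coeff} (hF : LipOnBalls F) (z : ℂ) :
    LipOnBalls fun x => z • F x := fun M => by
  obtain ⟨K, hK, h⟩ := hF M
  refine ⟨‖z‖ * K, by positivity, fun x y hx hy => ?_⟩
  rw [← smul_sub, norm_smul, mul_assoc]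
  exact mul_le_mul_of_nonneg_left (h x y hx hy) (norm_nonneg _)

theorem LipOnBalls.sub {F G : E → Coeff} (hF : LipOnBalls F) (hG : LipOnBalls G) :
    LipOnBalls fun x => F x - G x := by
  simpa [sub_eq_add_neg] using hF.add (hG.smul (-1))

theorem LipOnBalls.mul {F G : E → Coeff} (hF : LipOnBalls F) (hG : LipOnBalls G) :
    LipOnBalls fun x => mul L (F x) (G x) := fun M => by
  obtain ⟨K, hK, h⟩ := hF M
  obtain ⟨K', hK', h'⟩ := hG M
  obtain ⟨B, hB, hb⟩ := hF.bounded M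
  obtain ⟨B', hB', hb'⟩ := hG.bounded M
  have hA := algConst_nonneg (L := L)
  refine ⟨algConst L * (K * B' + B * K'), by positivity, fun x y hx hy => ?_⟩
  rw [mul_sub_mul_eq]
  refine (norm_add_le _ _).trans ((add_le_add (norm_mul_le' _ _) (norm_mul_le' _ _)).trans ?_)
  have h1 := h x y hx hy
  have h2 := h' x y hx hy
  have h3 := hb y hy
  have h4 := hb' x hx
  calc _ ≤ algConst L * ((K * ‖x - y‖) * B') + algConst L * (B * (K' * ‖x - y‖)) := by gcongr
    _ = _ := by ring

theorem LipOnBalls.cconj {F : E → Coeff} (hF : LipOnBalls F) :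
    LipOnBalls fun x => cconj L (F x) := fun M => by
  obtain ⟨K, hK, h⟩ := hF M
  refine ⟨(1 + ‖sobolevSeq L‖) * K, by positivity, fun x y hx hy => ?_⟩
  have h1 : GrossPitaevskii.cconj L (F x) - GrossPitaevskii.cconj L (F y) =
      GrossPitaevskii.cconj L (F x - F y) := ev_ext (L := L) fun t => by simp
  rw [h1, mul_assoc]
  exact (norm_cconj_le _).trans (mul_le_mul_of_nonneg_left (h x y hx hy) (by positivity))

theorem LipOnBalls.modSq {F : E → Coeff} (hF : LipOnBalls F) :
    LipOnBalls fun x => modSq L (F x) := hF.mul hF.cconj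

theorem LipOnBalls.dens (c : Constants) {F : E → Coeff} (hF : LipOnBalls F) :
    LipOnBalls fun x => dens L c (F x) := fun M => by
  obtain ⟨K, hK, h⟩ := (hF.modSq (L := L)) M
  obtain ⟨B, hB, hb⟩ := hF.bounded M
  have hR := c.R_pos
  have hP := c.P_pos
  have hβ := c.β_pos
  have hA := algConst_nonneg (L := L)
  set D := 2 * c.R * c.P / c.β ^ 2 * (‖sobolevSeq L‖ * B) * B + c.P / c.β with hD
  have hD0 : 0 ≤ D := by positivity
  refine ⟨c.R / c.P * (algConst L * (algConst L * (D * D)) * K), by positivity,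
    fun x y hx hy => ?_⟩
  have h1 : GrossPitaevskii.dens L c (F x) - GrossPitaevskii.dens L c (F y) =
      ((c.R / c.P : ℝ) : ℂ) • GrossPitaevskii.mul L (GrossPitaevskii.mul L
        (GrossPitaevskii.dens L c (F x)) (GrossPitaevskii.dens L c (F y)))
        (GrossPitaevskii.modSq L (F y) - GrossPitaevskii.modSq L (F x)) :=
    ev_ext (L := L) fun t => by
      simp only [map_sub, map_smul, ContinuousMap.sub_apply, ContinuousMap.smul_apply, ev_mul,
        ContinuousMap.mul_apply, ev_dens, ev_modSq, ← Complex.ofReal_sub, adiabaticDensity_sub,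
        smul_eq_mul]
      push_cast
      ring
  rw [h1, norm_smul, Complex.norm_real, Real.norm_of_nonneg (by positivity), mul_assoc (c.R / c.P)]
  gcongr
  have h2 := h y x hy hx
  rw [norm_sub_rev y x] at h2
  have h3 := norm_dens_le (L := L) c (F x) (hb x hx)
  have h4 := norm_dens_le (L := L) c (F y) (hb y hy)
  calc _ ≤ algConst L * (‖GrossPitaevskii.mul L (GrossPitaevskii.dens L c (F x))
          (GrossPitaevskii.dens L c (F y))‖ *
          ‖GrossPitaevskii.modSq L (F y) - GrossPitaevskii.modSq L (F x)‖) := norm_mul_le' _ _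
    _ ≤ algConst L * ((algConst L * (D * D)) * (K * ‖x - y‖)) := by
        gcongr
        exact (norm_mul_le' _ _).trans (by gcongr)
    _ = _ := by ring

end LipOnBalls

/-! ### Bounds on `H¹` inner products from pointwise bounds -/

open ComplexConjugate in
/-- One-sided bounds on `H¹` inner products follow from one-sided bounds on the increments and on
the values of the functions: the `H¹` inner product is a limit of `L²` inner products of difference
quotients. -/
theorem re_inner_add_le {a b a' b' w : Coeff} {C D : ℝ}
    (h1 : ∀ x y, (conj (ev L a x - ev L a y) * (ev L b x - ev L b y)).re +
      (conj (ev L a' x - ev L a' y) * (ev L b' x - ev L b' y)).re ≤ C * ‖ev L w x - ev L w y‖ ^ 2)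
    (h2 : ∀ x, (conj (ev L a x) * ev L b x).re + (conj (ev L a' x) * ev L b' x).re ≤
      C * ‖ev L w x‖ ^ 2 + D) :
    (inner ℂ a b).re + (inner ℂ a' b').re ≤ C * ‖w‖ ^ 2 + D := by
  have hre : ∀ {f : AddCircle L → ℂ}, Continuous f →
      (∫ x, f x ∂AddCircle.haarAddCircle).re = ∫ x, (f x).re ∂AddCircle.haarAddCircle :=
    fun {f} hf => (integral_re (𝕜 := ℂ) (integrable_of_continuous hf)).symm
  have hL2 : (inner ℂ (toL2 L a) (toL2 L b)).re + (inner ℂ (toL2 L a') (toL2 L b')).re ≤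
      C * ‖toL2 L w‖ ^ 2 + D := by
    rw [inner_toL2, inner_toL2, norm_toL2_sq, hre (by fun_prop), hre (by fun_prop),
      ← integral_add (integrable_of_continuous (by fun_prop))
        (integrable_of_continuous (by fun_prop)), ← integral_const_mul]
    calc _ ≤ ∫ x, (C * ‖ev L w x‖ ^ 2 + D) ∂AddCircle.haarAddCircle :=
          integral_mono (integrable_of_continuous (by fun_prop))
            (integrable_of_continuous (by fun_prop)) h2
      _ = _ := by
          rw [integral_add (integrable_of_continuous (by fun_prop)) (integrable_const _)]
          simp
  have hT := fun a b : Coeff =>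
    (Complex.continuous_re.tendsto _).comp (tendsto_diff_inner (L := L) a b)
  have hww : (inner ℂ w w - inner ℂ (toL2 L w) (toL2 L w) : ℂ).re = ‖w‖ ^ 2 - ‖toL2 L w‖ ^ 2 := by
    rw [inner_self_eq_norm_sq_to_K, inner_self_eq_norm_sq_to_K]
    norm_cast
  have hlim := le_of_tendsto_of_tendsto ((hT a b).add (hT a' b')) ((hT w w).const_mul C) ?_
  · rw [hww, Complex.sub_re, Complex.sub_re] at hlim
    linarith
  · filter_upwards with h
    simp only [Function.comp_apply, Complex.re_ofReal_mul]
    rw [← mul_add, mul_left_comm]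
    refine mul_le_mul_of_nonneg_left ?_ (by positivity)
    rw [hre (by fun_prop), hre (by fun_prop), hre (by fun_prop),
      ← integral_add (integrable_of_continuous (by fun_prop))
        (integrable_of_continuous (by fun_prop)), ← integral_const_mul]
    refine integral_mono (integrable_of_continuous (by fun_prop))
      (integrable_of_continuous (by fun_prop)) fun x => ?_
    refine (h1 (x + h) x).trans_eq ?_
    rw [Complex.conj_mul']
    norm_cast

end

section

/-! ### Scalar differential inequalities -/

theorem le_of_hasDerivWithinAt_nonneg {z z' : ℝ → ℝ} {a b : ℝ}
    (hz : ∀ t ∈ Icc a b, HasDerivWithinAt z (z' t) (Icc a b) t) (h : ∀ t ∈ Icc a b, 0 ≤ z' t) :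
    ∀ t ∈ Icc a b, z a ≤ z t := by
  have hd : ∀ t ∈ interior (Icc a b), HasDerivAt z (z' t) t := fun t ht => by
    rw [interior_Icc] at ht
    exact (hz t (Ioo_subset_Icc_self ht)).hasDerivAt (Icc_mem_nhds ht.1 ht.2)
  have hm : MonotoneOn z (Icc a b) := by
    refine monotoneOn_of_deriv_nonneg (convex_Icc a b)
      (fun t ht => (hz t ht).continuousWithinAt)
      (fun t ht => (hd t ht).differentiableAt.differentiableWithinAt) fun t ht => ?_
    rw [(hd t ht).deriv]
    exact h t (interior_subset ht)
  exact fun t ht => hm (left_mem_Icc.2 (ht.1.trans ht.2)) ht ht.1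

theorem hasDerivWithinAt_primitive {F : Type*} [NormedAddCommGroup F] [NormedSpace ℝ F]
    [CompleteSpace F] {p : ℝ → F} {a b : ℝ} (hab : a ≤ b) (hp : ContinuousOn p (Icc a b)) :
    (∀ t ∈ Icc a b, HasDerivWithinAt (fun t => ∫ s in a..t, p s) (p t) (Icc a b) t) := by
  intro t ht
  set q := IccExtend hab ((Icc a b).domRestrict p) with hq
  have hqc : Continuous q := continuous_IccExtend_iff.2 hp.domRestrict
  have hqp : ∀ s ∈ Icc a b, q s = p s := fun s hs => by rw [hq, IccExtend_of_mem _ _ hs]; rfl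
  have h1 : HasDerivAt (fun t => ∫ s in a..t, q s) (q t) t :=
    (hqc.integral_hasStrictDerivAt a t).hasDerivAt
  rw [hqp t ht] at h1
  refine h1.hasDerivWithinAt.congr_of_mem (fun s hs => ?_) ht
  refine intervalIntegral.integral_congr fun τ hτ => ?_
  rw [uIcc_of_le hs.1] at hτ
  exact (hqp τ ⟨hτ.1, hτ.2.trans hs.2⟩).symm

/-- A function with `z' ≥ -p z` that is nonnegative initially stays nonnegative. -/
theorem nonneg_of_deriv_ge {z z' p : ℝ → ℝ} {a b : ℝ}
    (hz : ∀ t ∈ Icc a b, HasDerivWithinAt z (z' t) (Icc a b) t) (hp : ContinuousOn p (Icc a b))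
    (h : ∀ t ∈ Icc a b, -(p t) * z t ≤ z' t) (h0 : 0 ≤ z a) : ∀ t ∈ Icc a b, 0 ≤ z t := by
  intro t ht
  have hd : ∀ t ∈ Icc a b, HasDerivWithinAt (fun t => z t * Real.exp (∫ s in a..t, p s))
      (z' t * Real.exp (∫ s in a..t, p s) + z t * (Real.exp (∫ s in a..t, p s) * p t))
      (Icc a b) t := fun t ht =>
    (hz t ht).mul (hasDerivWithinAt_primitive (ht.1.trans ht.2) hp t ht).exp
  have h1 := le_of_hasDerivWithinAt_nonneg hd (fun t ht => by
    have := h t ht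
    have he := Real.exp_pos (∫ s in a..t, p s)
    have : 0 ≤ (z' t + p t * z t) * Real.exp (∫ s in a..t, p s) :=
      mul_nonneg (by linarith) he.le
    linarith) t ht
  simp only [intervalIntegral.integral_same, Real.exp_zero, mul_one] at h1
  exact nonneg_of_mul_nonneg_left (h0.trans h1) (Real.exp_pos _)

/-- Gronwall's inequality with an integrated forcing. -/
theorem le_exp_mul_of_deriv_le {y y' r : ℝ → ℝ} {K T : ℝ} (hK : 0 ≤ K)
    (hy : ∀ t ∈ Icc 0 T, HasDerivWithinAt y (y' t) (Icc 0 T) t) (hr : ContinuousOn r (Icc 0 T))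
    (hr0 : ∀ t ∈ Icc 0 T, 0 ≤ r t) (h : ∀ t ∈ Icc 0 T, y' t ≤ K * y t + r t) :
    ∀ t ∈ Icc 0 T, y t ≤ Real.exp (K * t) * (y 0 + ∫ s in 0..t, r s) := by
  intro t ht
  have hE : ∀ t, HasDerivWithinAt (fun t => Real.exp (-K * t)) (Real.exp (-K * t) * -K)
      (Icc 0 T) t := fun t => by
    simpa using ((hasDerivAt_id t).const_mul (-K)).exp.hasDerivWithinAt
  have hd : ∀ t ∈ Icc 0 T, HasDerivWithinAt
      (fun t => (∫ s in 0..t, r s) - y t * Real.exp (-K * t))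
      (r t - (y' t * Real.exp (-K * t) + y t * (Real.exp (-K * t) * -K))) (Icc 0 T) t :=
    fun t ht => (hasDerivWithinAt_primitive (ht.1.trans ht.2) hr t ht).sub ((hy t ht).mul (hE t))
  have h1 := le_of_hasDerivWithinAt_nonneg hd (fun t ht => by
    have h2 := h t ht
    have h3 := hr0 t ht
    have he := Real.exp_pos (-K * t)
    have he1 : Real.exp (-K * t) ≤ 1 := Real.exp_le_one_iff.2 (by nlinarith [ht.1])
    have h4 : (y' t - K * y t) * Real.exp (-K * t) ≤ r t * Real.exp (-K * t) :=
      mul_le_mul_of_nonneg_right (by linarith) he.le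
    have h5 : r t * Real.exp (-K * t) ≤ r t := mul_le_of_le_one_right h3 he1
    linarith) t ht
  simp only [intervalIntegral.integral_same, mul_zero, Real.exp_zero, mul_one] at h1
  have h2 : y t * Real.exp (-K * t) ≤ y 0 + ∫ s in 0..t, r s := by linarith
  have h3 : y t = Real.exp (K * t) * (y t * Real.exp (-K * t)) := by
    rw [mul_left_comm, ← Real.exp_add]; simp
  rw [h3]
  exact mul_le_mul_of_nonneg_left h2 (Real.exp_pos _).le

section Relaxation

variable {y b : ℝ → ℝ} {P ε a t : ℝ}

theorem hasDerivWithinAt_exp_decay (q ε a : ℝ) (S : Set ℝ) (s : ℝ) :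
    HasDerivWithinAt (fun s => Real.exp (-(q / ε) * (s - a)))
      (Real.exp (-(q / ε) * (s - a)) * -(q / ε)) S s := by
  have := (((hasDerivAt_id s).sub_const a).const_mul (-(q / ε))).exp.hasDerivWithinAt (s := S)
  simpa using this

/-- Comparison of `ε y' = P - b y` with the solution for the smaller constant rate `q`. -/
theorem relaxation_le {q N : ℝ} (hε : 0 < ε) (hP : 0 < P) (hq : 0 < q) (hat : a ≤ t)
    (hy : ∀ s ∈ Icc a t, HasDerivWithinAt y ((P - b s * y s) / ε) (Icc a t) s)
    (hb : ∀ s ∈ Icc a t, q ≤ b s) (h0 : ∀ s ∈ Icc a t, 0 ≤ y s) (hN : y a ≤ N) :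
    y t ≤ P / q + N * Real.exp (-(q / ε) * (t - a)) := by
  have hd : ∀ s ∈ Icc a t, HasDerivWithinAt
      (fun s => P / q + N * Real.exp (-(q / ε) * (s - a)) - y s)
      (N * (Real.exp (-(q / ε) * (s - a)) * -(q / ε)) - (P - b s * y s) / ε) (Icc a t) s :=
    fun s hs => (((hasDerivWithinAt_exp_decay q ε a _ s).const_mul N).const_add (P / q)).sub
      (hy s hs)
  have := nonneg_of_deriv_ge hd (p := fun _ => q / ε) continuousOn_const (fun s hs => by
    have h1 : 0 ≤ (b s - q) * y s / ε :=
      div_nonneg (mul_nonneg (by linarith [hb s hs]) (h0 s hs)) hε.le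
    have h2 : N * (Real.exp (-(q / ε) * (s - a)) * -(q / ε)) - (P - b s * y s) / ε -
        -(q / ε) * (P / q + N * Real.exp (-(q / ε) * (s - a)) - y s) = (b s - q) * y s / ε := by
      field_simp; ring
    linarith) (by
      have : 0 < P / q := by positivity
      simp; linarith) t (right_mem_Icc.2 hat)
  linarith

/-- Comparison of `ε y' = P - b y` with the solution for the larger constant rate `q`, started
at `0`. -/
theorem le_relaxation {q : ℝ} (hε : 0 < ε) (hq : 0 < q) (hat : a ≤ t)
    (hy : ∀ s ∈ Icc a t, HasDerivWithinAt y ((P - b s * y s) / ε) (Icc a t) s)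
    (hb : ∀ s ∈ Icc a t, b s ≤ q) (h0 : ∀ s ∈ Icc a t, 0 ≤ y s) :
    P / q - P / q * Real.exp (-(q / ε) * (t - a)) ≤ y t := by
  have hd : ∀ s ∈ Icc a t, HasDerivWithinAt
      (fun s => y s - (P / q - P / q * Real.exp (-(q / ε) * (s - a))))
      ((P - b s * y s) / ε - -(P / q * (Real.exp (-(q / ε) * (s - a)) * -(q / ε)))) (Icc a t) s :=
    fun s hs => (hy s hs).sub
      (((hasDerivWithinAt_exp_decay q ε a _ s).const_mul (P / q)).const_sub (P / q))
  have := nonneg_of_deriv_ge hd (p := fun _ => q / ε) continuousOn_const (fun s hs => by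
    have h1 : 0 ≤ (q - b s) * y s / ε :=
      div_nonneg (mul_nonneg (by linarith [hb s hs]) (h0 s hs)) hε.le
    have h2 : (P - b s * y s) / ε - -(P / q * (Real.exp (-(q / ε) * (s - a)) * -(q / ε))) -
        -(q / ε) * (y s - (P / q - P / q * Real.exp (-(q / ε) * (s - a)))) =
        (q - b s) * y s / ε := by
      field_simp; ring
    linarith) (by simpa using h0 a (left_mem_Icc.2 hat)) t (right_mem_Icc.2 hat)
  linarith

/-- A linear relaxation equation `ε y' = P - b y` with rates converging near the time `t > 0`
drives `y(t)` to the equilibrium value as `ε → 0`. -/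
theorem tendsto_relaxation {N b₀ : ℝ} {e : ℕ → ℝ} {y b : ℕ → ℝ → ℝ} (hP : 0 < P) (hb₀ : 0 < b₀)
    (ht : 0 < t) (he : ∀ k, 0 < e k) (he0 : Tendsto e atTop (𝓝 0))
    (hy : ∀ k, ∀ s ∈ Icc 0 t, HasDerivWithinAt (y k) ((P - b k s * y k s) / e k) (Icc 0 t) s)
    (h0 : ∀ k, ∀ s ∈ Icc 0 t, 0 ≤ y k s) (hN : ∀ k, ∀ s ∈ Icc 0 t, y k s ≤ N)
    (hb : ∀ η > 0, ∃ δ > 0, ∀ᶠ k in atTop, ∀ s ∈ Icc 0 t, t - δ ≤ s → |b k s - b₀| ≤ η) :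
    Tendsto (fun k => y k t) atTop (𝓝 (P / b₀)) := by
  have hexp : ∀ q δ : ℝ, 0 < q → 0 < δ →
      Tendsto (fun k => Real.exp (-(q / e k) * δ)) atTop (𝓝 0) := fun q δ hq hδ => by
    have h1 : Tendsto (fun k => (e k)⁻¹) atTop atTop :=
      tendsto_inv_nhdsGT_zero.comp (tendsto_nhdsWithin_iff.2 ⟨he0, Eventually.of_forall he⟩)
    have h2 : Tendsto (fun k => (q * δ) * (e k)⁻¹) atTop atTop :=
      h1.const_mul_atTop (by positivity)
    refine (Real.tendsto_exp_neg_atTop_nhds_zero.comp h2).congr fun k => ?_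
    simp only [Function.comp_apply]
    congr 1
    ring
  have hsub : ∀ δ, 0 < δ → Icc (t - min δ t) t ⊆ Icc 0 t := fun δ hδ =>
    Icc_subset_Icc_left (by linarith [min_le_right δ t])
  refine tendsto_order.2 ⟨fun c hc => ?_, fun c hc => ?_⟩
  · have hcont : Tendsto (fun η => P / (b₀ + η)) (𝓝[>] 0) (𝓝 (P / (b₀ + 0))) :=
      ((tendsto_const_nhds.div (tendsto_const_nhds.add tendsto_id) (by linarith))).mono_left
        nhdsWithin_le_nhds
    rw [add_zero] at hcont
    obtain ⟨η, hηc, hη⟩ := ((hcont.eventually_const_lt hc).and self_mem_nhdsWithin).exists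
    have hη' : (0 : ℝ) < η := hη
    have hq : 0 < b₀ + η := by linarith
    obtain ⟨δ, hδ, hk⟩ := hb η hη
    have hδ' : 0 < min δ t := lt_min hδ ht
    have hlim := ((hexp _ _ hq hδ').const_mul (P / (b₀ + η))).const_sub (P / (b₀ + η))
    rw [mul_zero, sub_zero] at hlim
    filter_upwards [hk, hlim.eventually_const_lt hηc] with k hk1 hk2
    refine hk2.trans_le ?_
    have := le_relaxation (he k) hq (by linarith : t - min δ t ≤ t)
      (fun s hs => (hy k s (hsub δ hδ hs)).mono (hsub δ hδ))
      (fun s hs => by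
        have := abs_le.1 (hk1 s (hsub δ hδ hs) (by linarith [hs.1, min_le_left δ t]))
        linarith) (fun s hs => h0 k s (hsub δ hδ hs))
    rwa [sub_sub_cancel] at this
  · have hcont : Tendsto (fun η => P / (b₀ - η)) (𝓝[>] 0) (𝓝 (P / (b₀ - 0))) :=
      ((tendsto_const_nhds.div (tendsto_const_nhds.sub tendsto_id) (by linarith))).mono_left
        nhdsWithin_le_nhds
    rw [sub_zero] at hcont
    have hsmall : ∀ᶠ η in 𝓝[>] (0 : ℝ), η < b₀ :=
      (eventually_lt_nhds hb₀).filter_mono nhdsWithin_le_nhds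
    obtain ⟨η, ⟨hηc, hηb⟩, hη⟩ :=
      (((hcont.eventually_lt_const hc).and hsmall).and self_mem_nhdsWithin).exists
    have hq : 0 < b₀ - η := by linarith
    obtain ⟨δ, hδ, hk⟩ := hb η hη
    have hδ' : 0 < min δ t := lt_min hδ ht
    have hlim := ((hexp _ _ hq hδ').const_mul N).const_add (P / (b₀ - η))
    rw [mul_zero, add_zero] at hlim
    filter_upwards [hk, hlim.eventually_lt_const hηc] with k hk1 hk2
    refine lt_of_le_of_lt ?_ hk2
    have := relaxation_le (he k) hP hq (by linarith : t - min δ t ≤ t)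
      (fun s hs => (hy k s (hsub δ hδ hs)).mono (hsub δ hδ))
      (fun s hs => by
        have := abs_le.1 (hk1 s (hsub δ hδ hs) (by linarith [hs.1, min_le_left δ t]))
        linarith) (fun s hs => h0 k s (hsub δ hδ hs))
      (hN k _ (hsub δ hδ (left_mem_Icc.2 (by linarith))))
    rwa [sub_sub_cancel] at this

end Relaxation

/-! ### Global solutions of ordinary differential equations -/

section ODE

variable {E : Type*} [NormedAddCommGroup E] [NormedSpace ℝ E]

/-- `u` solves `u' = f(t, u)`, `u(0) = x₀` on `[0, T]`. -/
structure IsTrajectory (f : ℝ → E → E) (x₀ : E) (T : ℝ) (u : ℝ → E) : Prop where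
  init : u 0 = x₀
  deriv : ∀ t ∈ Icc 0 T, HasDerivWithinAt u (f t (u t)) (Icc 0 T) t

/-- A vector field that is continuous in time and Lipschitz on bounded sets, uniformly on bounded
time intervals. -/
structure LocallyLipField (f : ℝ → E → E) : Prop where
  cont : ∀ x, ContinuousOn (fun t => f t x) (Ici 0)
  lip : ∀ T M : ℝ, ∃ K : ℝ, 0 ≤ K ∧
    ∀ t ∈ Icc 0 T, ∀ x y, ‖x‖ ≤ M → ‖y‖ ≤ M → ‖f t x - f t y‖ ≤ K * ‖x - y‖

variable {f : ℝ → E → E} {x₀ : E} {T : ℝ} {u v : ℝ → E}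

theorem IsTrajectory.continuousOn (hu : IsTrajectory f x₀ T u) : ContinuousOn u (Icc 0 T) :=
  fun t ht => (hu.deriv t ht).continuousWithinAt

theorem IsTrajectory.mono (hu : IsTrajectory f x₀ T u) {T' : ℝ} (h : T' ≤ T) :
    IsTrajectory f x₀ T' u :=
  ⟨hu.init, fun t ht => (hu.deriv t ⟨ht.1, ht.2.trans h⟩).mono (Icc_subset_Icc_right h)⟩

theorem hasDerivWithinAt_Ici_of_Icc {u' : E} {t : ℝ} (ht : t ∈ Ico 0 T)
    (h : HasDerivWithinAt u u' (Icc 0 T) t) : HasDerivWithinAt u u' (Ici t) t :=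
  h.mono_of_mem_nhdsWithin (mem_of_superset (Icc_mem_nhdsGE ht.2) (Icc_subset_Icc_left ht.1))

theorem IsTrajectory.eqOn (hf : LocallyLipField f) (hu : IsTrajectory f x₀ T u)
    (hv : IsTrajectory f x₀ T v) : EqOn u v (Icc 0 T) := by
  obtain ⟨M, hM⟩ := isCompact_Icc.exists_bound_of_continuousOn hu.continuousOn
  obtain ⟨M', hM'⟩ := isCompact_Icc.exists_bound_of_continuousOn hv.continuousOn
  obtain ⟨K, hK, hlip⟩ := hf.lip T (max M M')
  refine ODE_solution_unique_of_mem_Icc_right (v := f) (K := K.toNNReal)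
    (s := fun _ => Metric.closedBall 0 (max M M')) (fun t ht => ?_) hu.continuousOn
    (fun t ht => hasDerivWithinAt_Ici_of_Icc ht (hu.deriv t (Ico_subset_Icc_self ht)))
    (fun t ht => ?_) hv.continuousOn
    (fun t ht => hasDerivWithinAt_Ici_of_Icc ht (hv.deriv t (Ico_subset_Icc_self ht)))
    (fun t ht => ?_) (hu.init.trans hv.init.symm)
  · refine LipschitzOnWith.of_dist_le_mul fun x hx y hy => ?_
    rw [dist_eq_norm, dist_eq_norm, Real.coe_toNNReal _ hK]
    exact hlip t (Ico_subset_Icc_self ht) x y (by simpa using hx) (by simpa using hy)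
  · simpa using Or.inl (hM t (Ico_subset_Icc_self ht))
  · simpa using Or.inr (hM' t (Ico_subset_Icc_self ht))

/-- The radial retraction onto the ball of radius `M`. -/
def radial (M : ℝ) (x : E) : E := if ‖x‖ ≤ M then x else (M / ‖x‖) • x

theorem radial_of_le {M : ℝ} {x : E} (h : ‖x‖ ≤ M) : radial M x = x := if_pos h

theorem norm_radial_le {M : ℝ} (hM : 0 < M) (x : E) : ‖radial M x‖ ≤ M := by
  unfold radial
  split_ifs with h
  · exact h
  · have hx : 0 < ‖x‖ := hM.trans (not_le.1 h)
    rw [norm_smul, Real.norm_of_nonneg (by positivity), div_mul_cancel₀ _ hx.ne']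

theorem norm_radial_sub_le {M : ℝ} (hM : 0 < M) (x y : E) :
    ‖radial M x - radial M y‖ ≤ 2 * ‖x - y‖ := by
  wlog hxy : ‖y‖ ≤ ‖x‖ generalizing x y
  · rw [norm_sub_rev, norm_sub_rev x]
    exact this y x (not_le.1 hxy).le
  have h0 := norm_nonneg (x - y)
  have h1 : ‖x‖ - ‖y‖ ≤ ‖x - y‖ := norm_sub_norm_le x y
  by_cases hx : ‖x‖ ≤ M
  · rw [radial_of_le hx, radial_of_le (hxy.trans hx)]
    linarith
  have hx' := not_le.1 hx
  have hx0 : 0 < ‖x‖ := hM.trans hx'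
  have hle : M / ‖x‖ ≤ 1 := (div_le_one hx0).2 hx'.le
  by_cases hy : ‖y‖ ≤ M
  · rw [radial_of_le hy, radial, if_neg hx]
    have h2 : (M / ‖x‖) • x - y = (x - y) - (1 - M / ‖x‖) • x := by
      rw [sub_smul, one_smul]; abel
    have h3 : ‖(1 - M / ‖x‖) • x‖ = ‖x‖ - M := by
      rw [norm_smul, Real.norm_of_nonneg (by linarith), sub_mul, div_mul_cancel₀ _ hx0.ne', one_mul]
    rw [h2]
    refine (norm_sub_le _ _).trans ?_
    rw [h3]; linarith
  · have hy' := not_le.1 hy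
    have hy0 : 0 < ‖y‖ := hM.trans hy'
    rw [radial, radial, if_neg hx, if_neg hy]
    have h2 : (M / ‖x‖) • x - (M / ‖y‖) • y = (M / ‖x‖) • (x - y) - (M / ‖y‖ - M / ‖x‖) • y := by
      rw [sub_smul, smul_sub]; abel
    have h3 : ‖(M / ‖y‖ - M / ‖x‖) • y‖ = (M / ‖x‖) * (‖x‖ - ‖y‖) := by
      rw [norm_smul, Real.norm_of_nonneg]
      · field_simp
      · rw [sub_nonneg]; gcongr
    rw [h2]
    refine (norm_sub_le _ _).trans ?_
    rw [h3, norm_smul, Real.norm_of_nonneg (by positivity)]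
    have h4 : 0 < M / ‖x‖ := by positivity
    nlinarith

/-- The continuity argument: a bound that improves itself holds throughout. -/
theorem le_of_continuousOn_of_trap {φ : ℝ → ℝ} {M : ℝ} (hφ : ContinuousOn φ (Icc 0 T))
    (h0 : φ 0 ≤ M) (h : ∀ t ∈ Icc 0 T, (∀ s ∈ Icc 0 t, φ s ≤ M + 1) → φ t ≤ M) :
    ∀ t ∈ Icc 0 T, φ t ≤ M := by
  suffices hb : ∀ s ∈ Icc 0 T, φ s < M + 1 from fun t ht =>
    h t ht fun s hs => (hb s ⟨hs.1, hs.2.trans ht.2⟩).le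
  by_contra! hcon
  obtain ⟨s₀, hs₀, hs₁⟩ := hcon
  have hcl : IsClosed (Icc 0 T ∩ φ ⁻¹' Ici (M + 1)) :=
    hφ.preimage_isClosed_of_isClosed isClosed_Icc isClosed_Ici
  obtain ⟨m, ⟨hm, hmM⟩, hmin⟩ :=
    (isCompact_Icc.of_isClosed_subset hcl inter_subset_left).exists_isLeast ⟨s₀, hs₀, hs₁⟩
  have hlt : ∀ s ∈ Icc 0 m, s < m → φ s < M + 1 := fun s hs hsm => by
    by_contra! hc
    exact absurd (hmin ⟨⟨hs.1, hs.2.trans hm.2⟩, hc⟩) (not_le.2 hsm)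
  obtain ⟨s, hs, hsM⟩ := intermediate_value_Icc hm.1 (hφ.mono (Icc_subset_Icc_right hm.2))
    (show M + 1 ∈ Icc (φ 0) (φ m) from ⟨by linarith, hmM⟩)
  have hsm : s = m := by
    by_contra hne
    have := hlt s hs (lt_of_le_of_ne hs.2 hne)
    linarith
  rw [hsm] at hsM
  have := h m hm fun s hs => by
    rcases hs.2.lt_or_eq with hlt' | heq
    · exact (hlt s hs hlt').le
    · rw [heq, hsM]
  linarith

variable [CompleteSpace E]

/-- Existence up to time `T` from an a priori bound `M`. The field composed with the retraction onto
the ball of radius `M + 1` is globally Lipschitz, so that Picard–Lindelöf gives a solution on all of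
`[0, T]`; by the a priori bound this solution never reaches the sphere of radius `M + 1`. -/
theorem exists_isTrajectory (hf : LocallyLipField f) (x₀ : E) (hT : 0 ≤ T)
    (hap : ∃ M, ∀ t ∈ Icc 0 T, ∀ u, IsTrajectory f x₀ t u → ‖u t‖ ≤ M) :
    ∃ u, IsTrajectory f x₀ T u := by
  obtain ⟨M, hap⟩ := hap
  have hM0 : ‖x₀‖ ≤ M := hap 0 (left_mem_Icc.2 hT) (fun _ => x₀) ⟨rfl, fun t ht => by
    have h0 : t = 0 := le_antisymm ht.2 ht.1
    subst h0
    rw [hasDerivWithinAt_iff_tendsto_slope]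
    simp⟩
  have hM1 : 0 < M + 1 := by linarith [norm_nonneg x₀]
  obtain ⟨K, hK, hlip⟩ := hf.lip T (M + 1)
  obtain ⟨B, hB⟩ := isCompact_Icc.exists_bound_of_continuousOn
    ((hf.cont 0).mono (Icc_subset_Ici_self : Icc 0 T ⊆ Ici 0))
  have hB0 : 0 ≤ B := (norm_nonneg _).trans (hB 0 (left_mem_Icc.2 hT))
  set B' : ℝ := B + K * (M + 1) with hB'
  have hB'0 : 0 ≤ B' := by positivity
  have hpl : IsPicardLindelof (fun t x => f t (radial (M + 1) x))
      (⟨0, left_mem_Icc.2 hT⟩ : Icc 0 T) x₀ (B' * T).toNNReal 0 B'.toNNReal (K * 2).toNNReal := by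
    refine ⟨fun t ht => ?_, fun x _ => (hf.cont _).mono Icc_subset_Ici_self, fun t ht x _ => ?_, ?_⟩
    · refine LipschitzOnWith.of_dist_le_mul fun x _ y _ => ?_
      rw [dist_eq_norm, dist_eq_norm, Real.coe_toNNReal _ (by positivity), mul_assoc]
      refine (hlip t ht _ _ (norm_radial_le hM1 x) (norm_radial_le hM1 y)).trans ?_
      exact mul_le_mul_of_nonneg_left (norm_radial_sub_le hM1 x y) hK
    · rw [Real.coe_toNNReal _ hB'0]
      have h1 := hlip t ht (radial (M + 1) x) 0 (norm_radial_le hM1 x) (by simpa using hM1.le)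
      rw [sub_zero] at h1
      have h2 := norm_le_norm_add_norm_sub' (f t (radial (M + 1) x)) (f t 0)
      have h3 := hB t ht
      have h4 : K * ‖radial (M + 1) x‖ ≤ K * (M + 1) :=
        mul_le_mul_of_nonneg_left (norm_radial_le hM1 x) hK
      linarith
    · rw [Real.coe_toNNReal _ hB'0, Real.coe_toNNReal _ (by positivity)]
      simp [hT]
  obtain ⟨u, hu0, hu⟩ := hpl.exists_eq_forall_mem_Icc_hasDerivWithinAt₀
  have huc : ContinuousOn u (Icc 0 T) := fun t ht => (hu t ht).continuousWithinAt
  have htraj : ∀ t ∈ Icc 0 T, (∀ s ∈ Icc 0 t, ‖u s‖ ≤ M + 1) → IsTrajectory f x₀ t u :=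
    fun t ht h => ⟨hu0, fun s hs => by
      have := (hu s ⟨hs.1, hs.2.trans ht.2⟩).mono (Icc_subset_Icc_right ht.2)
      rwa [radial_of_le (h s hs)] at this⟩
  have hbd : ∀ t ∈ Icc 0 T, ‖u t‖ ≤ M := le_of_continuousOn_of_trap huc.norm
    (by rwa [show u 0 = x₀ from hu0]) fun t ht h => hap t ht u (htraj t ht h)
  exact ⟨u, htraj T (right_mem_Icc.2 hT) fun s hs => by linarith [hbd s hs]⟩

/-- A vector field that is Lipschitz on bounded sets and whose trajectories obey an a priori bound
has a global trajectory. -/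
theorem exists_global_trajectory (hf : LocallyLipField f) (x₀ : E)
    (hap : ∀ T, 0 ≤ T → ∃ M, ∀ t ∈ Icc 0 T, ∀ u, IsTrajectory f x₀ t u → ‖u t‖ ≤ M) :
    ∃ u, ∀ T, IsTrajectory f x₀ T u := by
  choose w hw using fun N : ℕ => exists_isTrajectory hf x₀ N.cast_nonneg (hap N N.cast_nonneg)
  have key : ∀ N : ℕ, ∀ t ∈ Icc (0 : ℝ) N, w ⌈t⌉₊ t = w N t := fun N t ht => by
    have h1 : (⌈t⌉₊ : ℝ) ≤ N := by exact_mod_cast Nat.ceil_le.2 ht.2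
    exact (hw ⌈t⌉₊).eqOn hf ((hw N).mono h1) ⟨ht.1, Nat.le_ceil t⟩
  refine ⟨fun t => w ⌈t⌉₊ t, fun T => ⟨?_, fun t ht => ?_⟩⟩
  · simpa using (hw 0).init
  · obtain ⟨N, hN⟩ := exists_nat_ge T
    have hmem : ∀ s ∈ Icc 0 T, s ∈ Icc (0 : ℝ) N := fun s hs => ⟨hs.1, hs.2.trans hN⟩
    have h1 := ((hw N).mono hN).deriv t ht
    rw [← key N t (hmem t ht)] at h1
    exact h1.congr_of_mem (fun s hs => key N s (hmem s hs)) ht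

end ODE

end

section

variable (L : ℝ)

theorem continuous_rotate {X : Type*} [TopologicalSpace X] {τ : X → ℝ} {v : X → Coeff}
    (hτ : Continuous τ) (hv : Continuous v) : Continuous fun x => freeFlow L (τ x) (v x) :=
  (continuous_freeFlow_uncurry L).comp (hτ.prodMk hv)

theorem norm_rotate (t : ℝ) (p : Coeff × Coeff) :
    ‖((freeFlow L t p.1, p.2) : Coeff × Coeff)‖ = ‖p‖ := by
  rw [Prod.norm_def, Prod.norm_def, norm_freeFlow]

theorem norm_rotate_sub (t : ℝ) (p q : Coeff × Coeff) :
    ‖((freeFlow L t p.1, p.2) : Coeff × Coeff) - (freeFlow L t q.1, q.2)‖ = ‖p - q‖ := by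
  rw [← norm_rotate L t (p - q)]
  simp

/-- The factor `v(τ) - v(t)` makes up for the missing differentiability of the group. -/
theorem hasDerivWithinAt_freeFlow_sub {v : ℝ → Coeff} {g : Coeff} {s : Set ℝ} {t : ℝ}
    (hv : HasDerivWithinAt v g s t) :
    HasDerivWithinAt (fun τ => freeFlow L τ (v τ - v t)) (freeFlow L t g) s t := by
  rw [hasDerivWithinAt_iff_tendsto_slope] at hv ⊢
  have hτ : Tendsto (fun τ : ℝ => τ) (𝓝[s \ {t}] t) (𝓝 t) := tendsto_id.mono_left nhdsWithin_le_nhds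
  refine (tendsto_freeFlow L hτ hv).congr fun τ => ?_
  simp only [slope_def_module, sub_self, map_zero, sub_zero]
  exact ((freeFlow L τ).restrictScalars ℝ).map_smul _ _

/-- The `H¹` orbits of the free group are differentiable when tested in `L²` against `u ∈ H¹`, with
derivative `-(i/2)⟨∂ₓu, ∂ₓS(t)a⟩`. -/
theorem hasDerivAt_inner_freeFlow (u a : Coeff) (t : ℝ) :
    HasDerivAt (fun τ => (inner ℂ (toL2 L u) (toL2 L (freeFlow L τ a)) : ℂ))
      (-(Complex.I / 2) * (inner ℂ u (freeFlow L t a) -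
        inner ℂ (toL2 L u) (toL2 L (freeFlow L t a)))) t := by
  have h1 : ∀ τ, (inner ℂ (toL2 L u) (toL2 L (freeFlow L τ a)) : ℂ) =
      ∑' k, (starRingEnd ℂ) (toL2 L u k) * (phase L τ k * toL2 L a k) := fun τ => by
    rw [lp.inner_eq_tsum]
    refine tsum_congr fun k => ?_
    rw [toL2_freeFlow, freeFlow_apply, RCLike.inner_apply']
  have h2 : -(Complex.I / 2) * (inner ℂ u (freeFlow L t a) -
        inner ℂ (toL2 L u) (toL2 L (freeFlow L t a))) =
      ∑' k, (starRingEnd ℂ) (toL2 L u k) *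
        ((-(Complex.I / 2) * (waveNumber L k ^ 2 : ℝ) * phase L t k) * toL2 L a k) := by
    rw [inner_sub_inner_toL2, ← tsum_mul_left]
    refine tsum_congr fun k => ?_
    rw [toL2_freeFlow, freeFlow_apply]
    ring
  have hc : ∀ z w : ℂ, ‖(starRingEnd ℂ) z * w‖ = ‖z‖ * ‖w‖ := fun z w => by simp
  rw [h2, funext h1]
  refine hasDerivAt_tsum (y₀ := t) (summable_norm_mul_norm u a)
    (g := fun k τ => (starRingEnd ℂ) (toL2 L u k) * (phase L τ k * toL2 L a k))
    (g' := fun k τ => (starRingEnd ℂ) (toL2 L u k) *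
        ((-(Complex.I / 2) * (waveNumber L k ^ 2 : ℝ) * phase L τ k) * toL2 L a k))
    (fun k τ => ((hasDerivAt_phase L τ k).mul_const _).const_mul _) (fun k τ => ?_) ?_ t
  · rw [hc, norm_mul, norm_mul, norm_phase, mul_one, norm_mul, Complex.norm_real, toL2_apply,
      toL2_apply, norm_mul, norm_mul, norm_inv, Complex.norm_real,
      Real.norm_of_nonneg (bracket_pos L k).le, Real.norm_of_nonneg (sq_nonneg _)]
    have h3 : ‖-(Complex.I / 2)‖ = 1 / 2 := by simp
    rw [h3]
    have h4 := waveNumber_mul_inv_bracket_le L k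
    have hb := bracket_pos L k
    have h5 : (|waveNumber L k| * (bracket L k)⁻¹) ^ 2 ≤ 1 :=
      pow_le_one₀ (by positivity) h4
    rw [mul_pow, sq_abs] at h5
    calc _ = (waveNumber L k ^ 2 * (bracket L k)⁻¹ ^ 2) * (1 / 2 * (‖u k‖ * ‖a k‖)) := by ring
      _ ≤ 1 * (1 * (‖u k‖ * ‖a k‖)) := by gcongr; norm_num
      _ = _ := by ring
  · refine Summable.of_norm ((summable_norm_mul_norm (toL2 L u) (toL2 L a)).congr fun k => ?_)
    rw [hc, norm_mul, norm_phase, one_mul]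

variable {L} [hL : Fact (0 < L)]

/-! ### The vector fields -/

variable (L) in
/-- The complex potential `(R/2 - iλ) n - α/2` generated by the reservoir density `n`. -/
def pot (c : Constants) (n : Coeff) : Coeff :=
  ((c.R / 2 : ℝ) - Complex.I * c.lam : ℂ) • n - ((c.α / 2 : ℝ) : ℂ) • one L

variable (L) in
/-- The cubic nonlinearity `|a|²a`. -/
def cubic (a : Coeff) : Coeff := mul L (modSq L a) a

variable (L) in
/-- The zeroth-order part `-ig|a|²a + ((R/2 - iλ) n - α/2) a` of the equation for the wave
function. -/
def force (c : Constants) (a n : Coeff) : Coeff :=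
  (-Complex.I * c.g : ℂ) • cubic L a + mul L (pot L c n) a

variable (L) in
/-- The decay rate `β + R|a|²` of the reservoir. -/
def rate (c : Constants) (a : Coeff) : Coeff :=
  (c.β : ℂ) • one L + (c.R : ℂ) • modSq L a

variable (L) in
/-- The production rate `P - (β + R|a|²) n` of the reservoir. -/
def production (c : Constants) (a n : Coeff) : Coeff :=
  (c.P : ℂ) • one L - mul L (rate L c a) n

@[simp] theorem ev_pot (c : Constants) (n : Coeff) (x : AddCircle L) :
    ev L (pot L c n) x = ((c.R / 2 : ℝ) - Complex.I * c.lam) * ev L n x - (c.α / 2 : ℝ) := by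
  simp [pot]

@[simp] theorem ev_cubic (a : Coeff) (x : AddCircle L) :
    ev L (cubic L a) x = ((‖ev L a x‖ ^ 2 : ℝ) : ℂ) * ev L a x := by
  rw [cubic, ev_mul, ContinuousMap.mul_apply, ev_modSq]

theorem ev_force (c : Constants) (a n : Coeff) (x : AddCircle L) {r : ℝ} (h : ev L n x = r) :
    ev L (force L c a n) x = waveForcing c (ev L a x) r := by
  simp only [force, map_add, map_smul, ContinuousMap.add_apply, ContinuousMap.smul_apply, ev_cubic,
    ev_mul, ContinuousMap.mul_apply, ev_pot, h, waveForcing, smul_eq_mul]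
  push_cast
  ring

@[simp] theorem ev_rate (c : Constants) (a : Coeff) (x : AddCircle L) :
    ev L (rate L c a) x = ((c.β + c.R * ‖ev L a x‖ ^ 2 : ℝ) : ℂ) := by
  simp [rate]

@[simp] theorem ev_production (c : Constants) (a n : Coeff) (x : AddCircle L) :
    ev L (production L c a n) x = c.P - ((c.β + c.R * ‖ev L a x‖ ^ 2 : ℝ) : ℂ) * ev L n x := by
  simp only [production, map_sub, map_smul, ContinuousMap.sub_apply, ContinuousMap.smul_apply,
    ev_mul, ContinuousMap.mul_apply, ev_rate, ev_one, ContinuousMap.one_apply, smul_eq_mul, mul_one]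

variable (L) in
/-- The system for `(v, n)`, where `v(t) = S(-t)ψ(t)` is the wave function in the interaction
picture of the free Schrödinger group `S`. -/
def gpField (c : Constants) (ε : ℝ) (t : ℝ) (p : Coeff × Coeff) : Coeff × Coeff :=
  (freeFlow L (-t) (force L c (freeFlow L t p.1) p.2),
    ((ε⁻¹ : ℝ) : ℂ) • production L c (freeFlow L t p.1) p.2)

variable (L) in
/-- The adiabatic equation for `v(t) = S(-t)ψ(t)`. -/
def adiabaticField (c : Constants) (t : ℝ) (v : Coeff) : Coeff :=
  freeFlow L (-t) (force L c (freeFlow L t v) (dens L c (freeFlow L t v)))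

variable {E : Type*} [NormedAddCommGroup E]

theorem LipOnBalls.pot (c : Constants) {G : E → Coeff} (hG : LipOnBalls G) :
    LipOnBalls fun x => pot L c (G x) := (hG.smul _).sub (.const _)

theorem LipOnBalls.force (c : Constants) {F G : E → Coeff} (hF : LipOnBalls F)
    (hG : LipOnBalls G) : LipOnBalls fun x => force L c (F x) (G x) :=
  ((hF.modSq.mul hF).smul _).add ((hG.pot c).mul hF)

theorem LipOnBalls.rate (c : Constants) {F : E → Coeff} (hF : LipOnBalls F) :
    LipOnBalls fun x => rate L c (F x) := (LipOnBalls.const _).add (hF.modSq.smul _)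

theorem LipOnBalls.production (c : Constants) {F G : E → Coeff} (hF : LipOnBalls F)
    (hG : LipOnBalls G) : LipOnBalls fun x => production L c (F x) (G x) :=
  (LipOnBalls.const _).sub ((hF.rate c).mul hG)

theorem lipOnBalls_fst : LipOnBalls (Prod.fst : Coeff × Coeff → Coeff) :=
  .of_lipschitz 1 zero_le_one fun x y => by rw [one_mul]; exact norm_fst_le (x - y)

theorem lipOnBalls_snd : LipOnBalls (Prod.snd : Coeff × Coeff → Coeff) :=
  .of_lipschitz 1 zero_le_one fun x y => by rw [one_mul]; exact norm_snd_le (x - y)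

theorem lipOnBalls_id : LipOnBalls (id : Coeff → Coeff) :=
  .of_lipschitz 1 zero_le_one fun x y => by rw [one_mul]; rfl

theorem lipOnBalls_force (c : Constants) :
    LipOnBalls fun p : Coeff × Coeff => force L c p.1 p.2 :=
  lipOnBalls_fst.force c lipOnBalls_snd

theorem lipOnBalls_production (c : Constants) :
    LipOnBalls fun p : Coeff × Coeff => production L c p.1 p.2 :=
  lipOnBalls_fst.production c lipOnBalls_snd

theorem lipOnBalls_dens (c : Constants) : LipOnBalls fun a : Coeff => dens L c a :=
  lipOnBalls_id.dens c

theorem lipOnBalls_adiabaticForce (c : Constants) :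
    LipOnBalls fun a : Coeff => force L c a (dens L c a) :=
  lipOnBalls_id.force c (lipOnBalls_dens c)

theorem locallyLipField_gpField (c : Constants) (ε : ℝ) : LocallyLipField (gpField L c ε) where
  cont p := by
    have h1 : Continuous fun t : ℝ => ((freeFlow L t p.1, p.2) : Coeff × Coeff) :=
      (continuous_freeFlow L p.1).prodMk continuous_const
    exact ((continuous_rotate L continuous_neg
      ((lipOnBalls_force (L := L) c).continuous.comp h1)).prodMk
      (((lipOnBalls_production (L := L) c).continuous.comp h1).const_smul ((ε⁻¹ : ℝ) : ℂ))).continuousOn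
  lip _ M := by
    obtain ⟨K, hK, h⟩ := lipOnBalls_force (L := L) c M
    obtain ⟨K', hK', h'⟩ := (lipOnBalls_production (L := L) c).smul ((ε⁻¹ : ℝ) : ℂ) M
    refine ⟨max K K', le_max_of_le_left hK, fun t _ x y hx hy => ?_⟩
    rw [← norm_rotate L t] at hx hy
    have h1 := h _ _ hx hy
    have h2 := h' _ _ hx hy
    rw [norm_rotate_sub] at h1 h2
    refine max_le ?_ ?_
    · rw [Prod.fst_sub, gpField, gpField, ← map_sub, norm_freeFlow]
      exact h1.trans (by gcongr; exact le_max_left _ _)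
    · exact h2.trans (by gcongr; exact le_max_right _ _)

theorem locallyLipField_adiabaticField (c : Constants) :
    LocallyLipField (adiabaticField L c) where
  cont v := (continuous_rotate L continuous_neg ((lipOnBalls_adiabaticForce c).continuous.comp
    (continuous_freeFlow L v))).continuousOn
  lip _ M := by
    obtain ⟨K, hK, h⟩ := lipOnBalls_adiabaticForce (L := L) c M
    refine ⟨K, hK, fun t _ x y hx hy => ?_⟩
    rw [← norm_freeFlow L t] at hx hy
    have h1 := h _ _ hx hy
    rw [← map_sub, norm_freeFlow] at h1
    rwa [adiabaticField, adiabaticField, ← map_sub, norm_freeFlow]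

/-! ### Bounds for the reservoir density -/

theorem hasDerivWithinAt_ev_apply {n : ℝ → Coeff} {n' : Coeff} {s : Set ℝ} {t : ℝ}
    (h : HasDerivWithinAt n n' s t) (x : AddCircle L) :
    HasDerivWithinAt (fun t => ev L (n t) x) (ev L n' x) s t :=
  (((ContinuousMap.evalCLM ℂ x).comp (ev L)).restrictScalars ℝ).hasFDerivAt.comp_hasDerivWithinAt
    t h

theorem hasDerivWithinAt_re {z : ℝ → ℂ} {z' : ℂ} {s : Set ℝ} {t : ℝ}
    (h : HasDerivWithinAt z z' s t) : HasDerivWithinAt (fun t => (z t).re) z'.re s t :=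
  Complex.reCLM.hasFDerivAt.comp_hasDerivWithinAt t h

theorem hasDerivWithinAt_im {z : ℝ → ℂ} {z' : ℂ} {s : Set ℝ} {t : ℝ}
    (h : HasDerivWithinAt z z' s t) : HasDerivWithinAt (fun t => (z t).im) z'.im s t :=
  Complex.imCLM.hasFDerivAt.comp_hasDerivWithinAt t h

theorem continuousOn_ev_apply {ψ : ℝ → Coeff} {s : Set ℝ} (hψ : ContinuousOn ψ s)
    (x : AddCircle L) : ContinuousOn (fun t => ev L (ψ t) x) s :=
  (((ContinuousMap.evalCLM ℂ x).comp (ev L)).continuous.comp_continuousOn hψ)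

/-- The rate of change of the density at a point, for real densities. -/
theorem hasDerivWithinAt_re_density {c : Constants} {ε t T : ℝ} {ψ n : ℝ → Coeff}
    (hn : HasDerivWithinAt n (((ε⁻¹ : ℝ) : ℂ) • production L c (ψ t) (n t)) (Icc 0 T) t)
    (x : AddCircle L) :
    HasDerivWithinAt (fun t => (ev L (n t) x).re)
      ((c.P - (c.β + c.R * ‖ev L (ψ t) x‖ ^ 2) * (ev L (n t) x).re) / ε) (Icc 0 T) t := by
  have := hasDerivWithinAt_re (hasDerivWithinAt_ev_apply (L := L) hn x)
  simp only [map_smul, ContinuousMap.smul_apply, ev_production, smul_eq_mul,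
    Complex.re_ofReal_mul, Complex.sub_re, Complex.ofReal_re] at this
  rwa [inv_mul_eq_div] at this

/-- The density stays real and between `0` and `N`, if it is so initially and `N ≥ P/β`. -/
theorem density_bounds {c : Constants} {ε T N : ℝ} (hε : 0 < ε) {ψ n : ℝ → Coeff}
    (hψ : ContinuousOn ψ (Icc 0 T))
    (hn : ∀ t ∈ Icc 0 T,
      HasDerivWithinAt n (((ε⁻¹ : ℝ) : ℂ) • production L c (ψ t) (n t)) (Icc 0 T) t)
    (hN : c.P / c.β ≤ N) (x : AddCircle L) (him : (ev L (n 0) x).im = 0)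
    (h0 : 0 ≤ (ev L (n 0) x).re) (hle : (ev L (n 0) x).re ≤ N) :
    ∀ t ∈ Icc 0 T, ev L (n t) x = ((ev L (n t) x).re : ℂ) ∧ 0 ≤ (ev L (n t) x).re ∧
      (ev L (n t) x).re ≤ N := by
  have hβ := c.β_pos
  have hR := c.R_pos
  have hP := c.P_pos
  set b : ℝ → ℝ := fun t => c.β + c.R * ‖ev L (ψ t) x‖ ^ 2 with hb
  have hbβ : ∀ t, c.β ≤ b t := fun t => by
    have : 0 ≤ c.R * ‖ev L (ψ t) x‖ ^ 2 := by positivity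
    simp only [hb]; linarith
  have hp : ContinuousOn (fun t => b t / ε) (Icc 0 T) := by
    have := continuousOn_ev_apply (L := L) hψ x
    fun_prop
  have hre := fun t ht => hasDerivWithinAt_re_density (hn t ht) x
  have hI : ∀ t ∈ Icc 0 T, HasDerivWithinAt (fun t => (ev L (n t) x).im)
      (-(b t / ε) * (ev L (n t) x).im) (Icc 0 T) t := fun t ht => by
    have := hasDerivWithinAt_im (hasDerivWithinAt_ev_apply (L := L) (hn t ht) x)
    simp only [map_smul, ContinuousMap.smul_apply, ev_production, smul_eq_mul,
      Complex.im_ofReal_mul, Complex.sub_im, Complex.ofReal_im] at this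
    convert this using 1
    simp only [hb]
    ring
  have h1 := nonneg_of_deriv_ge hI hp (fun t _ => le_rfl) him.ge
  have h2 := nonneg_of_deriv_ge (fun t ht => (hI t ht).neg) hp
    (fun t _ => by simp) (by simp [him])
  have h3 := nonneg_of_deriv_ge hre hp (fun t ht => by
    have : 0 < c.P / ε := by positivity
    rw [sub_div]
    have h : (c.β + c.R * ‖ev L (ψ t) x‖ ^ 2) * (ev L (n t) x).re / ε =
      b t / ε * (ev L (n t) x).re := by simp only [hb]; ring
    linarith) h0
  have h4 := nonneg_of_deriv_ge (fun t ht => (hre t ht).const_sub N) hp (fun t ht => by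
    have h5 : 0 ≤ (b t * N - c.P) / ε := by
      refine div_nonneg ?_ hε.le
      rw [div_le_iff₀ hβ] at hN
      have hN0 : 0 ≤ N := h0.trans hle
      nlinarith [hbβ t]
    have h6 : -((c.P - (c.β + c.R * ‖ev L (ψ t) x‖ ^ 2) * (ev L (n t) x).re) / ε) -
        -(b t / ε) * (N - (ev L (n t) x).re) = (b t * N - c.P) / ε := by simp only [hb]; ring
    linarith) (by simpa using hle)
  intro t ht
  have h7 : (ev L (n t) x).im = 0 := le_antisymm (by simpa using h2 t ht) (h1 t ht)
  exact ⟨Complex.ext (by simp) (by simp [h7]), h3 t ht, by linarith [h4 t ht]⟩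

/-! ### The energy of the wave function -/

theorem hasDerivWithinAt_zero_of_le {e m : ℝ → ℝ} {s : Set ℝ} {t : ℝ}
    (hm : HasDerivWithinAt m 0 s t) (hm0 : m t = 0) (he0 : e t = 0)
    (h : ∀ᶠ τ in 𝓝[s] t, |e τ| ≤ m τ) : HasDerivWithinAt e 0 s t := by
  rw [hasDerivWithinAt_iff_isLittleO] at hm ⊢
  simp only [hm0, he0, sub_zero, smul_zero] at hm ⊢
  refine (Asymptotics.IsBigO.of_bound 1 ?_).trans_isLittleO hm
  filter_upwards [h] with τ hτ
  rw [one_mul, Real.norm_eq_abs, Real.norm_eq_abs]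
  exact hτ.trans (le_abs_self _)

theorem hasDerivWithinAt_norm_sq {v : ℝ → Coeff} {g : Coeff} {s : Set ℝ} {t : ℝ}
    (hv : HasDerivWithinAt v g s t) :
    HasDerivWithinAt (fun τ => ‖v τ‖ ^ 2) (2 * (inner ℂ (v t) g : ℂ).re) s t := by
  have h := hasDerivWithinAt_re (hv.inner ℂ hv)
  have h1 : ∀ τ, (inner ℂ (v τ) (v τ) : ℂ).re = ‖v τ‖ ^ 2 := fun τ => by
    rw [inner_self_eq_norm_sq_to_K]; norm_cast
  simp only [h1] at h
  convert h using 1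
  rw [Complex.add_re, ← inner_conj_symm g (v t), Complex.conj_re]
  ring

variable (L) in
/-- The quartic integral `∫ |a|⁴` (normalised by the length of the torus). -/
def quartic (a : Coeff) : ℝ := ‖toL2 L (modSq L a)‖ ^ 2

theorem quartic_eq (a : Coeff) :
    quartic L a = ∫ x, (‖ev L a x‖ ^ 2) ^ 2 ∂AddCircle.haarAddCircle := by
  rw [quartic, norm_toL2_sq]
  simp only [ev_modSq, Complex.norm_real, Real.norm_eq_abs, abs_pow, abs_norm]

theorem re_integral {f : AddCircle L → ℂ} (hf : Continuous f) :
    (∫ x, f x ∂AddCircle.haarAddCircle).re = ∫ x, (f x).re ∂AddCircle.haarAddCircle :=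
  (integral_re (𝕜 := ℂ) (integrable_of_continuous hf)).symm

/-- The first-order Taylor expansion of `|z|⁴` with remainder. -/
theorem quartic_expansion (z w : ℂ) {M : ℝ} (hz : ‖z‖ ≤ M) (hw : ‖w‖ ≤ M) :
    |(‖w‖ ^ 2) ^ 2 - (‖z‖ ^ 2) ^ 2 -
      4 * ((starRingEnd ℂ) (((‖z‖ ^ 2 : ℝ) : ℂ) * z) * (w - z)).re| ≤ 6 * M ^ 2 * ‖w - z‖ ^ 2 := by
  have hM : 0 ≤ M := (norm_nonneg _).trans hz
  have h1 : ((starRingEnd ℂ) (((‖z‖ ^ 2 : ℝ) : ℂ) * z) * (w - z)).re =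
      ‖z‖ ^ 2 * ((starRingEnd ℂ) z * (w - z)).re := by
    rw [map_mul, Complex.conj_ofReal, mul_assoc, Complex.re_ofReal_mul]
  have h2 : ‖w‖ ^ 2 = ‖z‖ ^ 2 + 2 * ((starRingEnd ℂ) z * (w - z)).re + ‖w - z‖ ^ 2 := by
    simp only [← Complex.normSq_eq_norm_sq, Complex.normSq_apply]
    simp
    ring
  have h3 := abs_norm_sq_sub_le w z
  have h4 : (‖w‖ ^ 2 - ‖z‖ ^ 2) ^ 2 ≤ (2 * M * ‖w - z‖) ^ 2 := by
    rw [← sq_abs (‖w‖ ^ 2 - ‖z‖ ^ 2)]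
    have : (‖w‖ + ‖z‖) * ‖w - z‖ ≤ 2 * M * ‖w - z‖ := by gcongr; linarith
    gcongr
    exact h3.trans this
  have h5 : (‖w‖ ^ 2) ^ 2 - (‖z‖ ^ 2) ^ 2 - 4 * (‖z‖ ^ 2 * ((starRingEnd ℂ) z * (w - z)).re) =
      2 * ‖z‖ ^ 2 * ‖w - z‖ ^ 2 + (‖w‖ ^ 2 - ‖z‖ ^ 2) ^ 2 := by
    rw [h2]; ring
  have h6 : ‖z‖ ^ 2 * ‖w - z‖ ^ 2 ≤ M ^ 2 * ‖w - z‖ ^ 2 := by gcongr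
  rw [h1, h5, abs_of_nonneg (by positivity)]
  nlinarith

theorem quartic_taylor {a b : Coeff} {M : ℝ} (ha : ‖ev L a‖ ≤ M) (hb : ‖ev L b‖ ≤ M) :
    |quartic L b - quartic L a - 4 * (inner ℂ (toL2 L (cubic L a)) (toL2 L (b - a)) : ℂ).re| ≤
      6 * M ^ 2 * ‖toL2 L (b - a)‖ ^ 2 := by
  rw [quartic_eq, quartic_eq, inner_toL2, re_integral (by fun_prop), norm_toL2_sq,
    ← integral_sub (integrable_of_continuous (by fun_prop))
      (integrable_of_continuous (by fun_prop)), ← integral_const_mul,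
    ← integral_const_mul,
    ← integral_sub (integrable_of_continuous (by fun_prop))
      (integrable_of_continuous (by fun_prop))]
  refine abs_integral_le_integral_abs.trans (integral_mono
    (integrable_of_continuous (by fun_prop)) (integrable_of_continuous (by fun_prop)) fun x => ?_)
  simp only [ev_cubic, map_sub, ContinuousMap.sub_apply]
  exact quartic_expansion _ _ (((ev L a).norm_coe_le_norm x).trans ha)
    (((ev L b).norm_coe_le_norm x).trans hb)

/-- The time derivative of `∫ |ψ|⁴`. The wave function `ψ = S(t)v` is only differentiable with
values in `H⁻¹`; the quartic integral is nevertheless differentiable, since its gradient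
`4|ψ|²ψ` lies in `H¹` and `‖ψ(τ) - ψ(t)‖²` in `L²` is `o(τ - t)`. -/
theorem hasDerivWithinAt_quartic {v : ℝ → Coeff} {g : Coeff} {s : Set ℝ} {t : ℝ}
    (hv : HasDerivWithinAt v g s t) :
    HasDerivWithinAt (fun τ => quartic L (freeFlow L τ (v τ)))
      (4 * (inner ℂ (toL2 L (cubic L (freeFlow L t (v t)))) (toL2 L (freeFlow L t g)) : ℂ).re +
        2 * (inner ℂ (cubic L (freeFlow L t (v t))) (freeFlow L t (v t)) -
          inner ℂ (toL2 L (cubic L (freeFlow L t (v t)))) (toL2 L (freeFlow L t (v t))) : ℂ).im)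
      s t := by
  set ψ : ℝ → Coeff := fun τ => freeFlow L τ (v τ) with hψ
  set a := v t with ha
  set u := cubic L (freeFlow L t a) with hu
  have hsplit : ∀ τ, ψ τ - ψ t = freeFlow L τ (v τ - a) + (freeFlow L τ a - freeFlow L t a) :=
    fun τ => by simp only [hψ, map_sub]; abel
  -- the linear part
  have h1 : HasDerivWithinAt (fun τ => (inner ℂ (toL2 L u) (toL2 L (freeFlow L τ (v τ - a))) : ℂ))
      (inner ℂ (toL2 L u) (toL2 L (freeFlow L t g))) s t :=
    (((innerSL ℂ (toL2 L u)).comp (toL2 L)).restrictScalars ℝ).hasFDerivAt.comp_hasDerivWithinAt t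
      (hasDerivWithinAt_freeFlow_sub L hv)
  have h2 := ((hasDerivAt_inner_freeFlow L u a t).sub_const
    (inner ℂ (toL2 L u) (toL2 L (freeFlow L t a)) : ℂ)).hasDerivWithinAt (s := s)
  have hlin : HasDerivWithinAt (fun τ => 4 * (inner ℂ (toL2 L u) (toL2 L (ψ τ - ψ t)) : ℂ).re)
      (4 * (inner ℂ (toL2 L u) (toL2 L (freeFlow L t g)) : ℂ).re +
        2 * (inner ℂ u (freeFlow L t a) -
          inner ℂ (toL2 L u) (toL2 L (freeFlow L t a)) : ℂ).im) s t := by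
    have h3 := (hasDerivWithinAt_re (h1.add h2)).const_mul 4
    have he : ∀ τ, 4 * (inner ℂ (toL2 L u) (toL2 L (ψ τ - ψ t)) : ℂ).re =
        4 * (inner ℂ (toL2 L u) (toL2 L (freeFlow L τ (v τ - a))) +
          (inner ℂ (toL2 L u) (toL2 L (freeFlow L τ a)) -
            inner ℂ (toL2 L u) (toL2 L (freeFlow L t a))) : ℂ).re := fun τ => by
      rw [hsplit, map_add, inner_add_right, map_sub (toL2 L) (freeFlow L τ a), inner_sub_right]
    refine (h3.congr_deriv ?_).congr (fun τ _ => ?_) ?_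
    · have : ∀ z w : ℂ, 4 * (z + -(Complex.I / 2) * w).re = 4 * z.re + 2 * w.im := fun z w => by
        simp; ring
      exact this _ _
    · exact he τ
    · exact he t
  -- the quadratic remainder
  have h4 : HasDerivWithinAt (fun τ => ‖v τ - a‖ ^ 2) 0 s t := by
    have := hasDerivWithinAt_norm_sq (hv.sub_const a)
    simpa [ha] using this
  have h5 : HasDerivWithinAt (fun τ => ‖toL2 L (freeFlow L τ a - freeFlow L t a)‖ ^ 2) 0 s t := by
    have h6 := ((hasDerivWithinAt_re (hasDerivAt_inner_freeFlow L (freeFlow L t a) a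
      t).hasDerivWithinAt (s := s)).const_mul (-2)).const_add (2 * ‖toL2 L a‖ ^ 2)
    have hn : ∀ τ, ‖toL2 L (freeFlow L τ a)‖ = ‖toL2 L a‖ := fun τ => by
      rw [toL2_freeFlow, norm_freeFlow]
    have he : ∀ τ, ‖toL2 L (freeFlow L τ a - freeFlow L t a)‖ ^ 2 = 2 * ‖toL2 L a‖ ^ 2 +
        -2 * (inner ℂ (toL2 L (freeFlow L t a)) (toL2 L (freeFlow L τ a)) : ℂ).re := fun τ => by
      have h7 : RCLike.re (inner ℂ (toL2 L (freeFlow L τ a)) (toL2 L (freeFlow L t a)) : ℂ) =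
          (inner ℂ (toL2 L (freeFlow L t a)) (toL2 L (freeFlow L τ a)) : ℂ).re := by
        rw [← inner_conj_symm]; exact Complex.conj_re _
      rw [map_sub, norm_sub_sq (𝕜 := ℂ), hn, hn, h7]
      ring
    refine (h6.congr_deriv ?_).congr (fun τ _ => he τ) (he t)
    rw [inner_self_eq_norm_sq_to_K, inner_self_eq_norm_sq_to_K]
    simp [← Complex.ofReal_pow]
  set M := ‖sobolevSeq L‖ * (‖a‖ + 1) with hM
  have h6 := ((h4.const_mul 2).add (h5.const_mul 2)).const_mul (6 * M ^ 2)
  have hrem : HasDerivWithinAt (fun τ => quartic L (ψ τ) - quartic L (ψ t) -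
      4 * (inner ℂ (toL2 L u) (toL2 L (ψ τ - ψ t)) : ℂ).re) 0 s t := by
    refine hasDerivWithinAt_zero_of_le (h6.congr_deriv (by simp)) (by simp [ha]) (by simp) ?_
    have h7 : ∀ᶠ τ in 𝓝[s] t, ‖v τ‖ < ‖a‖ + 1 :=
      hv.continuousWithinAt.norm.eventually_lt_const (by linarith)
    filter_upwards [h7] with τ hτ
    have h8 : ∀ τ', ‖v τ'‖ ≤ ‖a‖ + 1 → ‖ev L (ψ τ')‖ ≤ M := fun τ' h => by
      refine (norm_ev_le L _).trans ?_
      rw [hψ, norm_freeFlow]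
      exact mul_le_mul_of_nonneg_left h (norm_nonneg _)
    refine (quartic_taylor (h8 t (by linarith)) (h8 τ hτ.le)).trans ?_
    simp only [Pi.add_apply]
    gcongr
    rw [hsplit, map_add]
    have h9 : ‖toL2 L (freeFlow L τ (v τ - a))‖ ≤ ‖v τ - a‖ :=
      (norm_toL2_le L _).trans_eq (norm_freeFlow L _ _)
    have h10 := norm_add_le (toL2 L (freeFlow L τ (v τ - a)))
      (toL2 L (freeFlow L τ a - freeFlow L t a))
    have h11 := norm_nonneg (toL2 L (freeFlow L τ (v τ - a)))
    have h12 := norm_nonneg (toL2 L (freeFlow L τ (v τ - a)) +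
      toL2 L (freeFlow L τ a - freeFlow L t a))
    nlinarith [sq_nonneg (‖toL2 L (freeFlow L τ (v τ - a))‖ -
      ‖toL2 L (freeFlow L τ a - freeFlow L t a)‖)]
  refine ((hrem.add hlin).add_const (quartic L (ψ t))).congr_deriv (zero_add _)
    |>.congr (fun τ _ => ?_) ?_ <;> simp [hψ]

/-- The energy identity: in the derivative of `‖ψ‖² + g∫|ψ|⁴` the contribution of the cubic
nonlinearity to the `H¹` norm cancels against the dispersive part of the derivative of the
quartic integral. -/
theorem hasDerivWithinAt_energy (c : Constants) {v : ℝ → Coeff} {n ψ : Coeff} {s : Set ℝ} {t : ℝ}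
    (hψ : ψ = freeFlow L t (v t))
    (hv : HasDerivWithinAt v (freeFlow L (-t) (force L c ψ n)) s t) :
    HasDerivWithinAt (fun τ => ‖v τ‖ ^ 2 + c.g * quartic L (freeFlow L τ (v τ)))
      (2 * (inner ℂ ψ (mul L (pot L c n) ψ) : ℂ).re +
        4 * c.g * (inner ℂ (toL2 L (cubic L ψ)) (toL2 L (mul L (pot L c n) ψ)) : ℂ).re) s t := by
  have h1 := hasDerivWithinAt_norm_sq hv
  have h2 := (hasDerivWithinAt_quartic (L := L) hv).const_mul c.g
  refine (h1.add h2).congr_deriv ?_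
  rw [freeFlow_freeFlow_neg, ← hψ, inner_freeFlow_right, neg_neg, ← hψ, force, inner_add_right,
    inner_smul_right, map_add, map_smul, inner_add_right, inner_smul_right,
    inner_self_eq_norm_sq_to_K]
  have h3 : (inner ℂ (toL2 L (cubic L ψ)) (toL2 L ψ) : ℂ).im = 0 := by
    rw [inner_toL2]
    have : ∀ x, (starRingEnd ℂ) (ev L (cubic L ψ) x) * ev L ψ x =
        (((‖ev L ψ x‖ ^ 2) ^ 2 : ℝ) : ℂ) := fun x => by
        rw [ev_cubic, map_mul, Complex.conj_ofReal, mul_assoc, Complex.conj_mul']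
        push_cast; ring
    simp_rw [this]
    rw [integral_complex_ofReal, Complex.ofReal_im]
  have h4 : (inner ℂ ψ (cubic L ψ) : ℂ).im = -(inner ℂ (cubic L ψ) ψ : ℂ).im := by
    rw [← inner_conj_symm, Complex.conj_im]
  simp [h3, h4, ← Complex.ofReal_pow]
  ring

end

section

variable {L : ℝ}

theorem continuousOn_wave {v : ℝ → Coeff} {s : Set ℝ} (hv : ContinuousOn v s) :
    ContinuousOn (fun t => freeFlow L t (v t)) s :=
  fun t ht => tendsto_freeFlow L (tendsto_id.mono_left nhdsWithin_le_nhds) (hv t ht)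

variable [hL : Fact (0 < L)]

/-! ### A priori bounds -/

/-- The coupling constant `R/2 - iλ` of the wave function to the reservoir. -/
def coupling (c : Constants) : ℂ := (c.R / 2 : ℝ) - Complex.I * c.lam

theorem coupling_re (c : Constants) : (coupling c).re = c.R / 2 := by simp [coupling]

theorem re_conj_mul_le (z w : ℂ) : ((starRingEnd ℂ) z * w).re ≤ ‖z‖ * ‖w‖ := by
  refine (Complex.re_le_norm _).trans_eq ?_
  rw [norm_mul, Complex.norm_conj]

theorem re_conj_mul_self (z w : ℂ) : ((starRingEnd ℂ) z * (w * z)).re = w.re * ‖z‖ ^ 2 := by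
  rw [mul_left_comm, Complex.conj_mul', ← Complex.ofReal_pow, mul_comm, Complex.re_ofReal_mul,
    mul_comm]

/-- The exponential rate in the energy estimate, for reservoir densities bounded by `N`. -/
def growthRate (c : Constants) (N : ℝ) : ℝ :=
  c.R * N + (‖coupling c‖ + 2 * c.R * N) ^ 2 / (2 * c.R)

/-- The increments of the coupling terms. The variation of the density multiplied by `|z| + |w|`
is absorbed by the damping `-R|ψ|²n` of the reservoir, which makes the bound independent of the
relaxation time. -/
theorem increment_le (c : Constants) {N r q : ℝ} (hr0 : 0 ≤ r) (hr : r ≤ N) (hq0 : 0 ≤ q)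
    (hq : q ≤ N) (z w : ℂ) :
    ((starRingEnd ℂ) (z - w) * (2 * ((coupling c * r - (c.α / 2 : ℝ)) * z -
        (coupling c * q - (c.α / 2 : ℝ)) * w))).re +
      2 * ((r - q) * -((c.β + c.R * ‖z‖ ^ 2) * r - (c.β + c.R * ‖w‖ ^ 2) * q)) ≤
      growthRate c N * ‖z - w‖ ^ 2 := by
  have hR := c.R_pos
  have hβ := c.β_pos
  have hα := c.α_pos
  have hN : 0 ≤ N := hr0.trans hr
  set d := ‖z - w‖ with hd
  set p := ‖z‖ + ‖w‖ with hp
  set s := |r - q| * p with hs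
  have hd0 : 0 ≤ d := norm_nonneg _
  have hp0 : 0 ≤ p := by positivity
  have hs0 : 0 ≤ s := by positivity
  have h1 : ((starRingEnd ℂ) (z - w) * (2 * ((coupling c * r - (c.α / 2 : ℝ)) * z -
        (coupling c * q - (c.α / 2 : ℝ)) * w))).re ≤ c.R * N * d ^ 2 + ‖coupling c‖ * s * d := by
    have e : (starRingEnd ℂ) (z - w) * (2 * ((coupling c * r - (c.α / 2 : ℝ)) * z -
        (coupling c * q - (c.α / 2 : ℝ)) * w)) =
        (starRingEnd ℂ) (z - w) * ((coupling c * (r + q : ℝ) - (c.α : ℝ)) * (z - w)) +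
        (starRingEnd ℂ) (z - w) * (coupling c * (r - q : ℝ) * (z + w)) := by
      push_cast; ring
    rw [e, Complex.add_re, re_conj_mul_self]
    refine add_le_add ?_ ?_
    · rw [Complex.sub_re, Complex.re_mul_ofReal, coupling_re, Complex.ofReal_re]
      gcongr
      nlinarith
    · refine (re_conj_mul_le _ _).trans ?_
      rw [norm_mul, norm_mul, Complex.norm_real, Real.norm_eq_abs]
      have := norm_add_le z w
      calc d * (‖coupling c‖ * |r - q| * ‖z + w‖) ≤ d * (‖coupling c‖ * |r - q| * p) := by gcongr
        _ = _ := by rw [hs]; ring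
  have h2 : 2 * ((r - q) * -((c.β + c.R * ‖z‖ ^ 2) * r - (c.β + c.R * ‖w‖ ^ 2) * q)) ≤
      -(c.R / 2) * s ^ 2 + 2 * c.R * N * s * d := by
    have e : 2 * ((r - q) * -((c.β + c.R * ‖z‖ ^ 2) * r - (c.β + c.R * ‖w‖ ^ 2) * q)) =
        -(2 * c.β + c.R * (‖z‖ ^ 2 + ‖w‖ ^ 2)) * (r - q) ^ 2 +
          -(c.R * (r - q) * (‖z‖ ^ 2 - ‖w‖ ^ 2) * (r + q)) := by ring
    rw [e]
    refine add_le_add ?_ ?_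
    · have h3 : p ^ 2 ≤ 2 * (‖z‖ ^ 2 + ‖w‖ ^ 2) := by
        rw [hp]; nlinarith [sq_nonneg (‖z‖ - ‖w‖)]
      have h4 : s ^ 2 = (r - q) ^ 2 * p ^ 2 := by rw [hs, mul_pow, sq_abs]
      rw [h4]
      have h5 := sq_nonneg (r - q)
      nlinarith [mul_nonneg h5 hβ.le, mul_nonneg (mul_nonneg h5 hR.le) (sub_nonneg.2 h3)]
    · refine (neg_le_abs _).trans ?_
      rw [abs_mul, abs_mul, abs_mul, abs_of_pos hR, abs_of_nonneg (by linarith : 0 ≤ r + q)]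
      calc c.R * |r - q| * |‖z‖ ^ 2 - ‖w‖ ^ 2| * (r + q)
          ≤ c.R * |r - q| * (p * d) * (2 * N) := by
            gcongr
            · exact abs_norm_sq_sub_le z w
            · linarith
        _ = _ := by rw [hs]; ring
  have h3 : (‖coupling c‖ + 2 * c.R * N) * s * d - c.R / 2 * s ^ 2 ≤
      (‖coupling c‖ + 2 * c.R * N) ^ 2 / (2 * c.R) * d ^ 2 := by
    have e : (‖coupling c‖ + 2 * c.R * N) ^ 2 / (2 * c.R) * d ^ 2 -
        ((‖coupling c‖ + 2 * c.R * N) * s * d - c.R / 2 * s ^ 2) =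
        (c.R * s - (‖coupling c‖ + 2 * c.R * N) * d) ^ 2 / (2 * c.R) := by
      field_simp; ring
    have : 0 ≤ (c.R * s - (‖coupling c‖ + 2 * c.R * N) * d) ^ 2 / (2 * c.R) := by positivity
    linarith
  rw [growthRate, add_mul]
  linarith

theorem growthRate_ge (c : Constants) {N : ℝ} : c.R * N ≤ growthRate c N := by
  have hR := c.R_pos
  rw [growthRate]
  have : 0 ≤ (‖coupling c‖ + 2 * c.R * N) ^ 2 / (2 * c.R) := by positivity
  linarith

theorem ev_mul_pot (c : Constants) (ψ n : Coeff) (x : AddCircle L) :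
    ev L (mul L (pot L c n) ψ) x = (coupling c * ev L n x - (c.α / 2 : ℝ)) * ev L ψ x := by
  rw [ev_mul, ContinuousMap.mul_apply, ev_pot, coupling]

theorem re_potential_le (c : Constants) {N r : ℝ} (hr : r ≤ N) :
    (coupling c * r - (c.α / 2 : ℝ)).re ≤ c.R * N / 2 := by
  have := c.α_pos
  have := c.R_pos
  rw [Complex.sub_re, Complex.re_mul_ofReal, coupling_re, Complex.ofReal_re]
  nlinarith

/-- In the derivative of `‖ψ‖² + ε‖n‖²` in `H¹`, the coupling terms grow at most linearly in
`‖ψ‖²`. -/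
theorem inner_coupling_le (c : Constants) {N : ℝ} (ψ n : Coeff)
    (hn : ∀ x, ∃ r : ℝ, ev L n x = r ∧ 0 ≤ r ∧ r ≤ N) :
    2 * (inner ℂ ψ (mul L (pot L c n) ψ) : ℂ).re + 2 * (inner ℂ n (production L c ψ n) : ℂ).re ≤
      growthRate c N * ‖ψ‖ ^ 2 + 2 * N * c.P := by
  have hβ := c.β_pos
  have hR := c.R_pos
  have hP := c.P_pos
  have h := re_inner_add_le (L := L) (a := ψ) (b := (2 : ℂ) • mul L (pot L c n) ψ) (a' := n)
    (b' := (2 : ℂ) • production L c ψ n) (w := ψ) (C := growthRate c N) (D := 2 * N * c.P)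
    (fun x y => by
      obtain ⟨r, hr, hr0, hrN⟩ := hn x
      obtain ⟨q, hq, hq0, hqN⟩ := hn y
      refine le_of_eq_of_le ?_ (increment_le c hr0 hrN hq0 hqN (ev L ψ x) (ev L ψ y))
      simp only [map_smul, ContinuousMap.smul_apply, ev_mul_pot, ev_production, hr, hq, smul_eq_mul]
      congr 1
      · congr 2; ring
      · rw [← Complex.ofReal_sub, Complex.conj_ofReal, Complex.re_ofReal_mul]
        rw [← Complex.ofReal_mul, ← Complex.ofReal_mul, ← Complex.ofReal_sub, ← Complex.ofReal_sub,
          ← Complex.ofReal_ofNat, ← Complex.ofReal_mul, ← Complex.ofReal_mul, ← Complex.ofReal_sub,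
          Complex.ofReal_re]
        ring)
    (fun x => by
      obtain ⟨r, hr, hr0, hrN⟩ := hn x
      simp only [map_smul, ContinuousMap.smul_apply, ev_mul_pot, ev_production, hr, smul_eq_mul]
      refine add_le_add ?_ ?_
      · rw [← mul_assoc (2 : ℂ), re_conj_mul_self]
        have h1 := re_potential_le c hrN
        have h2 := growthRate_ge c (N := N)
        gcongr
        rw [← Complex.ofReal_ofNat, Complex.re_ofReal_mul]
        linarith
      · rw [Complex.conj_ofReal, ← Complex.ofReal_mul, ← Complex.ofReal_sub, ← Complex.ofReal_ofNat,
          ← Complex.ofReal_mul, ← Complex.ofReal_mul, Complex.ofReal_re]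
        have h3 : 0 ≤ (c.β + c.R * ‖ev L ψ x‖ ^ 2) * r * r := by positivity
        nlinarith)
  rwa [inner_smul_right, inner_smul_right, ← Complex.ofReal_ofNat, Complex.re_ofReal_mul,
    Complex.re_ofReal_mul] at h

theorem inner_cubic_le (c : Constants) {N : ℝ} (ψ n : Coeff)
    (hn : ∀ x, ∃ r : ℝ, ev L n x = r ∧ r ≤ N) :
    4 * c.g * (inner ℂ (toL2 L (cubic L ψ)) (toL2 L (mul L (pot L c n) ψ)) : ℂ).re ≤
      2 * c.R * N * (c.g * quartic L ψ) := by
  have hg := c.g_pos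
  have h : (inner ℂ (toL2 L (cubic L ψ)) (toL2 L (mul L (pot L c n) ψ)) : ℂ).re ≤
      c.R * N / 2 * quartic L ψ := by
    rw [inner_toL2, re_integral (by fun_prop), quartic_eq, ← integral_const_mul]
    refine integral_mono (integrable_of_continuous (by fun_prop))
      (integrable_of_continuous (by fun_prop)) fun x => ?_
    obtain ⟨r, hr, hrN⟩ := hn x
    simp only [ev_mul_pot, ev_cubic, hr, map_mul, Complex.conj_ofReal]
    rw [mul_assoc, Complex.re_ofReal_mul, re_conj_mul_self]
    have := re_potential_le c hrN
    calc _ = (coupling c * r - (c.α / 2 : ℝ)).re * (‖ev L ψ x‖ ^ 2) ^ 2 := by ring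
      _ ≤ _ := by gcongr
  nlinarith

section GP

variable {c : Constants} {ε T : ℝ} {ψ₀ n₀ : Coeff} {u : ℝ → Coeff × Coeff}

theorem gp_deriv_fst (hu : IsTrajectory (gpField L c ε) (ψ₀, n₀) T u) :
    ∀ t ∈ Icc 0 T, HasDerivWithinAt (fun t => (u t).1)
      (freeFlow L (-t) (force L c (freeFlow L t (u t).1) (u t).2)) (Icc 0 T) t := fun t ht =>
  (ContinuousLinearMap.fst ℝ Coeff Coeff).hasFDerivAt.comp_hasDerivWithinAt t (hu.deriv t ht)

theorem gp_deriv_snd (hu : IsTrajectory (gpField L c ε) (ψ₀, n₀) T u) :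
    ∀ t ∈ Icc 0 T, HasDerivWithinAt (fun t => (u t).2)
      (((ε⁻¹ : ℝ) : ℂ) • production L c (freeFlow L t (u t).1) (u t).2) (Icc 0 T) t := fun t ht =>
  (ContinuousLinearMap.snd ℝ Coeff Coeff).hasFDerivAt.comp_hasDerivWithinAt t (hu.deriv t ht)

theorem gp_continuousOn_wave (hu : IsTrajectory (gpField L c ε) (ψ₀, n₀) T u) :
    ContinuousOn (fun t => freeFlow L t (u t).1) (Icc 0 T) :=
  continuousOn_wave fun t ht => (gp_deriv_fst hu t ht).continuousWithinAt

theorem gp_continuousOn_density (hu : IsTrajectory (gpField L c ε) (ψ₀, n₀) T u) :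
    ContinuousOn (fun t => (u t).2) (Icc 0 T) :=
  fun t ht => (gp_deriv_snd hu t ht).continuousWithinAt

/-- `n` is real-valued with values between `0` and `N`. -/
def IsDensity (L : ℝ) [Fact (0 < L)] (N : ℝ) (n : Coeff) : Prop :=
  ∀ x, ∃ r : ℝ, ev L n x = r ∧ 0 ≤ r ∧ r ≤ N

theorem IsDensity.evolve {N : ℝ} (hε : 0 < ε) {ψ n : ℝ → Coeff} (hψ : ContinuousOn ψ (Icc 0 T))
    (hn : ∀ t ∈ Icc 0 T,
      HasDerivWithinAt n (((ε⁻¹ : ℝ) : ℂ) • production L c (ψ t) (n t)) (Icc 0 T) t)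
    (hN : c.P / c.β ≤ N) (h0 : IsDensity L N (n 0)) : ∀ t ∈ Icc 0 T, IsDensity L N (n t) := by
  intro t ht x
  obtain ⟨r, hr, hr0, hrN⟩ := h0 x
  have := density_bounds hε hψ hn hN x (by simp [hr]) (by simpa [hr]) (by simpa [hr]) t ht
  exact ⟨_, this⟩

theorem gp_isDensity {N : ℝ} (hε : 0 < ε) (hN : c.P / c.β ≤ N) (h0 : IsDensity L N n₀)
    (hu : IsTrajectory (gpField L c ε) (ψ₀, n₀) T u) : ∀ t ∈ Icc 0 T, IsDensity L N (u t).2 :=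
  IsDensity.evolve hε (gp_continuousOn_wave hu) (gp_deriv_snd hu) hN (by rw [hu.init]; exact h0)

/-- The energy bound. Its constants do not depend on `ε ∈ (0, 1]`. -/
theorem gp_energy_le {N : ℝ} (hε : 0 < ε) (hN : c.P / c.β ≤ N) (h0 : IsDensity L N n₀)
    (hu : IsTrajectory (gpField L c ε) (ψ₀, n₀) T u) : ∀ t ∈ Icc 0 T,
      ‖(u t).1‖ ^ 2 + ε * ‖(u t).2‖ ^ 2 ≤ Real.exp ((growthRate c N + 2 * c.R * N) * t) *
        (‖ψ₀‖ ^ 2 + c.g * quartic L ψ₀ + ε * ‖n₀‖ ^ 2 + 2 * N * c.P * t) := by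
  intro t ht
  have hR := c.R_pos
  have hP := c.P_pos
  have hg := c.g_pos
  have hN0 : 0 ≤ N := (div_pos hP c.β_pos).le.trans hN
  have hC : 0 ≤ growthRate c N := (by positivity : 0 ≤ c.R * N).trans (growthRate_ge c)
  have hQ : ∀ a : Coeff, 0 ≤ quartic L a := fun a => sq_nonneg _
  have hd : ∀ t ∈ Icc 0 T, HasDerivWithinAt
      (fun t => (‖(u t).1‖ ^ 2 + c.g * quartic L (freeFlow L t (u t).1)) + ε * ‖(u t).2‖ ^ 2)
      (2 * (inner ℂ (freeFlow L t (u t).1) 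
          (mul L (pot L c (u t).2) (freeFlow L t (u t).1)) : ℂ).re +
        4 * c.g * (inner ℂ (toL2 L (cubic L (freeFlow L t (u t).1)))
          (toL2 L (mul L (pot L c (u t).2) (freeFlow L t (u t).1))) : ℂ).re +
        2 * (inner ℂ (u t).2 (production L c (freeFlow L t (u t).1) (u t).2) : ℂ).re)
      (Icc 0 T) t := fun t ht => by
    refine ((hasDerivWithinAt_energy c rfl (gp_deriv_fst hu t ht)).add
      ((hasDerivWithinAt_norm_sq (gp_deriv_snd hu t ht)).const_mul ε)).congr_deriv ?_
    rw [inner_smul_right, Complex.re_ofReal_mul]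
    field_simp
  have h := le_exp_mul_of_deriv_le (K := growthRate c N + 2 * c.R * N) (by positivity) hd
    (r := fun _ => 2 * N * c.P) continuousOn_const (fun _ _ => by positivity) (fun t ht => by
      have hdens := gp_isDensity hε hN h0 hu t ht
      have h1 := inner_coupling_le c (freeFlow L t (u t).1) (u t).2 hdens
      have h2 := inner_cubic_le c (freeFlow L t (u t).1) (u t).2
        fun x => (hdens x).imp fun r h => ⟨h.1, h.2.2⟩
      rw [norm_freeFlow] at h1
      have h3 := mul_nonneg hg.le (hQ (freeFlow L t (u t).1))
      have h4 : 0 ≤ ε * ‖(u t).2‖ ^ 2 := by positivity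
      have h5 := sq_nonneg ‖(u t).1‖
      have h6 : 0 ≤ 2 * c.R * N := by positivity
      nlinarith [mul_nonneg hC h3, mul_nonneg hC h4, mul_nonneg h6 h5, mul_nonneg h6 h4]) t ht
  rw [hu.init] at h
  simp only [freeFlow_zero, intervalIntegral.integral_const, sub_zero, smul_eq_mul] at h
  have := mul_nonneg hg.le (hQ (freeFlow L t (u t).1))
  rw [mul_comm t] at h
  linarith

theorem gp_exists_global {N : ℝ} (hε : 0 < ε) (hN : c.P / c.β ≤ N) (h0 : IsDensity L N n₀) :
    ∃ u, ∀ T, IsTrajectory (gpField L c ε) (ψ₀, n₀) T u := by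
  refine exists_global_trajectory (locallyLipField_gpField c ε) _ fun T hT => ?_
  have hR := c.R_pos
  have hP := c.P_pos
  have hg := c.g_pos
  have hN0 : 0 ≤ N := (div_pos hP c.β_pos).le.trans hN
  have hC : 0 ≤ growthRate c N := (by positivity : 0 ≤ c.R * N).trans (growthRate_ge c)
  have hQ : 0 ≤ quartic L ψ₀ := sq_nonneg _
  set B := Real.exp ((growthRate c N + 2 * c.R * N) * T) *
        (‖ψ₀‖ ^ 2 + c.g * quartic L ψ₀ + ε * ‖n₀‖ ^ 2 + 2 * N * c.P * T) with hB
  refine ⟨max √B √(B / ε), fun t ht u hu => ?_⟩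
  have h1 := gp_energy_le hε hN h0 hu t (right_mem_Icc.2 ht.1)
  have h2 : Real.exp ((growthRate c N + 2 * c.R * N) * t) *
      (‖ψ₀‖ ^ 2 + c.g * quartic L ψ₀ + ε * ‖n₀‖ ^ 2 + 2 * N * c.P * t) ≤ B := by
    have := ht.1
    rw [hB]
    gcongr
    all_goals exact ht.2
  have h3 : 0 ≤ ε * ‖(u t).2‖ ^ 2 := by positivity
  refine max_le_max (Real.le_sqrt_of_sq_le ?_) (Real.le_sqrt_of_sq_le ?_)
  · linarith
  · rw [le_div_iff₀ hε]
    nlinarith [sq_nonneg ‖(u t).1‖]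

end GP

/-! ### Global solutions of the adiabatic equation -/

/-- The increments of the adiabatic coupling. The density decays like `|z|⁻²`, which compensates the
factor `|z| + |w|`, so that the constant does not depend on the size of `z` and `w`. -/
theorem adiabatic_increment_le (c : Constants) (z w : ℂ) :
    ((starRingEnd ℂ) (z - w) * (2 * ((coupling c * adiabaticDensity c z - (c.α / 2 : ℝ)) * z -
        (coupling c * adiabaticDensity c w - (c.α / 2 : ℝ)) * w))).re ≤
      6 * ‖coupling c‖ * (c.P / c.β) * ‖z - w‖ ^ 2 := by
  have hP := c.P_pos
  have hR := c.R_pos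
  have hβ := c.β_pos
  have hα := c.α_pos
  set r := adiabaticDensity c z with hr
  set q := adiabaticDensity c w with hq
  set N := c.P / c.β with hN
  have hr0 : 0 < r := adiabaticDensity_pos c z
  have hq0 : 0 < q := adiabaticDensity_pos c w
  have hrN : r ≤ N := adiabaticDensity_le c z
  have hqN : q ≤ N := adiabaticDensity_le c w
  have hN0 : 0 < N := by positivity
  have hpr : r * (c.β + c.R * ‖z‖ ^ 2) = c.P := by
    rw [hr, adiabaticDensity]; exact div_mul_cancel₀ _ (by positivity)
  have hpq : q * (c.β + c.R * ‖w‖ ^ 2) = c.P := by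
    rw [hq, adiabaticDensity]; exact div_mul_cancel₀ _ (by positivity)
  set d := ‖z - w‖ with hd
  have hd0 : 0 ≤ d := norm_nonneg _
  have h1 : |r - q| * ‖z + w‖ ≤ 4 * N * d := by
    have h2 : |r - q| ≤ c.R / c.P * (r * q) * ((‖z‖ + ‖w‖) * d) := by
      rw [hr, hq, adiabaticDensity_sub, ← hr, ← hq, abs_mul, abs_of_pos (by positivity)]
      gcongr
      rw [abs_sub_comm]
      exact abs_norm_sq_sub_le z w
    have h3 : c.R * (r * q) * (‖z‖ + ‖w‖) ^ 2 ≤ 4 * N * c.P := by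
      have h4 : (‖z‖ + ‖w‖) ^ 2 ≤ 2 * (‖z‖ ^ 2 + ‖w‖ ^ 2) := by
        nlinarith [sq_nonneg (‖z‖ - ‖w‖)]
      have h5 : r * (c.R * ‖z‖ ^ 2) ≤ c.P := by nlinarith [mul_pos hr0 hβ]
      have h6 : q * (c.R * ‖w‖ ^ 2) ≤ c.P := by nlinarith [mul_pos hq0 hβ]
      calc c.R * (r * q) * (‖z‖ + ‖w‖) ^ 2
          ≤ c.R * (r * q) * (2 * (‖z‖ ^ 2 + ‖w‖ ^ 2)) := by gcongr
        _ = 2 * (q * (r * (c.R * ‖z‖ ^ 2)) + r * (q * (c.R * ‖w‖ ^ 2))) := by ring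
        _ ≤ 2 * (N * c.P + N * c.P) := by gcongr
        _ = _ := by ring
    calc |r - q| * ‖z + w‖ ≤ c.R / c.P * (r * q) * ((‖z‖ + ‖w‖) * d) * (‖z‖ + ‖w‖) := by
          gcongr
          exact norm_add_le z w
      _ = c.R * (r * q) * (‖z‖ + ‖w‖) ^ 2 / c.P * d := by ring
      _ ≤ 4 * N * c.P / c.P * d := by gcongr
      _ = _ := by rw [mul_div_cancel_right₀ _ hP.ne']
  have e : (starRingEnd ℂ) (z - w) * (2 * ((coupling c * r - (c.α / 2 : ℝ)) * z -
        (coupling c * q - (c.α / 2 : ℝ)) * w)) =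
        (starRingEnd ℂ) (z - w) * ((coupling c * (r + q : ℝ) - (c.α : ℝ)) * (z - w)) +
        (starRingEnd ℂ) (z - w) * (coupling c * (r - q : ℝ) * (z + w)) := by
      push_cast; ring
  have hκ : c.R / 2 ≤ ‖coupling c‖ := by
    rw [← coupling_re]; exact Complex.re_le_norm _
  rw [e, Complex.add_re, re_conj_mul_self]
  have h7 : (coupling c * (r + q : ℝ) - (c.α : ℝ)).re * ‖z - w‖ ^ 2 ≤
      2 * ‖coupling c‖ * N * d ^ 2 := by
    rw [Complex.sub_re, Complex.re_mul_ofReal, coupling_re, Complex.ofReal_re]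
    gcongr
    nlinarith
  have h8 : ((starRingEnd ℂ) (z - w) * (coupling c * (r - q : ℝ) * (z + w))).re ≤
      4 * ‖coupling c‖ * N * d ^ 2 := by
    refine (re_conj_mul_le _ _).trans ?_
    rw [norm_mul, norm_mul, Complex.norm_real, Real.norm_eq_abs]
    calc d * (‖coupling c‖ * |r - q| * ‖z + w‖)
        = d * (‖coupling c‖ * (|r - q| * ‖z + w‖)) := by ring
      _ ≤ d * (‖coupling c‖ * (4 * N * d)) := by gcongr
      _ = _ := by ring
  linarith

section Adiabatic

variable {c : Constants} {T : ℝ} {ψ₀ : Coeff} {v : ℝ → Coeff}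

theorem isDensity_dens (c : Constants) (a : Coeff) : IsDensity L (c.P / c.β) (dens L c a) :=
  fun x => ⟨_, ev_dens c a x, (adiabaticDensity_pos c _).le, adiabaticDensity_le c _⟩

theorem adiabatic_energy_le (hv : IsTrajectory (adiabaticField L c) ψ₀ T v) : ∀ t ∈ Icc 0 T,
    ‖v t‖ ^ 2 ≤ Real.exp ((6 * ‖coupling c‖ * (c.P / c.β) + 2 * c.R * (c.P / c.β)) * t) *
      (‖ψ₀‖ ^ 2 + c.g * quartic L ψ₀) := by
  intro t ht
  have hR := c.R_pos
  have hP := c.P_pos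
  have hg := c.g_pos
  have hβ := c.β_pos
  have hQ : ∀ a : Coeff, 0 ≤ quartic L a := fun a => sq_nonneg _
  set C := 6 * ‖coupling c‖ * (c.P / c.β) with hC
  set C' := 2 * c.R * (c.P / c.β) with hC'
  have hC0 : 0 ≤ C := by positivity
  have hC'0 : 0 ≤ C' := by positivity
  have hd := fun t ht => hasDerivWithinAt_energy (L := L) c
    (n := dens L c (freeFlow L t (v t))) rfl (hv.deriv t ht)
  have h := le_exp_mul_of_deriv_le (K := C + C') (by positivity) hd
    (r := fun _ => 0) continuousOn_const (fun _ _ => le_rfl) (fun t ht => by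
      set ψ := freeFlow L t (v t) with hψ
      have h1 := re_inner_add_le (L := L) (a := ψ)
        (b := (2 : ℂ) • mul L (pot L c (dens L c ψ)) ψ) (a' := 0) (b' := 0) (w := ψ) (C := C)
        (D := 0) (fun x y => by
          simp only [map_smul, map_zero, ContinuousMap.zero_apply, sub_zero, zero_mul,
            Complex.zero_re, add_zero, ContinuousMap.smul_apply, ev_mul_pot, ev_dens, smul_eq_mul]
          rw [← mul_sub]
          exact adiabatic_increment_le c (ev L ψ x) (ev L ψ y)) (fun x => by
          simp only [map_smul, map_zero, ContinuousMap.zero_apply, zero_mul,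
            Complex.zero_re, add_zero, ContinuousMap.smul_apply, ev_mul_pot, ev_dens, smul_eq_mul]
          rw [← mul_assoc (2 : ℂ), re_conj_mul_self, ← Complex.ofReal_ofNat, Complex.re_ofReal_mul]
          have h2 := re_potential_le c (adiabaticDensity_le c (ev L ψ x))
          have hκ : c.R / 2 ≤ ‖coupling c‖ := by
            rw [← coupling_re]; exact Complex.re_le_norm _
          have : 0 < c.P / c.β := by positivity
          gcongr
          nlinarith)
      have h2 := inner_cubic_le c ψ (dens L c ψ)
        fun x => (isDensity_dens c ψ x).imp fun r h => ⟨h.1, h.2.2⟩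
      rw [inner_smul_right, ← Complex.ofReal_ofNat, Complex.re_ofReal_mul, hψ, norm_freeFlow,
        ← hψ, inner_zero_left, Complex.zero_re] at h1
      have h3 := mul_nonneg hg.le (hQ ψ)
      have h5 := sq_nonneg ‖v t‖
      nlinarith [mul_nonneg hC0 h3, mul_nonneg hC'0 h5]) t ht
  simp only [hv.init, freeFlow_zero, intervalIntegral.integral_zero, add_zero] at h
  have := mul_nonneg hg.le (hQ (freeFlow L t (v t)))
  linarith

variable (c ψ₀) in
theorem adiabatic_exists_global : ∃ v, ∀ T, IsTrajectory (adiabaticField L c) ψ₀ T v := by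
  refine exists_global_trajectory (locallyLipField_adiabaticField c) _ fun T hT => ?_
  have hR := c.R_pos
  have hP := c.P_pos
  have hg := c.g_pos
  have hβ := c.β_pos
  have hQ : 0 ≤ quartic L ψ₀ := sq_nonneg _
  refine ⟨√(Real.exp ((6 * ‖coupling c‖ * (c.P / c.β) + 2 * c.R * (c.P / c.β)) * T) *
      (‖ψ₀‖ ^ 2 + c.g * quartic L ψ₀)), fun t ht v hv => Real.le_sqrt_of_sq_le ?_⟩
  refine (adiabatic_energy_le hv t (right_mem_Icc.2 ht.1)).trans ?_
  gcongr
  exact ht.2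

end Adiabatic

end

section

/-! ### Mild solutions and trajectories -/

/-- The fundamental theorem of calculus, as an equivalence. -/
theorem hasDerivWithinAt_iff_eq_integral {F : Type*} [NormedAddCommGroup F] [NormedSpace ℝ F]
    [CompleteSpace F] {p u : ℝ → F} {x₀ : F} {T : ℝ} (hT : 0 ≤ T) (hp : ContinuousOn p (Icc 0 T)) :
    (u 0 = x₀ ∧ ∀ t ∈ Icc 0 T, HasDerivWithinAt u (p t) (Icc 0 T) t) ↔
      ∀ t ∈ Icc 0 T, u t = x₀ + ∫ s in 0..t, p s := by
  constructor
  · rintro ⟨h0, h⟩ t ht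
    have hsub : Icc 0 t ⊆ Icc 0 T := Icc_subset_Icc_right ht.2
    have := intervalIntegral.integral_eq_sub_of_hasDeriv_right_of_le ht.1
      (fun s hs => (h s (hsub hs)).continuousWithinAt.mono hsub)
      (fun s hs => (hasDerivWithinAt_Ici_of_Icc ⟨hs.1.le, hs.2.trans_le ht.2⟩
        (h s ⟨hs.1.le, (hs.2.trans_le ht.2).le⟩)).Ioi_of_Ici)
      ((hp.mono hsub).intervalIntegrable_of_Icc ht.1)
    rw [this, h0, add_sub_cancel]
  · intro h
    refine ⟨by simpa using h 0 (left_mem_Icc.2 hT), fun t ht => ?_⟩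
    exact ((hasDerivWithinAt_primitive hT hp t ht).const_add x₀).congr_of_mem h ht

/-- Duhamel's formula for `m' = q - κ m`, as an equivalence. -/
theorem relaxation_iff_eq_integral {F : Type*} [NormedAddCommGroup F] [NormedSpace ℝ F]
    [CompleteSpace F] {q m : ℝ → F} {x₀ : F} {κ T : ℝ} (hT : 0 ≤ T)
    (hq : ContinuousOn q (Icc 0 T)) :
    (m 0 = x₀ ∧ ∀ t ∈ Icc 0 T, HasDerivWithinAt m (q t - κ • m t) (Icc 0 T) t) ↔
      ∀ t ∈ Icc 0 T, m t = Real.exp (-κ * t) • x₀ +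
        ∫ s in 0..t, Real.exp (-κ * (t - s)) • q s := by
  have hE : ∀ (a : ℝ) t, HasDerivWithinAt (fun t => Real.exp (a * t)) (Real.exp (a * t) * a)
      (Icc 0 T) t := fun a t => by
    simpa using ((hasDerivAt_id t).const_mul a).exp.hasDerivWithinAt
  have hee : ∀ t, Real.exp (-κ * t) * Real.exp (κ * t) = 1 := fun t => by
    rw [← Real.exp_add]; simp
  have hp : ContinuousOn (fun t => Real.exp (κ * t) • q t) (Icc 0 T) :=
    ContinuousOn.smul (by fun_prop) hq
  have key := hasDerivWithinAt_iff_eq_integral (u := fun t => Real.exp (κ * t) • m t) (x₀ := x₀)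
    hT hp
  have h1 : (m 0 = x₀ ∧ ∀ t ∈ Icc 0 T, HasDerivWithinAt m (q t - κ • m t) (Icc 0 T) t) ↔
      (Real.exp (κ * 0) • m 0 = x₀ ∧ ∀ t ∈ Icc 0 T,
        HasDerivWithinAt (fun t => Real.exp (κ * t) • m t) (Real.exp (κ * t) • q t)
          (Icc 0 T) t) := by
    refine and_congr (by simp) (forall₂_congr fun t ht => ⟨fun h => ?_, fun h => ?_⟩)
    · refine ((hE κ t).smul h).congr_deriv ?_
      rw [smul_sub, smul_smul]; abel
    · refine (((hE (-κ) t).smul h).congr_deriv ?_).congr_of_mem (fun s _ => ?_) ht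
      · rw [smul_smul, hee, one_smul, smul_smul, mul_right_comm, hee, one_mul, neg_smul,
          sub_eq_add_neg]
      · rw [Pi.smul_apply', smul_smul, hee, one_smul]
  rw [h1, key]
  refine forall₂_congr fun t ht => ?_
  have h3 : ∀ s, Real.exp (-κ * (t - s)) • q s = Real.exp (-κ * t) • Real.exp (κ * s) • q s :=
    fun s => by rw [smul_smul, ← Real.exp_add]; ring_nf
  simp_rw [h3]
  rw [intervalIntegral.integral_smul, ← smul_add]
  constructor
  · intro h
    rw [← h, smul_smul, hee, one_smul]
  · intro h
    rw [h, smul_smul, mul_comm, hee, one_smul]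

theorem continuousOn_Ici_of_Icc {E : Type*} [TopologicalSpace E] {p : ℝ → E}
    (hp : ∀ T, ContinuousOn p (Icc 0 T)) : ContinuousOn p (Ici 0) := fun t ht => by
  refine (hp (t + 1) t ⟨ht, by linarith⟩).mono_of_mem_nhdsWithin ?_
  rw [← Ici_inter_Iic]
  exact inter_mem_nhdsWithin _ (Iic_mem_nhds (by linarith))

theorem intervalIntegrable_of_mem {F : Type*} [NormedAddCommGroup F] {p : ℝ → F} {T t : ℝ}
    (hp : ContinuousOn p (Icc 0 T)) (ht : t ∈ Icc 0 T) : IntervalIntegrable p volume 0 t :=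
  (hp.mono (Icc_subset_Icc_right ht.2)).intervalIntegrable_of_Icc ht.1

theorem continuousOn_comp₂ {X E F G : Type*} [TopologicalSpace X] [TopologicalSpace E]
    [TopologicalSpace F] [TopologicalSpace G] {f : E × F → G} (hf : Continuous f) {a : X → E}
    {m : X → F} {s : Set X} (ha : ContinuousOn a s) (hm : ContinuousOn m s) :
    ContinuousOn (fun t => f (a t, m t)) s := hf.comp_continuousOn (ha.prodMk hm)

variable {L : ℝ} [hL : Fact (0 < L)]

theorem ev_real_smul (r : ℝ) (a : Coeff) (x : AddCircle L) :
    ev L (r • a) x = (r : ℂ) * ev L a x := by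
  rw [show r • a = (r : ℂ) • a from rfl, map_smul, ContinuousMap.smul_apply, smul_eq_mul]

theorem ev_integral {p : ℝ → Coeff} {T t : ℝ} (hp : ContinuousOn p (Icc 0 T)) (ht : t ∈ Icc 0 T)
    (x : AddCircle L) : ev L (∫ s in 0..t, p s) x = ∫ s in 0..t, ev L (p s) x :=
  ((((ContinuousMap.evalCLM ℂ x).comp (ev L)).restrictScalars ℝ).intervalIntegral_comp_comm
    (intervalIntegrable_of_mem hp ht)).symm

/-- Duhamel's formula, pointwise on the torus, is the differential equation for `S(-t)a(t)`. -/
theorem duhamel_iff {a G : ℝ → Coeff} {a₀ : Coeff} {T : ℝ} (hT : 0 ≤ T)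
    (hG : ContinuousOn G (Icc 0 T)) :
    (freeFlow L (-0) (a 0) = a₀ ∧ ∀ t ∈ Icc 0 T,
      HasDerivWithinAt (fun t => freeFlow L (-t) (a t)) (freeFlow L (-t) (G t)) (Icc 0 T) t) ↔
    ∀ t ∈ Icc 0 T, ∀ x, ev L (a t) x = freeGroup t (ev L a₀) x +
      ∫ τ in 0..t, freeGroup (t - τ) (ev L (G τ)) x := by
  have hp : ContinuousOn (fun t => freeFlow L (-t) (G t)) (Icc 0 T) := fun t ht =>
    tendsto_freeFlow L (tendsto_id.neg.mono_left nhdsWithin_le_nhds) (hG t ht)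
  rw [hasDerivWithinAt_iff_eq_integral (u := fun t => freeFlow L (-t) (a t)) hT hp]
  refine forall₂_congr fun t ht => ?_
  have h1 : freeFlow L (-t) (a t) = a₀ + ∫ s in 0..t, freeFlow L (-s) (G s) ↔
      a t = freeFlow L t a₀ + ∫ s in 0..t, freeFlow L (t - s) (G s) := by
    have h2 : ∫ s in 0..t, freeFlow L (t - s) (G s) =
        freeFlow L t (∫ s in 0..t, freeFlow L (-s) (G s)) := by
      refine Eq.trans ?_ (((freeFlow L t).restrictScalars ℝ).intervalIntegral_comp_comm
        (intervalIntegrable_of_mem hp ht))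
      refine intervalIntegral.integral_congr fun s _ => ?_
      simp only [sub_eq_add_neg, freeFlow_add]
      rfl
    rw [h2, ← map_add]
    exact ⟨fun h => by rw [← h, freeFlow_freeFlow_neg], fun h => by rw [h, freeFlow_neg_freeFlow]⟩
  have hq : ContinuousOn (fun s => freeFlow L (t - s) (G s)) (Icc 0 T) := fun s hs =>
    tendsto_freeFlow L ((tendsto_id.const_sub t).mono_left nhdsWithin_le_nhds) (hG s hs)
  rw [h1]
  refine ⟨fun h x => ?_, fun h => ev_ext (L := L) fun x => ?_⟩
  · rw [h, map_add, ContinuousMap.add_apply, ev_integral hq ht, ev_freeFlow]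
    simp only [ev_freeFlow]
  · rw [h, map_add, ContinuousMap.add_apply, ev_integral hq ht, ev_freeFlow]
    simp only [ev_freeFlow]

theorem continuousOn_force (c : Constants) {a m : ℝ → Coeff} {s : Set ℝ} (ha : ContinuousOn a s)
    (hm : ContinuousOn m s) : ContinuousOn (fun t => force L c (a t) (m t)) s :=
  continuousOn_comp₂ (f := fun p => force L c p.1 p.2) (lipOnBalls_force c).continuous ha hm

theorem continuousOn_adiabaticForce (c : Constants) {a : ℝ → Coeff} {s : Set ℝ}
    (ha : ContinuousOn a s) : ContinuousOn (fun t => force L c (a t) (dens L c (a t))) s :=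
  (lipOnBalls_adiabaticForce c).continuous.comp_continuousOn ha

variable (L) in
/-- The production rate of the reservoir without its linear decay, `(P - R|a|²m)/ε`. -/
def source (c : Constants) (ε : ℝ) (a m : Coeff) : Coeff :=
  ((ε⁻¹ : ℝ) : ℂ) • ((c.P : ℂ) • one L - (c.R : ℂ) • mul L (modSq L a) m)

theorem lipOnBalls_source (c : Constants) (ε : ℝ) :
    LipOnBalls fun p : Coeff × Coeff => source L c ε p.1 p.2 :=
  ((LipOnBalls.const _).sub ((lipOnBalls_fst.modSq.mul lipOnBalls_snd).smul _)).smul _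

theorem continuousOn_source (c : Constants) (ε : ℝ) {a m : ℝ → Coeff} {s : Set ℝ}
    (ha : ContinuousOn a s) (hm : ContinuousOn m s) :
    ContinuousOn (fun t => source L c ε (a t) (m t)) s :=
  continuousOn_comp₂ (f := fun p => source L c ε p.1 p.2) (lipOnBalls_source c ε).continuous ha hm

theorem ev_source (c : Constants) (ε : ℝ) (a m : Coeff) (x : AddCircle L) {r : ℝ}
    (h : ev L m x = r) :
    ev L (source L c ε a m) x = (((c.P - c.R * ‖ev L a x‖ ^ 2 * r) / ε : ℝ) : ℂ) := by
  simp only [source, map_smul, map_sub, ContinuousMap.smul_apply, ContinuousMap.sub_apply, ev_one,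
    ev_mul, ContinuousMap.mul_apply, ev_modSq, h, ContinuousMap.one_apply, smul_eq_mul]
  push_cast
  ring

theorem smul_production_eq (c : Constants) (ε : ℝ) (a m : Coeff) :
    ((ε⁻¹ : ℝ) : ℂ) • production L c a m = source L c ε a m - (c.β / ε) • m :=
  ev_ext (L := L) fun x => by
    rw [map_sub, ContinuousMap.sub_apply, ev_real_smul]
    simp only [source, map_smul, map_sub, ContinuousMap.smul_apply, ContinuousMap.sub_apply, ev_one,
      ev_mul, ContinuousMap.mul_apply, ev_modSq, ev_production, ContinuousMap.one_apply,
      smul_eq_mul]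
    push_cast
    ring

/-- Duhamel's formula for the density, pointwise on the torus, is its differential equation. -/
theorem density_duhamel_iff {c : Constants} {ε T : ℝ} {a m : ℝ → Coeff} {m₀ : Coeff}
    {n : ℝ → AddCircle L → ℝ} {n₀ : AddCircle L → ℝ} (hT : 0 ≤ T)
    (ha : ContinuousOn a (Icc 0 T)) (hmc : ContinuousOn m (Icc 0 T))
    (hm : ∀ t ∈ Icc 0 T, ∀ x, ev L (m t) x = n t x) (hm₀ : ∀ x, ev L m₀ x = n₀ x) :
    (m 0 = m₀ ∧ ∀ t ∈ Icc 0 T,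
      HasDerivWithinAt m (((ε⁻¹ : ℝ) : ℂ) • production L c (a t) (m t)) (Icc 0 T) t) ↔
    ∀ t ∈ Icc 0 T, ∀ x, n t x = Real.exp (-(c.β / ε) * t) * n₀ x +
      ∫ τ in (0 : ℝ)..t, Real.exp (-(c.β / ε) * (t - τ)) *
        ((c.P - c.R * ‖ev L (a τ) x‖ ^ 2 * n τ x) / ε) := by
  have hqc := continuousOn_source (L := L) c ε ha hmc
  simp only [smul_production_eq]
  rw [relaxation_iff_eq_integral hT hqc]
  refine forall₂_congr fun t ht => ?_
  have hec : ContinuousOn (fun s => Real.exp (-(c.β / ε) * (t - s)) • source L c ε (a s) (m s))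
      (Icc 0 T) :=
    ContinuousOn.smul (f := fun s => Real.exp (-(c.β / ε) * (t - s))) (by fun_prop) hqc
  have hint : ∀ x, ev L (Real.exp (-(c.β / ε) * t) • m₀ +
      ∫ s in 0..t, Real.exp (-(c.β / ε) * (t - s)) • source L c ε (a s) (m s)) x =
      ((Real.exp (-(c.β / ε) * t) * n₀ x + ∫ τ in (0 : ℝ)..t, Real.exp (-(c.β / ε) * (t - τ)) *
        ((c.P - c.R * ‖ev L (a τ) x‖ ^ 2 * n τ x) / ε) : ℝ) : ℂ) := fun x => by
    rw [map_add, ContinuousMap.add_apply, ev_integral hec ht, Complex.ofReal_add,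
      ← intervalIntegral.integral_ofReal, ev_real_smul, hm₀, Complex.ofReal_mul]
    congr 1
    refine intervalIntegral.integral_congr fun s hs => ?_
    rw [uIcc_of_le ht.1] at hs
    simp only [ev_real_smul, ev_source c ε _ _ x (hm s ⟨hs.1, hs.2.trans ht.2⟩ x),
      Complex.ofReal_mul]
  constructor
  · intro h x
    have := hint x
    rw [← h, hm t ht] at this
    exact_mod_cast this
  · intro h
    refine ev_ext (L := L) fun x => ?_
    rw [hint, ← h, hm t ht]

theorem ContinuousOnH1.mono {u : ℝ → AddCircle L → ℂ} {I J : Set ℝ} (h : ContinuousOnH1 u I)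
    (hJ : J ⊆ I) : ContinuousOnH1 u J :=
  ⟨fun t ht => h.1 t (hJ ht), fun t ht => (h.2 t (hJ ht)).mono_left (nhdsWithin_mono t hJ)⟩

theorem h1Norm_ev_sub (a b : Coeff) :
    h1Norm ((ev L a : AddCircle L → ℂ) - (ev L b : AddCircle L → ℂ)) = √L * ‖a - b‖ := by
  rw [← h1Norm_ev, map_sub]
  rfl

theorem continuousOnH1_ev {a : ℝ → Coeff} {I : Set ℝ} (ha : ContinuousOn a I) :
    ContinuousOnH1 (fun t => (ev L (a t) : AddCircle L → ℂ)) I := by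
  refine ⟨fun t _ => memH1_ev (a t), fun t ht => ?_⟩
  simp only [h1Norm_ev_sub]
  simpa using (tendsto_iff_norm_sub_tendsto_zero.1 (ha t ht)).const_mul √L

/-- A curve of class `C(I; H¹)` is represented by a continuous curve in the Fourier model. -/
theorem ContinuousOnH1.exists_curve {u : ℝ → AddCircle L → ℂ} {I : Set ℝ}
    (h : ContinuousOnH1 u I) :
    ∃ a : ℝ → Coeff, ContinuousOn a I ∧ ∀ t ∈ I, u t = ev L (a t) := by
  have h1 : ∀ t, ∃ a : Coeff, t ∈ I → u t = ev L a := fun t => by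
    by_cases ht : t ∈ I
    · obtain ⟨a, ha⟩ := exists_ev_eq (h.1 t ht)
      exact ⟨a, fun _ => ha.symm⟩
    · exact ⟨0, fun h => absurd h ht⟩
  choose a ha using h1
  refine ⟨a, fun t ht => ?_, ha⟩
  have hLs : √L ≠ 0 := (Real.sqrt_pos.2 hL.out).ne'
  have h2 := (h.2 t ht).const_mul (√L)⁻¹
  rw [mul_zero] at h2
  refine tendsto_iff_norm_sub_tendsto_zero.2 (h2.congr' ?_)
  filter_upwards [self_mem_nhdsWithin] with s hs
  rw [ha s hs, ha t ht, h1Norm_ev_sub, inv_mul_cancel_left₀ hLs]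

section Adiabatic

variable {c : Constants} {a₀ : Coeff} {v : ℝ → Coeff}

theorem waveForcing_adiabatic (c : Constants) (a : Coeff) :
    (fun y => waveForcing c (ev L a y) (adiabaticDensity c (ev L a y))) =
      ev L (force L c a (dens L c a)) :=
  funext fun y => (ev_force c a _ y (ev_dens c a y)).symm

theorem isAdiabaticSolution_of_trajectory (hv : ∀ T, IsTrajectory (adiabaticField L c) a₀ T v) :
    IsAdiabaticSolution c (ev L a₀ : AddCircle L → ℂ) (Ici 0)
      (fun t => ev L (freeFlow L t (v t))) := by
  have hvc : ∀ T, ContinuousOn (fun t => freeFlow L t (v t)) (Icc 0 T) := fun T =>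
    continuousOn_wave (hv T).continuousOn
  refine ⟨continuousOnH1_ev (continuousOn_Ici_of_Icc hvc), fun t ht x => ?_⟩
  have ht' : (0 : ℝ) ≤ t := ht
  simp only [waveForcing_adiabatic]
  refine (duhamel_iff (a := fun t => freeFlow L t (v t)) ht'
    (continuousOn_adiabaticForce c (hvc t))).1
    ⟨by simp [(hv 0).init], fun s hs => ?_⟩ t (right_mem_Icc.2 ht') x
  simp only [freeFlow_neg_freeFlow]
  exact (hv t).deriv s hs

theorem IsAdiabaticSolution.mono {ψ₀ : AddCircle L → ℂ} {χ : ℝ → AddCircle L → ℂ} {I J : Set ℝ}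
    (h : IsAdiabaticSolution c ψ₀ I χ) (hJ : J ⊆ I) : IsAdiabaticSolution c ψ₀ J χ :=
  ⟨h.continuous.mono hJ, fun t ht => h.duhamel t (hJ ht)⟩

theorem IsAdiabaticSolution.exists_trajectory {T : ℝ} (hT : 0 ≤ T) {χ : ℝ → AddCircle L → ℂ}
    (h : IsAdiabaticSolution c (ev L a₀ : AddCircle L → ℂ) (Icc 0 T) χ) :
    ∃ v, IsTrajectory (adiabaticField L c) a₀ T v ∧
      ∀ t ∈ Icc 0 T, χ t = ev L (freeFlow L t (v t)) := by
  obtain ⟨a, hac, ha⟩ := h.continuous.exists_curve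
  have h1 := (duhamel_iff (a := a) (a₀ := a₀) (G := fun t => force L c (a t) (dens L c (a t))) hT
    (continuousOn_adiabaticForce c hac)).2 fun t ht x => by
      rw [← ha t ht, h.duhamel t ht x]
      congr 1
      refine intervalIntegral.integral_congr fun s hs => ?_
      rw [uIcc_of_le ht.1] at hs
      simp only [ha s ⟨hs.1, hs.2.trans ht.2⟩, waveForcing_adiabatic]
  refine ⟨fun t => freeFlow L (-t) (a t), ⟨h1.1, fun t ht => ?_⟩, fun t ht => ?_⟩
  · rw [adiabaticField, freeFlow_freeFlow_neg]
    exact h1.2 t ht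
  · rw [freeFlow_freeFlow_neg, ha t ht]

end Adiabatic

section GP

variable {c : Constants} {ε : ℝ} {a₀ m₀ : Coeff} {u : ℝ → Coeff × Coeff} {n₀ : AddCircle L → ℝ}

theorem waveForcing_eq_force (c : Constants) (a m : Coeff) {n : AddCircle L → ℝ}
    (h : ∀ x, ev L m x = n x) :
    (fun y => waveForcing c (ev L a y) (n y)) = ev L (force L c a m) :=
  funext fun y => (ev_force c a _ y (h y)).symm

theorem isGPSolution_of_trajectory {N : ℝ} (hε : 0 < ε) (hN : c.P / c.β ≤ N)
    (h0 : IsDensity L N m₀) (hm₀ : ∀ x, ev L m₀ x = n₀ x)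
    (hu : ∀ T, IsTrajectory (gpField L c ε) (a₀, m₀) T u) :
    IsGPSolution c ε (ev L a₀ : AddCircle L → ℂ) n₀ (Ici 0)
      (fun t => ev L (freeFlow L t (u t).1)) (fun t x => (ev L (u t).2 x).re) := by
  have hw : ∀ T, ContinuousOn (fun t => freeFlow L t (u t).1) (Icc 0 T) := fun T =>
    gp_continuousOn_wave (hu T)
  have hd : ∀ T, ContinuousOn (fun t => (u t).2) (Icc 0 T) := fun T =>
    gp_continuousOn_density (hu T)
  have hre : ∀ t, 0 ≤ t → ∀ x, ev L (u t).2 x = ((ev L (u t).2 x).re : ℂ) := fun t ht x => by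
    obtain ⟨r, hr, -⟩ := gp_isDensity hε hN h0 (hu t) t (right_mem_Icc.2 ht) x
    rw [hr, Complex.ofReal_re]
  refine ⟨continuousOnH1_ev (continuousOn_Ici_of_Icc hw), ?_, fun t ht x => ?_, fun t ht x => ?_⟩
  · have h1 := continuousOnH1_ev (L := L) (continuousOn_Ici_of_Icc hd)
    have h2 : ∀ t ∈ Ici (0 : ℝ), (fun x => ((ev L (u t).2 x).re : ℂ)) = ev L (u t).2 :=
      fun t ht => funext fun x => (hre t ht x).symm
    refine ⟨fun t ht => (congrArg MemH1 (h2 t ht)).mpr (h1.1 t ht), fun t ht => (h1.2 t ht).congr' ?_⟩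
    filter_upwards [self_mem_nhdsWithin] with s hs
    rw [h2 t ht, h2 s hs]
  · have ht' : (0 : ℝ) ≤ t := ht
    have h1 := (duhamel_iff (a := fun t => freeFlow L t (u t).1) (a₀ := a₀)
      (G := fun t => force L c (freeFlow L t (u t).1) (u t).2) ht'
      (continuousOn_force c (hw t) (hd t))).1
      ⟨by simp [(hu 0).init], fun s hs => by
        simp only [freeFlow_neg_freeFlow]
        exact gp_deriv_fst (hu t) s hs⟩ t (right_mem_Icc.2 ht') x
    rw [h1]
    congr 1
    refine intervalIntegral.integral_congr fun s hs => ?_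
    rw [uIcc_of_le ht'] at hs
    simp only [waveForcing_eq_force c _ _ (hre s hs.1)]
  · have ht' : (0 : ℝ) ≤ t := ht
    exact (density_duhamel_iff ht' (hw t) (hd t) (fun s hs => hre s hs.1) hm₀).1
      ⟨by simp [(hu 0).init], fun s hs => gp_deriv_snd (hu t) s hs⟩ t (right_mem_Icc.2 ht') x

theorem IsGPSolution.exists_trajectory {T : ℝ} (hT : 0 ≤ T) (hm₀ : ∀ x, ev L m₀ x = n₀ x)
    {χ : ℝ → AddCircle L → ℂ} {n : ℝ → AddCircle L → ℝ}
    (h : IsGPSolution c ε (ev L a₀ : AddCircle L → ℂ) n₀ (Ici 0) χ n) :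
    ∃ u, IsTrajectory (gpField L c ε) (a₀, m₀) T u ∧ ∀ t ∈ Icc 0 T,
      χ t = ev L (freeFlow L t (u t).1) ∧ ∀ x, n t x = (ev L (u t).2 x).re := by
  have hsub : Icc 0 T ⊆ Ici 0 := Icc_subset_Ici_self
  obtain ⟨a, hac, ha⟩ := (h.wave_continuous.mono hsub).exists_curve
  obtain ⟨m, hmc, hm⟩ := (h.density_continuous.mono hsub).exists_curve
  have hm' : ∀ t ∈ Icc 0 T, ∀ x, ev L (m t) x = n t x := fun t ht x => (congrFun (hm t ht) x).symm
  have h1 := (duhamel_iff (a := a) (a₀ := a₀) (G := fun t => force L c (a t) (m t)) hT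
    (continuousOn_force c hac hmc)).2 fun t ht x => by
      rw [← ha t ht, h.wave_duhamel t (hsub ht) x]
      congr 1
      refine intervalIntegral.integral_congr fun s hs => ?_
      rw [uIcc_of_le ht.1] at hs
      have hs' : s ∈ Icc 0 T := ⟨hs.1, hs.2.trans ht.2⟩
      simp only [ha s hs', waveForcing_eq_force c _ _ (hm' s hs')]
  have h2 := (density_duhamel_iff (c := c) (ε := ε) hT hac hmc hm' hm₀).2 fun t ht x => by
    rw [h.density_duhamel t (hsub ht) x]
    congr 1
    refine intervalIntegral.integral_congr fun s hs => ?_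
    rw [uIcc_of_le ht.1] at hs
    simp only [ha s ⟨hs.1, hs.2.trans ht.2⟩]
  refine ⟨fun t => (freeFlow L (-t) (a t), m t), ⟨Prod.ext h1.1 h2.1, fun t ht => ?_⟩,
    fun t ht => ⟨?_, fun x => ?_⟩⟩
  · simp only [gpField, freeFlow_freeFlow_neg]
    exact (h1.2 t ht).prodMk (h2.2 t ht)
  · rw [freeFlow_freeFlow_neg, ha t ht]
  · rw [hm' t ht, Complex.ofReal_re]

end GP

end

section

variable {L : ℝ} [hL : Fact (0 < L)]

/-! ### Comparison with the reservoir driven by the limit -/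

theorem waveForcing_eq (c : Constants) (z : ℂ) (r : ℝ) :
    waveForcing c z r = -Complex.I * c.g * ((‖z‖ ^ 2 : ℝ) * z) +
      (coupling c * r - (c.α / 2 : ℝ)) * z := by
  simp only [waveForcing, coupling]
  push_cast
  ring

theorem norm_waveForcing_sub_le (c : Constants) {M N : ℝ} {z w : ℂ} (hz : ‖z‖ ≤ M) (hw : ‖w‖ ≤ M)
    {r p : ℝ} (hr0 : 0 ≤ r) (hr : r ≤ N) :
    ‖waveForcing c z r - waveForcing c w p‖ ≤
      (3 * c.g * M ^ 2 + (‖coupling c‖ * N + c.α / 2)) * ‖z - w‖ + ‖coupling c‖ * M * |r - p| := by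
  have hg := c.g_pos
  have hα := c.α_pos
  have hM : 0 ≤ M := (norm_nonneg z).trans hz
  have e : waveForcing c z r - waveForcing c w p =
      -Complex.I * c.g * ((‖z‖ ^ 2 : ℝ) * (z - w) + ((‖z‖ ^ 2 - ‖w‖ ^ 2 : ℝ) : ℂ) * w) +
        (coupling c * r - (c.α / 2 : ℝ)) * (z - w) + coupling c * (r - p : ℝ) * w := by
    rw [waveForcing_eq, waveForcing_eq]; push_cast; ring
  have h1 : ‖-Complex.I * c.g * ((‖z‖ ^ 2 : ℝ) * (z - w) + ((‖z‖ ^ 2 - ‖w‖ ^ 2 : ℝ) : ℂ) * w)‖ ≤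
      3 * c.g * M ^ 2 * ‖z - w‖ := by
    rw [norm_mul, norm_mul, norm_neg, Complex.norm_I, one_mul, Complex.norm_real,
      Real.norm_of_nonneg hg.le]
    have h2 : ‖((‖z‖ ^ 2 : ℝ) : ℂ) * (z - w)‖ ≤ M ^ 2 * ‖z - w‖ := by
      rw [norm_mul, Complex.norm_real, Real.norm_of_nonneg (by positivity)]
      gcongr
    have h3 : ‖((‖z‖ ^ 2 - ‖w‖ ^ 2 : ℝ) : ℂ) * w‖ ≤ 2 * M * ‖z - w‖ * M := by
      rw [norm_mul, Complex.norm_real, Real.norm_eq_abs]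
      have : (‖z‖ + ‖w‖) * ‖z - w‖ ≤ 2 * M * ‖z - w‖ := by gcongr; linarith
      have := (abs_norm_sq_sub_le z w).trans this
      gcongr
    have h4 := norm_add_le (((‖z‖ ^ 2 : ℝ) : ℂ) * (z - w)) (((‖z‖ ^ 2 - ‖w‖ ^ 2 : ℝ) : ℂ) * w)
    calc _ ≤ c.g * (M ^ 2 * ‖z - w‖ + 2 * M * ‖z - w‖ * M) := by gcongr; linarith
      _ = _ := by ring
  have h2 : ‖(coupling c * r - (c.α / 2 : ℝ)) * (z - w)‖ ≤
      (‖coupling c‖ * N + c.α / 2) * ‖z - w‖ := by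
    rw [norm_mul]
    gcongr
    refine (norm_sub_le _ _).trans ?_
    rw [norm_mul, Complex.norm_real, Complex.norm_real, Real.norm_of_nonneg hr0,
      Real.norm_of_nonneg (by positivity)]
    gcongr
  have h3 : ‖coupling c * (r - p : ℝ) * w‖ ≤ ‖coupling c‖ * M * |r - p| := by
    rw [norm_mul, norm_mul, Complex.norm_real, Real.norm_eq_abs, mul_right_comm]
    gcongr
  rw [e, add_mul]
  exact (norm_add₃_le).trans (by linarith)

/-- The comparison of two states, at a point. Here `q` is the density of the auxiliary reservoir
and `p` the adiabatic one; the term `(r - q)²` is absorbed by the decay rate `β`. -/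
theorem exists_comparison_le (c : Constants) {M N : ℝ} (hM : 0 ≤ M) (hN : 0 ≤ N) :
    ∃ K : ℝ, 0 ≤ K ∧ ∀ z w : ℂ, ‖z‖ ≤ M → ‖w‖ ≤ M → ∀ r q p : ℝ, 0 ≤ r → r ≤ N → 0 ≤ q → q ≤ N →
      2 * ((starRingEnd ℂ) (z - w) * (waveForcing c z r - waveForcing c w p)).re +
        2 * ((r - q) * ((c.P - (c.β + c.R * ‖z‖ ^ 2) * r) - (c.P - (c.β + c.R * ‖w‖ ^ 2) * q))) ≤
      K * ‖z - w‖ ^ 2 + (q - p) ^ 2 := by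
  have hg := c.g_pos
  have hα := c.α_pos
  have hβ := c.β_pos
  have hR := c.R_pos
  set C₁ := 3 * c.g * M ^ 2 + (‖coupling c‖ * N + c.α / 2) with hC₁
  set C₂ := ‖coupling c‖ * M with hC₂
  set e := C₂ + 2 * c.R * M * N with he
  have hC₁0 : 0 ≤ C₁ := by positivity
  have hC₂0 : 0 ≤ C₂ := by positivity
  refine ⟨2 * C₁ + C₂ ^ 2 + e ^ 2 / (2 * c.β), by positivity,
    fun z w hz hw r q p hr0 hr hq0 hq => ?_⟩
  set d := ‖z - w‖ with hd
  set s := |r - q| with hs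
  have hd0 : 0 ≤ d := norm_nonneg _
  have hs0 : 0 ≤ s := abs_nonneg _
  have h1 : ((starRingEnd ℂ) (z - w) * (waveForcing c z r - waveForcing c w p)).re ≤
      d * (C₁ * d + C₂ * (s + |q - p|)) := by
    refine (re_conj_mul_le _ _).trans ?_
    gcongr
    refine (norm_waveForcing_sub_le c hz hw hr0 hr).trans ?_
    gcongr
    exact abs_sub_le r q p
  have h2 : (r - q) * ((c.P - (c.β + c.R * ‖z‖ ^ 2) * r) - (c.P - (c.β + c.R * ‖w‖ ^ 2) * q)) ≤
      -c.β * s ^ 2 + 2 * c.R * M * N * (s * d) := by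
    have e1 : (r - q) * ((c.P - (c.β + c.R * ‖z‖ ^ 2) * r) - (c.P - (c.β + c.R * ‖w‖ ^ 2) * q)) =
        -(c.β + c.R * ‖z‖ ^ 2) * (r - q) ^ 2 + -(c.R * q * ((r - q) * (‖z‖ ^ 2 - ‖w‖ ^ 2))) := by
      ring
    rw [e1]
    refine add_le_add ?_ ?_
    · rw [hs, sq_abs]
      have : 0 ≤ c.R * ‖z‖ ^ 2 * (r - q) ^ 2 := by positivity
      linarith
    · refine (neg_le_abs _).trans ?_
      rw [abs_mul, abs_mul (r - q), abs_of_nonneg (by positivity : 0 ≤ c.R * q)]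
      have h3 : (‖z‖ + ‖w‖) * d ≤ 2 * M * d := by gcongr; linarith
      have h4 := (abs_norm_sq_sub_le z w).trans h3
      calc c.R * q * (|r - q| * |‖z‖ ^ 2 - ‖w‖ ^ 2|) ≤ c.R * N * (s * (2 * M * d)) := by gcongr
        _ = _ := by ring
  have h3 : 2 * e * s * d - 2 * c.β * s ^ 2 ≤ e ^ 2 / (2 * c.β) * d ^ 2 := by
    have e2 : e ^ 2 / (2 * c.β) * d ^ 2 - (2 * e * s * d - 2 * c.β * s ^ 2) =
        (2 * c.β * s - e * d) ^ 2 / (2 * c.β) := by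
      field_simp; ring
    have : 0 ≤ (2 * c.β * s - e * d) ^ 2 / (2 * c.β) := by positivity
    linarith
  have h4 : 2 * (C₂ * d) * |q - p| ≤ (C₂ * d) ^ 2 + (q - p) ^ 2 := by
    rw [← sq_abs (q - p)]; exact two_mul_le_add_sq _ _
  have h5 : 2 * e * s * d = 2 * C₂ * s * d + 4 * c.R * M * N * s * d := by rw [he]; ring
  nlinarith

theorem inner_comparison_le (c : Constants) {K : ℝ} {ψ χ m μ ν : Coeff}
    (h : ∀ x, 2 * ((starRingEnd ℂ) (ev L ψ x - ev L χ x) *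
        (ev L (force L c ψ m) x - ev L (force L c χ ν) x)).re +
      2 * ((starRingEnd ℂ) (ev L m x - ev L μ x) *
        (ev L (production L c ψ m) x - ev L (production L c χ μ) x)).re ≤
      K * ‖ev L ψ x - ev L χ x‖ ^ 2 + ‖ev L μ x - ev L ν x‖ ^ 2) :
    2 * (inner ℂ (toL2 L (ψ - χ)) (toL2 L (force L c ψ m - force L c χ ν)) : ℂ).re +
      2 * (inner ℂ (toL2 L (m - μ)) (toL2 L (production L c ψ m - production L c χ μ)) : ℂ).re ≤
      K * ‖toL2 L (ψ - χ)‖ ^ 2 + ‖toL2 L (μ - ν)‖ ^ 2 := by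
  rw [inner_toL2, inner_toL2, norm_toL2_sq, norm_toL2_sq, re_integral (by fun_prop),
    re_integral (by fun_prop), ← integral_const_mul, ← integral_const_mul, ← integral_const_mul,
    ← integral_add (integrable_of_continuous (by fun_prop))
      (integrable_of_continuous (by fun_prop)),
    ← integral_add (integrable_of_continuous (by fun_prop))
      (integrable_of_continuous (by fun_prop))]
  refine integral_mono (integrable_of_continuous (by fun_prop))
    (integrable_of_continuous (by fun_prop)) fun x => ?_
  simpa only [map_sub, ContinuousMap.sub_apply] using h x

variable (L) in
/-- The reservoir driven by a prescribed wave function `ψ`. -/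
def reservoirField (c : Constants) (ε : ℝ) (ψ : ℝ → Coeff) (t : ℝ) (m : Coeff) : Coeff :=
  ((ε⁻¹ : ℝ) : ℂ) • production L c (ψ t) m

theorem norm_rate_le (c : Constants) (M : ℝ) :
    ∃ B : ℝ, 0 ≤ B ∧ ∀ a : Coeff, ‖a‖ ≤ M → ‖rate L c a‖ ≤ B :=
  (lipOnBalls_id.rate c).bounded M

theorem locallyLipField_reservoirField (c : Constants) (ε : ℝ) {ψ : ℝ → Coeff}
    (hψ : ContinuousOn ψ (Ici 0)) :
    LocallyLipField (reservoirField L c ε ψ) where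
  cont m := continuousOn_comp₂ (f := fun p => ((ε⁻¹ : ℝ) : ℂ) • production L c p.1 p.2)
    ((lipOnBalls_production c).smul _).continuous hψ continuousOn_const
  lip T M := by
    obtain ⟨B, hB⟩ := isCompact_Icc.exists_bound_of_continuousOn
      (hψ.mono (Icc_subset_Ici_self : Icc 0 T ⊆ Ici 0))
    obtain ⟨K, hK, h⟩ := (lipOnBalls_production (L := L) c).smul ((ε⁻¹ : ℝ) : ℂ) (max B M)
    refine ⟨K, hK, fun t ht x y hx hy => ?_⟩
    have h1 : ∀ z : Coeff, ‖z‖ ≤ M → ‖((ψ t, z) : Coeff × Coeff)‖ ≤ max B M := fun z hz =>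
      max_le_max (hB t ht) hz
    refine (h _ _ (h1 x hx) (h1 y hy)).trans_eq ?_
    rw [Prod.mk_sub_mk, sub_self, Prod.norm_def]
    simp

theorem reservoir_exists_global (c : Constants) (ε : ℝ) {ψ : ℝ → Coeff}
    (hψ : ContinuousOn ψ (Ici 0)) (m₀ : Coeff) :
    ∃ m, ∀ T, IsTrajectory (reservoirField L c ε ψ) m₀ T m := by
  refine exists_global_trajectory (locallyLipField_reservoirField c ε hψ) _ fun T hT => ?_
  obtain ⟨M, hM⟩ := isCompact_Icc.exists_bound_of_continuousOn
      (hψ.mono (Icc_subset_Ici_self : Icc 0 T ⊆ Ici 0))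
  obtain ⟨B, hB0, hB⟩ := norm_rate_le (L := L) c M
  set A := |ε⁻¹| * (c.P * ‖one L‖) with hA
  set K := |ε⁻¹| * (algConst L * B) with hK
  have hP := c.P_pos
  have hc := algConst_nonneg (L := L)
  have hA0 : 0 ≤ A := by positivity
  have hK0 : 0 ≤ K := by positivity
  refine ⟨√(Real.exp ((2 * K + 1) * T) * (‖m₀‖ ^ 2 + A ^ 2 * T)), fun t ht m hm =>
    Real.le_sqrt_of_sq_le ?_⟩
  have h := le_exp_mul_of_deriv_le (K := 2 * K + 1) (by positivity)
    (fun s hs => hasDerivWithinAt_norm_sq (hm.deriv s hs)) (r := fun _ => A ^ 2)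
    continuousOn_const (fun _ _ => by positivity) (fun s hs => by
      have h1 : ‖reservoirField L c ε ψ s (m s)‖ ≤ A + K * ‖m s‖ := by
        rw [reservoirField, norm_smul, Complex.norm_real, Real.norm_eq_abs, production]
        have h2 := norm_sub_le ((c.P : ℂ) • one L) (mul L (rate L c (ψ s)) (m s))
        rw [norm_smul, Complex.norm_real, Real.norm_of_nonneg hP.le] at h2
        have h3 : ‖mul L (rate L c (ψ s)) (m s)‖ ≤ algConst L * B * ‖m s‖ := by
          refine (norm_mul_le' _ _).trans ?_
          rw [mul_assoc]
          gcongr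
          exact hB _ (hM s ⟨hs.1, hs.2.trans ht.2⟩)
        calc _ ≤ |ε⁻¹| * (c.P * ‖one L‖ + algConst L * B * ‖m s‖) := by gcongr; linarith
          _ = _ := by rw [hA, hK]; ring
      have h2 : (inner ℂ (m s) (reservoirField L c ε ψ s (m s)) : ℂ).re ≤
          ‖m s‖ * (A + K * ‖m s‖) :=
        ((Complex.re_le_norm _).trans (norm_inner_le_norm _ _)).trans (by gcongr)
      nlinarith [sq_nonneg (‖m s‖ - A)]) t (right_mem_Icc.2 ht.1)
  rw [hm.init] at h
  simp only [intervalIntegral.integral_const, sub_zero, smul_eq_mul] at h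
  refine h.trans ?_
  rw [mul_comm t]
  have ht0 := ht.1
  gcongr
  all_goals exact ht.2

section Comparison

variable {c : Constants} {ε T N M K : ℝ} {a₀ m₀ : Coeff} {u : ℝ → Coeff × Coeff} {v μ : ℝ → Coeff}

/-- The `L²` distance of the wave functions is controlled by the distance of the auxiliary reservoir
from its adiabatic state. Gronwall's inequality is applied to `‖ψᵋ - ψ‖² + ε‖nᵋ - μ‖²`, which
vanishes initially; a direct comparison of `nᵋ` with the adiabatic density would involve the time
derivative of the latter, which is not a function. -/
theorem comparison_norm_sq_le (hε : 0 < ε) (hN : c.P / c.β ≤ N) (h0 : IsDensity L N m₀)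
    (hu : IsTrajectory (gpField L c ε) (a₀, m₀) T u) (hv : IsTrajectory (adiabaticField L c) a₀ T v)
    (hμ : IsTrajectory (reservoirField L c ε fun t => freeFlow L t (v t)) m₀ T μ)
    (hMu : ∀ t ∈ Icc 0 T, ∀ x, ‖ev L (freeFlow L t (u t).1) x‖ ≤ M)
    (hMv : ∀ t ∈ Icc 0 T, ∀ x, ‖ev L (freeFlow L t (v t)) x‖ ≤ M) (hK0 : 0 ≤ K)
    (hK : ∀ z w : ℂ, ‖z‖ ≤ M → ‖w‖ ≤ M → ∀ r q p : ℝ, 0 ≤ r → r ≤ N → 0 ≤ q → q ≤ N →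
      2 * ((starRingEnd ℂ) (z - w) * (waveForcing c z r - waveForcing c w p)).re +
        2 * ((r - q) * ((c.P - (c.β + c.R * ‖z‖ ^ 2) * r) - (c.P - (c.β + c.R * ‖w‖ ^ 2) * q))) ≤
      K * ‖z - w‖ ^ 2 + (q - p) ^ 2) :
    ∀ t ∈ Icc 0 T, ‖toL2 L (freeFlow L t (u t).1 - freeFlow L t (v t))‖ ^ 2 ≤ Real.exp (K * t) *
      ∫ s in 0..t, ‖toL2 L (μ s - dens L c (freeFlow L s (v s)))‖ ^ 2 := by
  intro t ht
  have hvc : ContinuousOn (fun t => freeFlow L t (v t)) (Icc 0 T) :=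
    continuousOn_wave hv.continuousOn
  have hum := gp_isDensity hε hN h0 hu
  have hμm := IsDensity.evolve (L := L) hε hvc hμ.deriv hN (by rw [hμ.init]; exact h0)
  have hr : ContinuousOn (fun s => ‖toL2 L (μ s - dens L c (freeFlow L s (v s)))‖ ^ 2)
      (Icc 0 T) := by
    have h1 : ContinuousOn (fun s => dens L c (freeFlow L s (v s))) (Icc 0 T) :=
      (lipOnBalls_dens c).continuous.comp_continuousOn hvc
    exact ((toL2 L).continuous.comp_continuousOn (hμ.continuousOn.sub h1)).norm.pow 2
  have hd : ∀ t ∈ Icc 0 T, HasDerivWithinAt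
      (fun t => ‖toL2 L ((u t).1 - v t)‖ ^ 2 + ε * ‖toL2 L ((u t).2 - μ t)‖ ^ 2)
      (2 * (inner ℂ (toL2 L (freeFlow L t (u t).1 - freeFlow L t (v t)))
          (toL2 L (force L c (freeFlow L t (u t).1) (u t).2 -
            force L c (freeFlow L t (v t)) (dens L c (freeFlow L t (v t))))) : ℂ).re +
        2 * (inner ℂ (toL2 L ((u t).2 - μ t)) (toL2 L
          (production L c (freeFlow L t (u t).1) (u t).2 -
            production L c (freeFlow L t (v t)) (μ t))) : ℂ).re) (Icc 0 T) t := fun t ht => by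
    have hlin : ∀ {p : ℝ → Coeff} {p' : Coeff}, HasDerivWithinAt p p' (Icc 0 T) t →
        HasDerivWithinAt (fun t => toL2 L (p t)) (toL2 L p') (Icc 0 T) t := fun h =>
      ((toL2 L).restrictScalars ℝ).hasFDerivAt.comp_hasDerivWithinAt t h
    have h1 := hasDerivWithinAt_norm_sq (hlin ((gp_deriv_fst hu t ht).sub (hv.deriv t ht)))
    have h2 := (hasDerivWithinAt_norm_sq
      (hlin ((gp_deriv_snd hu t ht).sub (hμ.deriv t ht)))).const_mul ε
    refine (h1.add h2).congr_deriv ?_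
    congr 1
    · rw [← map_sub (freeFlow L t), toL2_freeFlow, adiabaticField, ← map_sub (freeFlow L (-t)),
        toL2_freeFlow, inner_freeFlow_right, neg_neg]
      rfl
    · rw [reservoirField, ← smul_sub, map_smul, inner_smul_right, Complex.re_ofReal_mul]
      simp only [Pi.sub_apply]
      field_simp
  have h := le_exp_mul_of_deriv_le hK0 hd hr (fun _ _ => by positivity) (fun t ht => by
    refine (inner_comparison_le c fun x => ?_).trans (b := K *
      ‖toL2 L (freeFlow L t (u t).1 - freeFlow L t (v t))‖ ^ 2 +
        ‖toL2 L (μ t - dens L c (freeFlow L t (v t)))‖ ^ 2) ?_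
    · obtain ⟨r, hr, hr0, hrN⟩ := hum t ht x
      obtain ⟨q, hq, hq0, hqN⟩ := hμm t ht x
      have h1 := hK _ _ (hMu t ht x) (hMv t ht x) r q
        (adiabaticDensity c (ev L (freeFlow L t (v t)) x)) hr0 hrN hq0 hqN
      rw [ev_force c _ _ x hr, ev_force c _ _ x (ev_dens c _ x), ev_production, ev_production, hr,
        hq, ev_dens]
      simp only [← Complex.ofReal_mul, ← Complex.ofReal_sub, Complex.conj_ofReal, Complex.ofReal_re,
        Complex.norm_real, Real.norm_eq_abs, sq_abs]
      exact h1
    · rw [← map_sub, toL2_freeFlow, norm_freeFlow]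
      have : 0 ≤ K * (ε * ‖toL2 L ((u t).2 - μ t)‖ ^ 2) := by positivity
      linarith) t ht
  simp only [hu.init, hv.init, hμ.init, sub_self, map_zero, norm_zero] at h
  rw [← map_sub, toL2_freeFlow, norm_freeFlow]
  have : 0 ≤ ε * ‖toL2 L ((u t).2 - μ t)‖ ^ 2 := by positivity
  simp only [ne_eq, OfNat.ofNat_ne_zero, not_false_eq_true, zero_pow, mul_zero, zero_add] at h
  linarith

end Comparison

end

section

variable {L : ℝ} [hL : Fact (0 < L)]

/-! ### The adiabatic limit -/

/-- The auxiliary reservoir, driven by the limiting wave function, relaxes to its adiabatic state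
in `L²` of space-time. -/
theorem tendsto_integral_relaxation {c : Constants} {N T : ℝ} {e : ℕ → ℝ} {ψ : ℝ → Coeff}
    {μ : ℕ → ℝ → Coeff} {m₀ : Coeff} (he : ∀ k, 0 < e k) (he0 : Tendsto e atTop (𝓝 0))
    (hN : c.P / c.β ≤ N) (h0 : IsDensity L N m₀) (hT : 0 ≤ T) (hψ : ContinuousOn ψ (Icc 0 T))
    (hμ : ∀ k, IsTrajectory (reservoirField L c (e k) ψ) m₀ T (μ k)) :
    Tendsto (fun k => ∫ s in 0..T, ‖toL2 L (μ k s - dens L c (ψ s))‖ ^ 2) atTop (𝓝 0) := by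
  have hβ := c.β_pos
  have hR := c.R_pos
  have hdens := fun k => IsDensity.evolve (L := L) (he k) hψ (hμ k).deriv hN
    (by rw [(hμ k).init]; exact h0)
  have hbound : ∀ k, ∀ s ∈ Icc 0 T, ∀ x,
      ‖ev L (μ k s - dens L c (ψ s)) x‖ ≤ N := fun k s hs x => by
    obtain ⟨r, hr, hr0, hrN⟩ := hdens k s hs x
    have h1 := adiabaticDensity_pos c (ev L (ψ s) x)
    have h2 := (adiabaticDensity_le c (ev L (ψ s) x)).trans hN
    rw [map_sub, ContinuousMap.sub_apply, hr, ev_dens, ← Complex.ofReal_sub, Complex.norm_real,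
      Real.norm_eq_abs, abs_le]
    constructor <;> linarith
  have hpt : ∀ s ∈ Ioc 0 T, ∀ x,
      Tendsto (fun k => ev L (μ k s - dens L c (ψ s)) x) atTop (𝓝 0) := fun s hs x => by
    have hsub : Icc 0 s ⊆ Icc 0 T := Icc_subset_Icc_right hs.2
    have hs' : s ∈ Icc 0 T := ⟨hs.1.le, hs.2⟩
    have hre : ∀ k, ∀ τ ∈ Icc 0 T, ev L (μ k τ) x = ((ev L (μ k τ) x).re : ℂ) ∧
        0 ≤ (ev L (μ k τ) x).re ∧ (ev L (μ k τ) x).re ≤ N := fun k τ hτ => by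
      obtain ⟨r, hr, h⟩ := hdens k τ hτ x
      rw [hr, Complex.ofReal_re]
      exact ⟨rfl, h⟩
    have h1 := tendsto_relaxation (N := N) (e := e) (y := fun k τ => (ev L (μ k τ) x).re)
      (b := fun _ τ => c.β + c.R * ‖ev L (ψ τ) x‖ ^ 2) (b₀ := c.β + c.R * ‖ev L (ψ s) x‖ ^ 2)
      c.P_pos (by positivity) hs.1 he he0
      (fun k τ hτ => (hasDerivWithinAt_re_density ((hμ k).deriv τ (hsub hτ)) x).mono hsub)
      (fun k τ hτ => (hre k τ (hsub hτ)).2.1) (fun k τ hτ => (hre k τ (hsub hτ)).2.2)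
      (fun η hη => by
        have hc : ContinuousOn (fun τ => c.β + c.R * ‖ev L (ψ τ) x‖ ^ 2) (Icc 0 T) := by
          have := continuousOn_ev_apply (L := L) hψ x
          fun_prop
        obtain ⟨δ, hδ, h⟩ := Metric.continuousOn_iff.1 hc s hs' η hη
        refine ⟨δ / 2, by positivity, Eventually.of_forall fun k τ hτ hτ' => ?_⟩
        refine (h τ (hsub hτ) ?_).le
        rw [Real.dist_eq, abs_lt]
        constructor <;> linarith [hτ.2])
    have h2 := ((Complex.continuous_ofReal.tendsto _).comp h1).sub_const
      ((adiabaticDensity c (ev L (ψ s) x) : ℝ) : ℂ)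
    rw [adiabaticDensity, sub_self] at h2
    refine h2.congr fun k => ?_
    rw [map_sub, ContinuousMap.sub_apply, ev_dens, (hre k s hs').1]
    rfl
  have hint : ∀ s ∈ Ioc 0 T,
      Tendsto (fun k => ‖toL2 L (μ k s - dens L c (ψ s))‖ ^ 2) atTop (𝓝 0) := fun s hs => by
    simp only [norm_toL2_sq]
    rw [show (0 : ℝ) = ∫ _ : AddCircle L, (0 : ℝ) ∂AddCircle.haarAddCircle by simp]
    refine tendsto_integral_of_dominated_convergence (fun _ => N ^ 2)
      (fun k => (integrable_of_continuous (by fun_prop)).aestronglyMeasurable)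
      (integrable_const _) (fun k => Eventually.of_forall fun x => ?_)
      (Eventually.of_forall fun x => ?_)
    · rw [Real.norm_of_nonneg (by positivity)]
      have := hbound k s ⟨hs.1.le, hs.2⟩ x
      gcongr
    · simpa using (hpt s hs x).norm.pow 2
  have hle : ∀ k, ∀ s ∈ Icc 0 T, ‖toL2 L (μ k s - dens L c (ψ s))‖ ^ 2 ≤ N ^ 2 :=
    fun k s hs => by
      rw [norm_toL2_sq]
      calc _ ≤ ∫ _ : AddCircle L, N ^ 2 ∂AddCircle.haarAddCircle :=
            integral_mono (integrable_of_continuous (by fun_prop)) (integrable_const _) fun x => by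
              have := hbound k s hs x
              simp only
              gcongr
        _ = _ := by simp
  have hmeas : ∀ k, ContinuousOn (fun s => ‖toL2 L (μ k s - dens L c (ψ s))‖ ^ 2) (Icc 0 T) :=
    fun k => by
      have h1 : ContinuousOn (fun s => dens L c (ψ s)) (Icc 0 T) :=
        (lipOnBalls_dens c).continuous.comp_continuousOn hψ
      exact ((toL2 L).continuous.comp_continuousOn ((hμ k).continuousOn.sub h1)).norm.pow 2
  suffices h : Tendsto (fun k => ∫ s in 0..T, ‖toL2 L (μ k s - dens L c (ψ s))‖ ^ 2) atTop
      (𝓝 (∫ _ in 0..T, (0 : ℝ))) by simpa using h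
  refine intervalIntegral.tendsto_integral_filter_of_dominated_convergence (fun _ => N ^ 2)
    (Eventually.of_forall fun k => ?_) (Eventually.of_forall fun k => ?_)
    ?_ (Eventually.of_forall fun s hs => ?_)
  · rw [uIoc_of_le hT]
    exact ((hmeas k).mono Ioc_subset_Icc_self).aestronglyMeasurable measurableSet_Ioc
  · refine Eventually.of_forall fun s hs => ?_
    rw [uIoc_of_le hT] at hs
    rw [Real.norm_of_nonneg (by positivity)]
    exact hle k s (Ioc_subset_Icc_self hs)
  · exact intervalIntegrable_const
  · rw [uIoc_of_le hT] at hs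
    exact hint s hs

section Limit

variable {c : Constants} {T N : ℝ} {a₀ m₀ : Coeff} {e : ℕ → ℝ} {u : ℕ → ℝ → Coeff × Coeff}
  {v : ℝ → Coeff}

/-- The `H¹` norms of the wave functions are bounded uniformly in `k`, as `e` is bounded. -/
theorem gp_uniform_bound (he : ∀ k, 0 < e k) (he0 : Tendsto e atTop (𝓝 0)) (hN : c.P / c.β ≤ N)
    (h0 : IsDensity L N m₀) (hu : ∀ k, IsTrajectory (gpField L c (e k)) (a₀, m₀) T (u k)) :
    ∃ B : ℝ, 0 ≤ B ∧ ∀ k, ∀ t ∈ Icc 0 T, ‖(u k t).1‖ ≤ B := by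
  obtain ⟨E, hE⟩ := he0.bddAbove_range
  have hE' : ∀ k, e k ≤ E := fun k => hE ⟨k, rfl⟩
  have hR := c.R_pos
  have hP := c.P_pos
  have hg := c.g_pos
  have hN0 : 0 ≤ N := (div_pos hP c.β_pos).le.trans hN
  have hC : 0 ≤ growthRate c N := (by positivity : 0 ≤ c.R * N).trans (growthRate_ge c)
  have hQ : 0 ≤ quartic L a₀ := sq_nonneg _
  refine ⟨√(Real.exp ((growthRate c N + 2 * c.R * N) * T) *
    (‖a₀‖ ^ 2 + c.g * quartic L a₀ + E * ‖m₀‖ ^ 2 + 2 * N * c.P * T)), Real.sqrt_nonneg _,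
    fun k t ht => Real.le_sqrt_of_sq_le ?_⟩
  have h1 := gp_energy_le (he k) hN h0 (hu k) t ht
  have h2 : 0 ≤ e k * ‖(u k t).2‖ ^ 2 := mul_nonneg (he k).le (sq_nonneg _)
  have h3 : Real.exp ((growthRate c N + 2 * c.R * N) * t) *
      (‖a₀‖ ^ 2 + c.g * quartic L a₀ + e k * ‖m₀‖ ^ 2 + 2 * N * c.P * t) ≤
      Real.exp ((growthRate c N + 2 * c.R * N) * T) *
      (‖a₀‖ ^ 2 + c.g * quartic L a₀ + E * ‖m₀‖ ^ 2 + 2 * N * c.P * T) := by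
    have ht0 := ht.1
    have := (he k).le
    gcongr
    · exact ht.2
    · exact hE' k
    · exact ht.2
  linarith

/-- Convergence of the wave functions, uniformly in space-time: the `L²` norms of the differences
tend to zero, and the `H¹` norms are bounded. -/
theorem tendsto_wave (he : ∀ k, 0 < e k) (he0 : Tendsto e atTop (𝓝 0)) (hN : c.P / c.β ≤ N)
    (h0 : IsDensity L N m₀) (hT : 0 ≤ T)
    (hu : ∀ k, IsTrajectory (gpField L c (e k)) (a₀, m₀) T (u k))
    (hv : ∀ T, IsTrajectory (adiabaticField L c) a₀ T v) :
    ∀ η > 0, ∀ᶠ k in atTop, ∀ t ∈ Icc 0 T, ∀ x,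
      ‖ev L (freeFlow L t (u k t).1) x - ev L (freeFlow L t (v t)) x‖ ≤ η := by
  intro η hη
  obtain ⟨B, hB0, hB⟩ := gp_uniform_bound he he0 hN h0 hu
  obtain ⟨B', hB'⟩ := isCompact_Icc.exists_bound_of_continuousOn (hv T).continuousOn
  have hN0 : 0 ≤ N := (div_pos c.P_pos c.β_pos).le.trans hN
  have hB'0 : 0 ≤ B' := (norm_nonneg _).trans (hB' 0 (left_mem_Icc.2 hT))
  have hψ : ContinuousOn (fun t => freeFlow L t (v t)) (Icc 0 T) :=
    continuousOn_wave (hv T).continuousOn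
  have hψ' : ContinuousOn (fun t => freeFlow L t (v t)) (Ici 0) :=
    continuousOn_wave (continuousOn_Ici_of_Icc fun T => (hv T).continuousOn)
  choose μ hμ using fun k => reservoir_exists_global (L := L) c (e k) hψ' m₀
  have hsup : ∀ (a : Coeff) t x, ‖a‖ ≤ max B B' →
      ‖ev L (freeFlow L t a) x‖ ≤ ‖sobolevSeq L‖ * max B B' := fun a t x ha => by
    refine (norm_ev_apply_le L _ x).trans ?_
    rw [norm_freeFlow]
    gcongr
  obtain ⟨K, hK0, hK⟩ := exists_comparison_le c (M := ‖sobolevSeq L‖ * max B B') (by positivity) hN0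
  have hcomp : ∀ k, ∀ t ∈ Icc 0 T, ‖toL2 L (freeFlow L t (u k t).1 - freeFlow L t (v t))‖ ^ 2 ≤
      Real.exp (K * T) *
        ∫ s in 0..T, ‖toL2 L (μ k s - dens L c (freeFlow L s (v s)))‖ ^ 2 := fun k t ht => by
    have h1 := comparison_norm_sq_le (he k) hN h0 (hu k) (hv T) (hμ k T)
      (fun t ht x => hsup _ t x ((hB k t ht).trans (le_max_left _ _)))
      (fun t ht x => hsup _ t x ((hB' t ht).trans (le_max_right _ _))) hK0 hK t ht
    refine h1.trans ?_
    have hr : ContinuousOn (fun s => ‖toL2 L (μ k s - dens L c (freeFlow L s (v s)))‖ ^ 2)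
        (Icc 0 T) := by
      have h1 : ContinuousOn (fun s => dens L c (freeFlow L s (v s))) (Icc 0 T) :=
        (lipOnBalls_dens c).continuous.comp_continuousOn hψ
      exact ((toL2 L).continuous.comp_continuousOn ((hμ k T).continuousOn.sub h1)).norm.pow 2
    have h2 : 0 ≤ ∫ s in 0..t, ‖toL2 L (μ k s - dens L c (freeFlow L s (v s)))‖ ^ 2 :=
      intervalIntegral.integral_nonneg ht.1 fun _ _ => by positivity
    gcongr
    · exact ht.2
    · exact intervalIntegral.integral_mono_interval le_rfl ht.1 ht.2
        (Eventually.of_forall fun _ => by positivity) (hr.intervalIntegrable_of_Icc hT)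
  obtain ⟨C, hC0, hC⟩ := norm_ev_le_interpolation L (η := η / (2 * (B + B' + 1))) (by positivity)
  have hlim := (tendsto_integral_relaxation he he0 hN h0 hT hψ fun k => hμ k T).const_mul
    (Real.exp (K * T))
  rw [mul_zero] at hlim
  have hδ : (0 : ℝ) < (η / (2 * (C + 1))) ^ 2 := by positivity
  filter_upwards [hlim.eventually_lt_const hδ] with k hk t ht x
  have h1 : ‖toL2 L (freeFlow L t (u k t).1 - freeFlow L t (v t))‖ ≤ η / (2 * (C + 1)) :=
    (pow_le_pow_iff_left₀ (norm_nonneg _) (by positivity) two_ne_zero).1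
      ((hcomp k t ht).trans hk.le)
  have h2 : ‖freeFlow L t (u k t).1 - freeFlow L t (v t)‖ ≤ B + B' := by
    rw [← map_sub, norm_freeFlow]
    exact (norm_sub_le _ _).trans (add_le_add (hB k t ht) (hB' t ht))
  rw [← ContinuousMap.sub_apply, ← map_sub]
  calc _ ≤ ‖ev L (freeFlow L t (u k t).1 - freeFlow L t (v t))‖ :=
        ContinuousMap.norm_coe_le_norm _ x
    _ ≤ η / (2 * (B + B' + 1)) * (B + B') + C * (η / (2 * (C + 1))) := by
        refine (hC _).trans ?_
        gcongr
    _ ≤ η / (2 * (B + B' + 1)) * (B + B' + 1) + (C + 1) * (η / (2 * (C + 1))) := by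
        exact add_le_add (mul_le_mul_of_nonneg_left (by linarith) (by positivity))
          (mul_le_mul_of_nonneg_right (by linarith) (by positivity))
    _ = η := by field_simp; ring

/-- At positive times the densities converge pointwise to the adiabatic density. -/
theorem tendsto_density (he : ∀ k, 0 < e k) (he0 : Tendsto e atTop (𝓝 0)) (hN : c.P / c.β ≤ N)
    (h0 : IsDensity L N m₀) (hu : ∀ k, IsTrajectory (gpField L c (e k)) (a₀, m₀) T (u k))
    (hv : ∀ T, IsTrajectory (adiabaticField L c) a₀ T v) {t : ℝ} (ht : t ∈ Ioc 0 T)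
    (x : AddCircle L) :
    Tendsto (fun k => (ev L (u k t).2 x).re) atTop
      (𝓝 (adiabaticDensity c (ev L (freeFlow L t (v t)) x))) := by
  have hβ := c.β_pos
  have hR := c.R_pos
  have hT : 0 ≤ T := ht.1.le.trans ht.2
  have hsub : Icc 0 t ⊆ Icc 0 T := Icc_subset_Icc_right ht.2
  have hre : ∀ k, ∀ τ ∈ Icc 0 T, 0 ≤ (ev L (u k τ).2 x).re ∧ (ev L (u k τ).2 x).re ≤ N :=
    fun k τ hτ => by
      obtain ⟨r, hr, h⟩ := gp_isDensity (he k) hN h0 (hu k) τ hτ x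
      rwa [hr, Complex.ofReal_re]
  refine tendsto_relaxation (N := N) (e := e) (y := fun k τ => (ev L (u k τ).2 x).re)
      (b := fun k τ => c.β + c.R * ‖ev L (freeFlow L τ (u k τ).1) x‖ ^ 2)
      (b₀ := c.β + c.R * ‖ev L (freeFlow L t (v t)) x‖ ^ 2)
      c.P_pos (by positivity) ht.1 he he0
      (fun k τ hτ => (hasDerivWithinAt_re_density (ψ := fun τ => freeFlow L τ (u k τ).1)
        (n := fun τ => (u k τ).2) (gp_deriv_snd (hu k) τ (hsub hτ)) x).mono hsub)
      (fun k τ hτ => (hre k τ (hsub hτ)).1) (fun k τ hτ => (hre k τ (hsub hτ)).2)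
      (fun η hη => ?_)
  have hcz : Continuous fun z : ℂ => c.β + c.R * ‖z‖ ^ 2 := by fun_prop
  obtain ⟨ρ, hρ, hz⟩ := Metric.continuous_iff.1 hcz (ev L (freeFlow L t (v t)) x) η hη
  have hvc : ContinuousOn v (Icc 0 T) := (hv T).continuousOn
  have hψ := continuousOn_ev_apply (ψ := fun t => freeFlow L t (v t)) (continuousOn_wave hvc) x
  obtain ⟨δ, hδ, h⟩ :=
    Metric.continuousOn_iff.1 hψ t (Ioc_subset_Icc_self ht) (ρ / 2) (by positivity)
  refine ⟨δ / 2, by positivity, ?_⟩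
  filter_upwards [tendsto_wave he he0 hN h0 hT hu hv (ρ / 3) (by positivity)] with k hk τ hτ hτ'
  refine (hz _ ?_).le
  have h1 := hk τ (hsub hτ) x
  have h2 := h τ (hsub hτ) (by rw [Real.dist_eq, abs_lt]; constructor <;> linarith [hτ.2])
  rw [← dist_eq_norm] at h1
  linarith [dist_triangle (ev L (freeFlow L τ (u k τ).1) x) (ev L (freeFlow L τ (v τ)) x)
    (ev L (freeFlow L t (v t)) x)]

theorem continuousOn_ev_uncurry {a : ℝ → Coeff} {s : Set ℝ} (ha : ContinuousOn a s) :
    ContinuousOn (fun p : ℝ × AddCircle L => ev L (a p.1) p.2) (s ×ˢ univ) := by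
  have h1 : ContinuousOn (fun p : ℝ × AddCircle L => ev L (a p.1)) (s ×ˢ univ) :=
    (ev L).continuous.comp_continuousOn (ha.comp continuousOn_fst fun p hp => hp.1)
  exact continuousOn_comp₂ (f := fun q : C(AddCircle L, ℂ) × AddCircle L => q.1 q.2)
    continuous_eval h1 continuousOn_snd

theorem tendstoInC_wave (he : ∀ k, 0 < e k) (he0 : Tendsto e atTop (𝓝 0)) (hN : c.P / c.β ≤ N)
    (h0 : IsDensity L N m₀) (hT : 0 ≤ T)
    (hu : ∀ k, IsTrajectory (gpField L c (e k)) (a₀, m₀) T (u k))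
    (hv : ∀ T, IsTrajectory (adiabaticField L c) a₀ T v) :
    TendstoInC T (fun k t => (ev L (freeFlow L t (u k t).1) : AddCircle L → ℂ))
      (fun t => ev L (freeFlow L t (v t))) := by
  have hvc : ContinuousOn v (Icc 0 T) := (hv T).continuousOn
  refine ⟨fun k => continuousOn_ev_uncurry (a := fun t => freeFlow L t (u k t).1)
      (gp_continuousOn_wave (hu k)),
    continuousOn_ev_uncurry (a := fun t => freeFlow L t (v t)) (continuousOn_wave hvc),
    Metric.tendstoUniformlyOn_iff.2 fun η hη => ?_⟩
  filter_upwards [tendsto_wave he he0 hN h0 hT hu hv (η / 2) (by positivity)] with k hk p hp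
  rw [dist_comm, dist_eq_norm]
  exact (hk p.1 hp.1 p.2).trans_lt (by linarith)

theorem tendstoWeakStar_density (he : ∀ k, 0 < e k) (he0 : Tendsto e atTop (𝓝 0))
    (hN : c.P / c.β ≤ N) (h0 : IsDensity L N m₀)
    (hu : ∀ k, IsTrajectory (gpField L c (e k)) (a₀, m₀) T (u k))
    (hv : ∀ T, IsTrajectory (adiabaticField L c) a₀ T v) :
    TendstoWeakStar T (fun k t (x : AddCircle L) => (ev L (u k t).2 x).re)
      (fun t x => adiabaticDensity c (ev L (freeFlow L t (v t)) x)) := by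
  have hsub : Ioo 0 T ×ˢ (univ : Set (AddCircle L)) ⊆ Icc 0 T ×ˢ univ :=
    prod_mono_left Ioo_subset_Icc_self
  have hms : MeasurableSet (Ioo 0 T ×ˢ (univ : Set (AddCircle L))) :=
    measurableSet_Ioo.prod MeasurableSet.univ
  have hk : ∀ k, ∀ᵐ p : ℝ × AddCircle L ∂volume.restrict (Ioo 0 T ×ˢ univ),
      ‖(ev L (u k p.1).2 p.2).re‖ ≤ N := fun k => ae_restrict_of_forall_mem hms fun p hp => by
    obtain ⟨r, hr, hr0, hrN⟩ := gp_isDensity (he k) hN h0 (hu k) p.1 (hsub hp).1 p.2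
    rw [hr, Complex.ofReal_re, Real.norm_of_nonneg hr0]
    exact hrN
  have hmeas : ∀ k, AEStronglyMeasurable (fun p : ℝ × AddCircle L => (ev L (u k p.1).2 p.2).re)
      (volume.restrict (Ioo 0 T ×ˢ univ)) := fun k =>
    ((Complex.continuous_re.comp_continuousOn (continuousOn_ev_uncurry (a := fun t => (u k t).2)
      (gp_continuousOn_density (hu k)))).mono hsub).aestronglyMeasurable hms
  have hvc : ContinuousOn v (Icc 0 T) := (hv T).continuousOn
  have hlim : ContinuousOn (fun p : ℝ × AddCircle L =>
      adiabaticDensity c (ev L (freeFlow L p.1 (v p.1)) p.2)) (Icc 0 T ×ˢ univ) :=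
    (continuous_adiabaticDensity c).comp_continuousOn
      (continuousOn_ev_uncurry (a := fun t => freeFlow L t (v t)) (continuousOn_wave hvc))
  refine ⟨fun k => memLp_top_of_bound (hmeas k) N (hk k),
    memLp_top_of_bound ((hlim.mono hsub).aestronglyMeasurable hms) N
      (Eventually.of_forall fun p => ?_), fun φ hφ => ?_⟩
  · rw [Real.norm_of_nonneg (adiabaticDensity_pos c _).le]
    exact (adiabaticDensity_le c _).trans hN
  · refine tendsto_integral_of_dominated_convergence (fun p => N * ‖φ p‖)
      (fun k => (hmeas k).mul hφ.aestronglyMeasurable) (hφ.norm.const_mul N) (fun k => ?_) ?_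
    · filter_upwards [hk k] with p hp
      rw [norm_mul]
      gcongr
    · refine ae_restrict_of_forall_mem hms fun p hp => ?_
      exact (tendsto_density he he0 hN h0 hu hv ⟨hp.1.1, hp.1.2.le⟩ p.2).mul_const _

end Limit

theorem energy_ev_lt_top (c : Constants) (a : Coeff) {n : AddCircle L → ℝ} (hn : Continuous n) :
    energy c (ev L a : AddCircle L → ℂ) n < ⊤ := by
  refine ENNReal.add_lt_top.2 ⟨?_, ?_⟩
  · have hs : Summable fun k : ℤ =>
        L / 2 * waveNumber L k ^ 2 * ‖fourierCoeff (ev L a : AddCircle L → ℂ) k‖ ^ 2 := by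
      have hL0 := hL.out
      refine Summable.of_nonneg_of_le (fun k => by positivity) (fun k => ?_)
        ((memH1_ev (L := L) a).summable.mul_left (L / 2))
      rw [mul_assoc]
      gcongr
      linarith
    exact hs.tsum_ofReal_lt_top
  · have hc : Continuous fun x => c.g / 2 * ‖ev L a x‖ ^ 4 + c.lam * n x * ‖ev L a x‖ ^ 2 := by
      fun_prop
    exact (integrableOn_univ.1
      (hc.continuousOn.integrableOn_compact isCompact_univ)).lintegral_lt_top

end

end GrossPitaevskii

end

open GrossPitaevskii in
theorem proposition5p2 (L : ℝ) [Fact (0 < L)] (c : Constants)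
    (ψ₀ : AddCircle L → ℂ) (hψ₀ : MemH1 ψ₀) :
    ∃ ψ : ℝ → AddCircle L → ℂ,
      IsAdiabaticSolution c ψ₀ (Ici 0) ψ ∧
      (∀ t, 0 ≤ t → energy c (ψ t) (fun x => adiabaticDensity c (ψ t x)) < ⊤) ∧
      (∀ T : ℝ, 0 < T →
        IsAdiabaticSolution c ψ₀ (Icc 0 T) ψ ∧
        ∀ χ : ℝ → AddCircle L → ℂ, IsAdiabaticSolution c ψ₀ (Icc 0 T) χ →
          ∀ t ∈ Icc 0 T, χ t = ψ t) ∧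
      ∀ n₀ : AddCircle L → ℝ, MemH1 (fun x => (n₀ x : ℂ)) → (∀ x, 0 < n₀ x) →
        ∃ (ψε : ℝ → ℝ → AddCircle L → ℂ) (nε : ℝ → ℝ → AddCircle L → ℝ),
          (∀ ε : ℝ, 0 < ε →
            IsGPSolution c ε ψ₀ n₀ (Ici 0) (ψε ε) (nε ε) ∧
            ∀ (χ : ℝ → AddCircle L → ℂ) (m : ℝ → AddCircle L → ℝ),
              IsGPSolution c ε ψ₀ n₀ (Ici 0) χ m →
                ∀ t, 0 ≤ t → χ t = ψε ε t ∧ m t = nε ε t) ∧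
          ∀ e : ℕ → ℝ, (∀ k, 0 < e k) → Tendsto e atTop (𝓝 0) →
            ∃ σ : ℕ → ℕ, StrictMono σ ∧
              ∃ n : ℝ → AddCircle L → ℝ,
                (∀ t x, 0 ≤ t → n t x = adiabaticDensity c (ψ t x)) ∧
                ∀ T : ℝ, 0 ≤ T →
                  TendstoInC T (fun k => ψε (e (σ k))) ψ ∧
                  TendstoWeakStar T (fun k => nε (e (σ k))) n := by
  obtain ⟨a₀, rfl⟩ := exists_ev_eq hψ₀
  obtain ⟨v, hv⟩ := adiabatic_exists_global (L := L) c a₀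
  have hsol := isAdiabaticSolution_of_trajectory hv
  refine ⟨fun t => ev L (freeFlow L t (v t)), hsol, fun t _ => ?_, fun T hT => ⟨?_, ?_⟩, ?_⟩
  · exact energy_ev_lt_top c _ ((continuous_adiabaticDensity c).comp (map_continuous _))
  · exact hsol.mono Icc_subset_Ici_self
  · intro χ hχ t ht
    obtain ⟨w, hw, hχw⟩ := hχ.exists_trajectory hT.le
    rw [hχw t ht, hw.eqOn (locallyLipField_adiabaticField c) (hv T) ht]
  intro n₀ hn₀ hpos
  obtain ⟨m₀, hm₀⟩ := exists_ev_eq hn₀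
  have hm₀' : ∀ x, ev L m₀ x = n₀ x := congrFun hm₀
  set N := max (c.P / c.β) ‖ev L m₀‖ with hNdef
  have hN : c.P / c.β ≤ N := le_max_left _ _
  have h0 : IsDensity L N m₀ := fun x => ⟨n₀ x, hm₀' x, (hpos x).le, by
    have := (ev L m₀).norm_coe_le_norm x
    rw [hm₀' x, Complex.norm_real, Real.norm_of_nonneg (hpos x).le] at this
    exact this.trans (le_max_right _ _)⟩
  -- a family of solutions is chosen for all real `ε`, with an arbitrary value for `ε ≤ 0`
  have hex : ∀ ε : ℝ, ∃ u : ℝ → Coeff × Coeff, 0 < ε →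
      ∀ T, IsTrajectory (gpField L c ε) (a₀, m₀) T u := fun ε => by
    by_cases hε : 0 < ε
    · obtain ⟨u, hu⟩ := gp_exists_global (ψ₀ := a₀) hε hN h0
      exact ⟨u, fun _ => hu⟩
    · exact ⟨0, fun h => absurd h hε⟩
  choose u hu using hex
  -- the limit is the solution `ψ` found above, so the whole sequence converges and `σ = id` works
  refine ⟨fun ε t => ev L (freeFlow L t (u ε t).1), fun ε t x => (ev L (u ε t).2 x).re,
    fun ε hε => ⟨isGPSolution_of_trajectory hε hN h0 hm₀' (hu ε hε), fun χ m hχ t ht => ?_⟩,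
    fun e he he0 => ⟨id, strictMono_id, fun t x => adiabaticDensity c (ev L (freeFlow L t (v t)) x),
      fun _ _ _ => rfl, fun T hT => ⟨?_, ?_⟩⟩⟩
  · obtain ⟨w, hw, hχw⟩ := hχ.exists_trajectory ht hm₀'
    have htt : t ∈ Icc 0 t := right_mem_Icc.2 ht
    have heq := hw.eqOn (locallyLipField_gpField c ε) (hu ε hε t) htt
    simp only [← heq]
    exact ⟨(hχw t htt).1, funext (hχw t htt).2⟩
  · exact tendstoInC_wave he he0 hN h0 hT (fun k => hu (e k) (he k) T) hv
  · exact tendstoWeakStar_density he he0 hN h0 (fun k => hu (e k) (he k) T) hv
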